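/- Let $k=\mathbb F_q$ be a finite field, $t=+\sqrt q$, and let $\mathcal A$ be a $k$-linear abelian category such that: (a) $\mathcal A$ is essentially small and all sets $\operatorname{Hom}_{\mathcal A}(X,Y)$ are finite; (b) $\mathcal A$ is linear over $k$; (c) $\mathcal A$ has finite global dimension and enough projectives; (d) $\mathcal A$ is hereditary, i.e. $\operatorname{Ext}^i_{\mathcal A}=0$ for $i\ge 2$; (e) every nonzero object has nonzero class in the Grothendieck group $K(\mathcal A)$. Write $[X]$ also for the class of $X$ in $K(\mathcal A)$, let $\langle X,Y\rangle=\sum_i(-1)^i\dim_k\operatorname{Ext}^i_{\mathcal A}(X,Y)$ be the Euler form, which descends to $K(\mathcal A)$, and put $(\alpha,\beta)=\langle\alpha,\beta\rangle+\langle\beta,\alpha\rangle$. *Hall algebras of $\mathcal A$.* $H_{tw}(\mathcal A)$ is the complex vector space with basis the isomorphism classes $[X]$ of objects of $\mathcal A$ and product $$[X]*[Z]=t^{\langle X,Z\rangle}\sum_{Y}\frac{|\operatorname{Ext}^1_{\mathcal A}(X,Z)_Y|}{|\operatorname{Hom}_{\mathcal A}(X,Z)|}\,[Y],$$ where $\operatorname{Ext}^1(X,Z)_Y\subset\operatorname{Ext}^1(X,Z)$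 is the set of classes of extensions $0\to Z\to E\to X\to 0$ with $E\cong Y$; its unit is $[0]$. $H^e_{tw}(\mathcal A)$ is the algebra obtained from $H_{tw}(\mathcal A)$ by adjoining symbols $K_\alpha$, $\alpha\in K(\mathcal A)$, with relations $K_0=1$, $K_\alpha*K_\beta=K_{\alpha+\beta}$, $K_\alpha*[B]=t^{(\alpha,[B])}[B]*K_\alpha$. *Hall algebras of complexes.* Let $\mathcal C(\mathcal A)$ be the abelian category of $\mathbb Z/2$-graded complexes $M_1\overset{d_1}{\underset{d_0}{\rightleftarrows}}M_0$ ($d_1d_0=0=d_0d_1$) in $\mathcal A$ and $\mathcal C(\mathcal P)$ its full subcategory of complexes of projectives. The shift $M\mapsto M^\dagger$ exchanges the two degrees and changes the sign of the differential. $H_{tw}(\mathcal C(\mathcal P))$ is the complex vector space with basis the isomorphism classes of $\mathcal C(\mathcal P)$ and product $$[M]*[N]=t^{\langle M_0,N_0\rangle+\langle M_1,N_1\rangle}\sum_{L}\frac{|\operatorname{Ext}^1_{\mathcal C(\mathcal A)}(M,N)_L|}{|\operatorname{Hom}_{\mathcal C(\mathcal A)}(M,N)|}\,[L].$$ $DH(\mathcal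 A)$ is its localization at the classes of all acyclic complexes, and $DH_{red}(\mathcal A)$ is the quotient of $DH(\mathcal A)$ by the relations $[M]=1$ for all acyclic $M$ with $M\cong M^\dagger$. *The maps.* For a projective object $P$ let $K_P$ be the acyclic complex with $P$ in both degrees, $d_1=1$ and $d_0=0$. For $\alpha\in K(\mathcal A)$, written $\alpha=[P]-[Q]$ with $P,Q$ projective, put $K_\alpha=[K_P]*[K_Q]^{-1}$ and $K_\alpha^\dagger=[K_P^\dagger]*[K_Q^\dagger]^{-1}$ in $DH(\mathcal A)$. For an object $X$ with a projective resolution $0\to P\xrightarrow{f}Q\to X\to 0$ (for instance a minimal one), let $C=(P\overset{f}{\underset{0}{\rightleftarrows}}Q)$ with $P$ in degree $1$ and $Q$ in degree $0$, and put $$E_X=t^{\langle P,X\rangle}[K_P]^{-1}*[C],\qquad F_X=t^{\langle P,X\rangle}[K_P^\dagger]^{-1}*[C^\dagger].$$ Then these elements do not depend on the choices made, and there are unique algebra homomorphisms $I^e_+,I^e_-\colon H^e_{tw}(\mathcal A)\to DH(\mathcal A)$ with $I^e_+([X])=E_X$, $I^e_+(K_\alpha)=K_\alpha$ and $I^e_-([X])=F_X$,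 $I^e_-(K_\alpha)=K^\dagger_\alpha$ for all objects $X$ and all $\alpha\in K(\mathcal A)$. Moreover: 1. the linear map $H^e_{tw}(\mathcal A)\otimes_{\mathbb C}H^e_{tw}(\mathcal A)\to DH(\mathcal A)$, $a\otimes b\mapsto I^e_+(a)*I^e_-(b)$, is an isomorphism of vector spaces; 2. the linear map $H_{tw}(\mathcal A)\otimes_{\mathbb C}\mathbb C[K(\mathcal A)]\otimes_{\mathbb C}H_{tw}(\mathcal A)\to DH_{red}(\mathcal A)$, $[X]\otimes\alpha\otimes[Y]\mapsto E_X*K_\alpha*F_Y$, is an isomorphism of vector spaces. -/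

import Mathlib

open CategoryTheory CategoryTheory.Limits CategoryTheory.Abelian
open scoped TensorProduct ZeroObject

universe v u w

noncomputable section

namespace HallComplexes

/-! ### Isomorphism classes and Yoneda extensions -/

/-- The isomorphism classes of objects of a category. -/
abbrev IsoCl (C : Type u) [Category.{v} C] : Type u := Quotient (isIsomorphicSetoid C)

/-- The isomorphism class of an object. -/
def isoCl {C : Type u} [Category.{v} C] (X : C) : IsoCl C :=
  Quotient.mk (isIsomorphicSetoid C) X

/-- A (Yoneda) extension `0 ⟶ Z ⟶ Y ⟶ X ⟶ 0` of `X` by `Z` in an abelian category. -/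
structure Extension {C : Type u} [Category.{v} C] [Abelian C] (X Z : C) where
  /-- the middle term -/
  mid : C
  /-- the inclusion of the sub-object -/
  i : Z ⟶ mid
  /-- the projection to the quotient -/
  p : mid ⟶ X
  w : i ≫ p = 0
  shortExact : (ShortComplex.mk i p w).ShortExact

/-- Two extensions of `X` by `Z` are equivalent if their middle terms are isomorphic by an
isomorphism compatible with the identities of `X` and `Z`. -/
def extensionSetoid {C : Type u} [Category.{v} C] [Abelian C] (X Z : C) :
    Setoid (Extension X Z) where
  r E F := ∃ φ : E.mid ≅ F.mid, E.i ≫ φ.hom = F.i ∧ φ.hom ≫ F.p = E.p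
  iseqv :=
    { refl := fun E => ⟨Iso.refl _, by simp, by simp⟩
      symm := by
        rintro E F ⟨φ, h₁, h₂⟩
        exact ⟨φ.symm, by simp [← h₁], by simp [← h₂]⟩
      trans := by
        rintro E F G ⟨φ, h₁, h₂⟩ ⟨ψ, h₃, h₄⟩
        exact ⟨φ ≪≫ ψ, by simp [reassoc_of% h₁, h₃], by simp [h₄, h₂]⟩ }

/-- The set `Ext¹(X, Z)` of equivalence classes of extensions `0 ⟶ Z ⟶ Y ⟶ X ⟶ 0`. -/
def YExt {C : Type u} [Category.{v} C] [Abelian C] (X Z : C) : Type (max u v) :=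
  Quotient (extensionSetoid X Z)

/-- The subset `Ext¹(X, Z)_Y` of `Ext¹(X, Z)` of the classes of the extensions whose middle term
is isomorphic to `Y`. -/
def extWithMiddle {C : Type u} [Category.{v} C] [Abelian C] (X Z Y : C) : Set (YExt X Z) :=
  {ξ | ∃ E : Extension X Z, Quotient.mk (extensionSetoid X Z) E = ξ ∧ Nonempty (E.mid ≅ Y)}

/-- The structure constant `|Ext¹(X, Z)_Y| / |Hom(X, Z)|` of the Hall algebra. -/
def hallNumber {C : Type u} [Category.{v} C] [Abelian C] (X Z Y : C) : ℂ :=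
  (Nat.card (extWithMiddle X Z Y) : ℂ) / (Nat.card (X ⟶ Z) : ℂ)

/-! ### The Grothendieck group and the Euler form -/

/-- The subgroup generated by `[Y] - [X] - [Z]` for the short exact sequences
`0 ⟶ X ⟶ Y ⟶ Z ⟶ 0`. -/
def exactRelations (A : Type u) [Category.{v} A] [Abelian A] :
    AddSubgroup (FreeAbelianGroup A) :=
  AddSubgroup.closure {x | ∃ S : ShortComplex A, S.ShortExact ∧
    x = FreeAbelianGroup.of S.X₂ - FreeAbelianGroup.of S.X₁ - FreeAbelianGroup.of S.X₃}

/-- The Grothendieck group `K(A)` of an abelian category. -/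
abbrev K₀ (A : Type u) [Category.{v} A] [Abelian A] : Type u :=
  FreeAbelianGroup A ⧸ exactRelations A

/-- The class of an object in the Grothendieck group. -/
def cl {A : Type u} [Category.{v} A] [Abelian A] (X : A) : K₀ A :=
  QuotientAddGroup.mk (FreeAbelianGroup.of X)

/-- `dim_k Ext^i(X, Y)`. -/
def extDim (k : Type w) [Field k] {A : Type u} [Category.{v} A] [Abelian A] [Linear k A]
    (X Y : A) (i : ℕ) : ℕ :=
  letI := HasExt.standard A
  Module.finrank k (Ext.{max u v} X Y i)

/-- The Euler form `⟨X, Y⟩ = ∑ᵢ (-1)ⁱ dim_k Extⁱ(X, Y)` of two objects. -/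
def euler (k : Type w) [Field k] {A : Type u} [Category.{v} A] [Abelian A] [Linear k A]
    (X Y : A) : ℤ :=
  ∑ᶠ i : ℕ, (-1) ^ i * (extDim k X Y i : ℤ)

section EulerForm

variable (k : Type w) [Field k] {A : Type u} [Category.{v} A] [Abelian A] [Linear k A]

lemma sixTerm {V₁ V₂ V₃ V₄ V₅ V₆ : Type*}
    [AddCommGroup V₁] [Module k V₁] [Module.Finite k V₁]
    [AddCommGroup V₂] [Module k V₂] [Module.Finite k V₂]
    [AddCommGroup V₃] [Module k V₃] [Module.Finite k V₃]
    [AddCommGroup V₄] [Module k V₄] [Module.Finite k V₄]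
    [AddCommGroup V₅] [Module k V₅] [Module.Finite k V₅]
    [AddCommGroup V₆] [Module k V₆] [Module.Finite k V₆]
    (f₁ : V₁ →ₗ[k] V₂) (f₂ : V₂ →ₗ[k] V₃) (f₃ : V₃ →ₗ[k] V₄) (f₄ : V₄ →ₗ[k] V₅)
    (f₅ : V₅ →ₗ[k] V₆) (h₁ : Function.Injective f₁) (h₁₂ : Function.Exact f₁ f₂)
    (h₂₃ : Function.Exact f₂ f₃) (h₃₄ : Function.Exact f₃ f₄) (h₄₅ : Function.Exact f₄ f₅)
    (h₅ : Function.Surjective f₅) :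
    (Module.finrank k V₂ : ℤ) - Module.finrank k V₅ =
      ((Module.finrank k V₁ : ℤ) - Module.finrank k V₄) +
      ((Module.finrank k V₃ : ℤ) - Module.finrank k V₆) := by
  have e₁ := f₁.finrank_range_add_finrank_ker
  have e₂ := f₂.finrank_range_add_finrank_ker
  have e₃ := f₃.finrank_range_add_finrank_ker
  have e₄ := f₄.finrank_range_add_finrank_ker
  have e₅ := f₅.finrank_range_add_finrank_ker
  rw [LinearMap.ker_eq_bot.2 h₁, finrank_bot] at e₁
  rw [h₁₂.linearMap_ker_eq] at e₂
  rw [h₂₃.linearMap_ker_eq] at e₃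
  rw [h₃₄.linearMap_ker_eq] at e₄
  rw [h₄₅.linearMap_ker_eq, LinearMap.range_eq_top.2 h₅, finrank_top] at e₅
  omega

lemma finite_ext [EnoughProjectives A] [∀ X Y : A, Finite (X ⟶ Y)] [HasExt.{max u v} A]
    (X Y : A) (n : ℕ) : Module.Finite k (Ext.{max u v} X Y n) := by
  induction n generalizing X Y with
  | zero =>
    have : Module.Finite k (X ⟶ Y) := Module.Finite.of_finite
    exact Module.Finite.equiv (Ext.linearEquiv₀ (R := k) (X := X) (Y := Y)).symm
  | succ n hn =>
    let S := ShortComplex.mk _ _ (kernel.condition (Projective.π X))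
    have hS : S.ShortExact :=
      { exact := ShortComplex.exact_of_f_is_kernel _ (kernelIsKernel S.g) }
    have hs : Function.Surjective
        (Ext.precompOfLinear hS.extClass k Y (add_comm 1 n)) := fun x₃ =>
      Ext.contravariant_sequence_exact₃ hS Y x₃ (Ext.eq_zero_of_projective _) (by lia)
    have := hn (kernel (Projective.π X)) Y
    exact Module.Finite.of_surjective _ hs

lemma euler_eq [∀ X : A, HasProjectiveDimensionLE X 1] [HasExt.{max u v} A] (X Y : A) :
    euler k X Y = (Module.finrank k (Ext.{max u v} X Y 0) : ℤ)
      - Module.finrank k (Ext.{max u v} X Y 1) := by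
  have h : ∀ i, 2 ≤ i → extDim k X Y i = 0 := by
    intro i hi
    have : Subsingleton (Ext.{max u v} X Y i) :=
      HasProjectiveDimensionLT.subsingleton X 2 i hi Y
    exact Module.finrank_zero_of_subsingleton
  unfold euler
  rw [finsum_eq_sum_of_support_subset (s := Finset.range 2)]
  · simp [Finset.sum_range_succ, extDim, sub_eq_add_neg]
  · intro i hi
    by_contra hc
    simp only [Finset.coe_range, Set.mem_Iio, not_lt] at hc
    exact hi (by simp [h i hc])

variable [EnoughProjectives A] [∀ X Y : A, Finite (X ⟶ Y)] [∀ X : A, HasProjectiveDimensionLE X 1]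

lemma euler_add_right (X : A) {S : ShortComplex A} (hS : S.ShortExact) :
    euler k X S.X₂ = euler k X S.X₁ + euler k X S.X₃ := by
  let := HasExt.standard A
  have := finite_ext k (A := A)
  have := hS.mono_f
  rw [euler_eq, euler_eq, euler_eq]
  refine sixTerm k (Ext.postcompOfLinear (Ext.mk₀ S.f) k X (add_zero 0))
    (Ext.postcompOfLinear (Ext.mk₀ S.g) k X (add_zero 0))
    (Ext.postcompOfLinear hS.extClass k X (zero_add 1))
    (Ext.postcompOfLinear (Ext.mk₀ S.f) k X (add_zero 1))
    (Ext.postcompOfLinear (Ext.mk₀ S.g) k X (add_zero 1))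
    (Ext.postcomp_mk₀_injective_of_mono X S.f)
    ((ShortComplex.ab_exact_iff_function_exact _).1 (Ext.covariant_sequence_exact₂' X hS 0))
    ((ShortComplex.ab_exact_iff_function_exact _).1
      (Ext.covariant_sequence_exact₃' X hS 0 1 (zero_add 1)))
    ((ShortComplex.ab_exact_iff_function_exact _).1
      (Ext.covariant_sequence_exact₁' X hS 0 1 (zero_add 1)))
    ((ShortComplex.ab_exact_iff_function_exact _).1 (Ext.covariant_sequence_exact₂' X hS 1)) ?_
  intro x
  exact Ext.covariant_sequence_exact₃ X hS x (by lia)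
    (Ext.eq_zero_of_hasProjectiveDimensionLT _ 2 le_rfl)

lemma euler_add_left (Y : A) {S : ShortComplex A} (hS : S.ShortExact) :
    euler k S.X₂ Y = euler k S.X₁ Y + euler k S.X₃ Y := by
  let := HasExt.standard A
  have := finite_ext k (A := A)
  have := hS.epi_g
  rw [euler_eq, euler_eq, euler_eq, add_comm]
  refine sixTerm k (Ext.precompOfLinear (Ext.mk₀ S.g) k Y (zero_add 0))
    (Ext.precompOfLinear (Ext.mk₀ S.f) k Y (zero_add 0))
    (Ext.precompOfLinear hS.extClass k Y (add_zero 1))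
    (Ext.precompOfLinear (Ext.mk₀ S.g) k Y (zero_add 1))
    (Ext.precompOfLinear (Ext.mk₀ S.f) k Y (zero_add 1))
    (Ext.precomp_mk₀_injective_of_epi Y S.g)
    ((ShortComplex.ab_exact_iff_function_exact _).1 (Ext.contravariant_sequence_exact₂' hS Y 0))
    ((ShortComplex.ab_exact_iff_function_exact _).1
      (Ext.contravariant_sequence_exact₁' hS Y 0 1 (add_zero 1)))
    ((ShortComplex.ab_exact_iff_function_exact _).1
      (Ext.contravariant_sequence_exact₃' hS Y 0 1 (add_zero 1)))
    ((ShortComplex.ab_exact_iff_function_exact _).1 (Ext.contravariant_sequence_exact₂' hS Y 1)) ?_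
  intro x
  exact Ext.contravariant_sequence_exact₁ hS Y x (by lia)
    (Ext.eq_zero_of_hasProjectiveDimensionLT _ 2 le_rfl)

/-- The homomorphism `⟨X, -⟩` on the Grothendieck group. -/
def eulerRight (X : A) : K₀ A →+ ℤ :=
  QuotientAddGroup.lift (exactRelations A) (FreeAbelianGroup.lift fun Y : A => euler k X Y)
    ((AddSubgroup.closure_le _).2 (by
      rintro _ ⟨S, hS, rfl⟩
      simp [euler_add_right k X hS]))

lemma eulerRight_cl (X Y : A) : eulerRight k X (cl Y) = euler k X Y := by
  change FreeAbelianGroup.lift (fun Y : A => euler k X Y) (FreeAbelianGroup.of Y) = _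
  simp

variable (A) in
/-- The Euler form on the Grothendieck group, induced by the Euler form of objects. -/
def eulerK : K₀ A →+ K₀ A →+ ℤ :=
  QuotientAddGroup.lift (exactRelations A) (FreeAbelianGroup.lift fun X : A => eulerRight k X)
    ((AddSubgroup.closure_le _).2 (by
      rintro _ ⟨S, hS, rfl⟩
      rw [SetLike.mem_coe, AddMonoidHom.mem_ker]
      apply QuotientAddGroup.addMonoidHom_ext
      ext Y
      change (FreeAbelianGroup.lift (fun X : A => eulerRight k X)
        (FreeAbelianGroup.of S.X₂ - FreeAbelianGroup.of S.X₁ - FreeAbelianGroup.of S.X₃))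
          (cl Y) = 0
      simp [eulerRight_cl, euler_add_left k Y hS]))

lemma eulerK_cl (X Y : A) : eulerK k A (cl X) (cl Y) = euler k X Y := by
  change (FreeAbelianGroup.lift (fun X : A => eulerRight k X) (FreeAbelianGroup.of X)) (cl Y) = _
  simp [eulerRight_cl]

variable (A) in
/-- The symmetrised Euler form `(α, β) = ⟨α, β⟩ + ⟨β, α⟩`. -/
def symEuler (α β : K₀ A) : ℤ := eulerK k A α β + eulerK k A β α

end EulerForm

/-- The number `t = √q`, where `q` is the cardinality of the finite field `k`. -/
def tPar (k : Type w) : ℂ := ((Real.sqrt (Nat.card k) : ℝ) : ℂ)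

/-! ### The twisted Hall algebra of `A` -/

section HallA

variable (k : Type w) [Field k] (A : Type u) [Category.{v} A] [Abelian A] [Linear k A]

/-- The twisted Hall algebra `H_tw(A)`: the complex vector space with basis `Iso(A)`. -/
def HTw (k : Type w) [Field k] (A : Type u) [Category.{v} A] [Abelian A] [Linear k A] :
    Type u :=
  IsoCl A →₀ ℂ

instance : AddCommGroup (HTw k A) := inferInstanceAs (AddCommGroup (IsoCl A →₀ ℂ))
instance : Module ℂ (HTw k A) := inferInstanceAs (Module ℂ (IsoCl A →₀ ℂ))

variable {A} in
/-- The basis element `[X]` of `H_tw(A)`. -/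
def HTw.of (X : A) : HTw k A := Finsupp.single (isoCl X) (1 : ℂ)

/-- The twisted Hall product
`[X] * [Z] = t ^ ⟨X, Z⟩ · ∑_Y |Ext¹(X, Z)_Y| / |Hom(X, Z)| · [Y]`, extended bilinearly. -/
def HTw.mulLin : HTw k A →ₗ[ℂ] HTw k A →ₗ[ℂ] HTw k A :=
  Finsupp.lsum ℂ fun x => LinearMap.toSpanSingleton ℂ _ (Finsupp.lsum ℂ fun z =>
    LinearMap.toSpanSingleton ℂ _
      (tPar k ^ euler k x.out z.out •
        ∑ᶠ y : IsoCl A, hallNumber x.out z.out y.out • HTw.of k y.out))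

instance : Mul (HTw k A) := ⟨fun x y => HTw.mulLin k A x y⟩
instance : One (HTw k A) := ⟨HTw.of k (0 : A)⟩

end HallA

/-! ### The extended twisted Hall algebra of `A` -/

section HallAExt

variable (k : Type w) [Field k] (A : Type u) [Category.{v} A] [Abelian A] [Linear k A]
  [EnoughProjectives A] [∀ X Y : A, Finite (X ⟶ Y)] [∀ X : A, HasProjectiveDimensionLE X 1]

/-- The defining relations of the extended twisted Hall algebra: those of `H_tw(A)`, together with
`K_0 = 1`, `K_α * K_β = K_{α+β}` and `K_α * [B] = t ^ (α, [B]) · [B] * K_α`. -/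
inductive HTwERel : FreeAlgebra ℂ (HTw k A ⊕ K₀ A) → FreeAlgebra ℂ (HTw k A ⊕ K₀ A) → Prop
  | add (x y : HTw k A) : HTwERel (FreeAlgebra.ι ℂ (Sum.inl (x + y)))
      (FreeAlgebra.ι ℂ (Sum.inl x) + FreeAlgebra.ι ℂ (Sum.inl y))
  | smul (c : ℂ) (x : HTw k A) : HTwERel (FreeAlgebra.ι ℂ (Sum.inl (c • x)))
      (c • FreeAlgebra.ι ℂ (Sum.inl x))
  | one : HTwERel (FreeAlgebra.ι ℂ (Sum.inl 1)) 1
  | mul (x y : HTw k A) : HTwERel (FreeAlgebra.ι ℂ (Sum.inl (x * y)))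
      (FreeAlgebra.ι ℂ (Sum.inl x) * FreeAlgebra.ι ℂ (Sum.inl y))
  | K_zero : HTwERel (FreeAlgebra.ι ℂ (Sum.inr 0)) 1
  | K_add (α β : K₀ A) : HTwERel (FreeAlgebra.ι ℂ (Sum.inr (α + β)))
      (FreeAlgebra.ι ℂ (Sum.inr α) * FreeAlgebra.ι ℂ (Sum.inr β))
  | K_comm (α : K₀ A) (B : A) : HTwERel
      (FreeAlgebra.ι ℂ (Sum.inr α) * FreeAlgebra.ι ℂ (Sum.inl (HTw.of k B)))
      (tPar k ^ symEuler k A α (cl B) •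
        (FreeAlgebra.ι ℂ (Sum.inl (HTw.of k B)) * FreeAlgebra.ι ℂ (Sum.inr α)))

/-- The extended twisted Hall algebra `H^e_tw(A)`: the complex algebra obtained from `H_tw(A)` by
adjoining the symbols `K_α`, `α ∈ K(A)`, subject to the relations above. -/
def HTwE : Type u := RingQuot (HTwERel k A)

instance : Ring (HTwE k A) := inferInstanceAs (Ring (RingQuot (HTwERel k A)))
instance : Algebra ℂ (HTwE k A) := inferInstanceAs (Algebra ℂ (RingQuot (HTwERel k A)))

variable {A}

/-- The generator `[X]` of `H^e_tw(A)`. -/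
def HTwE.of (X : A) : HTwE k A :=
  RingQuot.mkAlgHom ℂ (HTwERel k A) (FreeAlgebra.ι ℂ (Sum.inl (HTw.of k X)))

/-- The generator `K_α` of `H^e_tw(A)`. -/
def HTwE.K (α : K₀ A) : HTwE k A :=
  RingQuot.mkAlgHom ℂ (HTwERel k A) (FreeAlgebra.ι ℂ (Sum.inr α))

end HallAExt

/-! ### `ℤ/2`-graded complexes -/

section Complexes

variable (A : Type u) [Category.{v} A] [Abelian A]

/-- The abelian category `C(A)` of `ℤ/2`-graded complexes in `A`: objects `X 0`, `X 1` with
differentials `d 1 0 : X 1 ⟶ X 0` and `d 0 1 : X 0 ⟶ X 1` whose composites both vanish. -/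
abbrev Z2Cplx : Type (max u v) := HomologicalComplex A (ComplexShape.up (ZMod 2))

/-- The full subcategory `C(P)` of `C(A)` of the complexes of projective objects. -/
abbrev ProjCplx : Type (max u v) :=
  ObjectProperty.FullSubcategory (fun M : Z2Cplx A => ∀ i, Projective (M.X i))

variable {A}

/-- The two-term complex with `f : M₁ ⟶ M₀` in degrees `1 ⟶ 0` and `g : M₀ ⟶ M₁` in degrees
`0 ⟶ 1`. -/
def mkCplx {M₁ M₀ : A} (f : M₁ ⟶ M₀) (g : M₀ ⟶ M₁) (hfg : f ≫ g = 0) (hgf : g ≫ f = 0) :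
    Z2Cplx A where
  X i := match i with
    | (0 : Fin 2) => M₀
    | (1 : Fin 2) => M₁
  d i j := match i, j with
    | (0 : Fin 2), (1 : Fin 2) => g
    | (1 : Fin 2), (0 : Fin 2) => f
    | (0 : Fin 2), (0 : Fin 2) => 0
    | (1 : Fin 2), (1 : Fin 2) => 0
  shape i j h := by
    match i, j with
    | (0 : Fin 2), (1 : Fin 2) => exact absurd rfl h
    | (1 : Fin 2), (0 : Fin 2) => exact absurd rfl h
    | (0 : Fin 2), (0 : Fin 2) => rfl
    | (1 : Fin 2), (1 : Fin 2) => rfl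
  d_comp_d' i j l _ _ := by
    match i, j, l with
    | (0 : Fin 2), (1 : Fin 2), (0 : Fin 2) => exact hgf
    | (1 : Fin 2), (0 : Fin 2), (1 : Fin 2) => exact hfg
    | (0 : Fin 2), (0 : Fin 2), _ => exact zero_comp
    | (1 : Fin 2), (1 : Fin 2), _ => exact zero_comp
    | (0 : Fin 2), (1 : Fin 2), (1 : Fin 2) => exact comp_zero
    | (1 : Fin 2), (0 : Fin 2), (0 : Fin 2) => exact comp_zero

/-- The shift `M†` of a `ℤ/2`-graded complex: the grading is shifted and the sign of the
differential is changed. -/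
def dag (M : Z2Cplx A) : Z2Cplx A where
  X i := M.X (i + 1)
  d i j := -M.d (i + 1) (j + 1)
  shape i j h := by
    rw [M.shape, neg_zero]
    intro h'
    exact h (add_right_cancel h')
  d_comp_d' i j l _ _ := by simp

/-- The shift of a complex of projectives. -/
def ProjCplx.dag (M : ProjCplx A) : ProjCplx A :=
  ⟨HallComplexes.dag M.obj, fun i => M.property (i + 1)⟩

/-- The two-term complex of projectives with `f : M₁ ⟶ M₀` in degrees `1 ⟶ 0` and zero differential
in degrees `0 ⟶ 1`. -/
def ProjCplx.ofHom {M₁ M₀ : A} (h₁ : Projective M₁) (h₀ : Projective M₀) (f : M₁ ⟶ M₀) :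
    ProjCplx A :=
  ⟨mkCplx f 0 comp_zero zero_comp, fun i => match i with
    | (0 : Fin 2) => h₀
    | (1 : Fin 2) => h₁⟩

/-- The complex `K_P`, that is `P` in both degrees, with the identity in degrees `1 ⟶ 0`. -/
def ProjCplx.K {P : A} (hP : Projective P) : ProjCplx A := ProjCplx.ofHom hP hP (𝟙 P)

lemma ProjCplx.acyclic_K {P : A} (hP : Projective P) : (ProjCplx.K hP).obj.Acyclic := by
  intro i
  match i with
  | (0 : Fin 2) =>
    refine ((ProjCplx.K hP).obj.exactAt_iff' (1 : ZMod 2) (0 : ZMod 2) (1 : ZMod 2)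
      (ComplexShape.prev_eq' _ rfl) (ComplexShape.next_eq' _ rfl)).2 ?_
    exact (ShortComplex.exact_iff_epi _ rfl).2 (inferInstanceAs (Epi (𝟙 P)))
  | (1 : Fin 2) =>
    refine ((ProjCplx.K hP).obj.exactAt_iff' (0 : ZMod 2) (1 : ZMod 2) (0 : ZMod 2)
      (ComplexShape.prev_eq' _ rfl) (ComplexShape.next_eq' _ rfl)).2 ?_
    exact (ShortComplex.exact_iff_mono _ rfl).2 (inferInstanceAs (Mono (𝟙 P)))

lemma ProjCplx.acyclic_K_dag {P : A} (hP : Projective P) : (ProjCplx.K hP).dag.obj.Acyclic := by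
  intro i
  match i with
  | (0 : Fin 2) =>
    refine ((ProjCplx.K hP).dag.obj.exactAt_iff' (1 : ZMod 2) (0 : ZMod 2) (1 : ZMod 2)
      (ComplexShape.prev_eq' _ rfl) (ComplexShape.next_eq' _ rfl)).2 ?_
    exact (ShortComplex.exact_iff_mono _ (neg_zero (G := P ⟶ P))).2
      (inferInstanceAs (Mono (-𝟙 P)))
  | (1 : Fin 2) =>
    refine ((ProjCplx.K hP).dag.obj.exactAt_iff' (0 : ZMod 2) (1 : ZMod 2) (0 : ZMod 2)
      (ComplexShape.prev_eq' _ rfl) (ComplexShape.next_eq' _ rfl)).2 ?_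
    exact (ShortComplex.exact_iff_epi _ (neg_zero (G := P ⟶ P))).2
      (inferInstanceAs (Epi (-𝟙 P)))

/-- The zero complex. -/
def ProjCplx.zero : ProjCplx A := ⟨0, fun _ => by
  refine ⟨fun f e _ => ⟨0, ?_⟩⟩
  exact ((HomologicalComplex.eval A (ComplexShape.up (ZMod 2)) _).map_isZero
    (isZero_zero _)).eq_of_src _ _⟩

end Complexes

/-! ### The twisted Hall algebra of `C(P)` and its localization `DH(A)` -/

section HallC

variable (k : Type w) [Field k] (A : Type u) [Category.{v} A] [Abelian A] [Linear k A]

/-- The twisted Hall algebra `H_tw(C(P))`: the complex vector space with basis `Iso(C(P))`. -/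
def HTwC (k : Type w) [Field k] (A : Type u) [Category.{v} A] [Abelian A] [Linear k A] :
    Type (max u v) :=
  IsoCl (ProjCplx A) →₀ ℂ

instance : AddCommGroup (HTwC k A) := inferInstanceAs (AddCommGroup (IsoCl (ProjCplx A) →₀ ℂ))
instance : Module ℂ (HTwC k A) := inferInstanceAs (Module ℂ (IsoCl (ProjCplx A) →₀ ℂ))

variable {A} in
/-- The basis element `[M]` of `H_tw(C(P))`. -/
def HTwC.of (M : ProjCplx A) : HTwC k A := Finsupp.single (isoCl M) (1 : ℂ)

/-- The twisted Hall product
`[M] * [N] = t ^ (⟨M₀, N₀⟩ + ⟨M₁, N₁⟩) · ∑_L |Ext¹(M, N)_L| / |Hom(M, N)| · [L]`, where `Ext¹` and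
`Hom` are those of `C(A)`, extended bilinearly. -/
def HTwC.mulLin : HTwC k A →ₗ[ℂ] HTwC k A →ₗ[ℂ] HTwC k A :=
  Finsupp.lsum ℂ fun x => LinearMap.toSpanSingleton ℂ _ (Finsupp.lsum ℂ fun z =>
    LinearMap.toSpanSingleton ℂ _
      (tPar k ^ (euler k (x.out.obj.X 0) (z.out.obj.X 0) +
          euler k (x.out.obj.X 1) (z.out.obj.X 1)) •
        ∑ᶠ y : IsoCl (ProjCplx A),
          hallNumber x.out.obj z.out.obj y.out.obj • HTwC.of k y.out))

instance : Mul (HTwC k A) := ⟨fun x y => HTwC.mulLin k A x y⟩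
instance : One (HTwC k A) := ⟨HTwC.of k (ProjCplx.zero : ProjCplx A)⟩

/-- The acyclic complexes of projectives. -/
abbrev AcyclicCplx (A : Type u) [Category.{v} A] [Abelian A] : Type (max u v) :=
  {M : ProjCplx A // M.obj.Acyclic}

/-- The defining relations of the localization: those of `H_tw(C(P))`, and the symbol attached to an
acyclic complex `M` is a two-sided inverse of `[M]`. -/
inductive DHRel : FreeAlgebra ℂ (HTwC k A ⊕ AcyclicCplx A) →
    FreeAlgebra ℂ (HTwC k A ⊕ AcyclicCplx A) → Prop
  | add (x y : HTwC k A) : DHRel (FreeAlgebra.ι ℂ (Sum.inl (x + y)))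
      (FreeAlgebra.ι ℂ (Sum.inl x) + FreeAlgebra.ι ℂ (Sum.inl y))
  | smul (c : ℂ) (x : HTwC k A) : DHRel (FreeAlgebra.ι ℂ (Sum.inl (c • x)))
      (c • FreeAlgebra.ι ℂ (Sum.inl x))
  | one : DHRel (FreeAlgebra.ι ℂ (Sum.inl 1)) 1
  | mul (x y : HTwC k A) : DHRel (FreeAlgebra.ι ℂ (Sum.inl (x * y)))
      (FreeAlgebra.ι ℂ (Sum.inl x) * FreeAlgebra.ι ℂ (Sum.inl y))
  | mul_inv (M : AcyclicCplx A) : DHRel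
      (FreeAlgebra.ι ℂ (Sum.inl (HTwC.of k M.1)) * FreeAlgebra.ι ℂ (Sum.inr M)) 1
  | inv_mul (M : AcyclicCplx A) : DHRel
      (FreeAlgebra.ι ℂ (Sum.inr M) * FreeAlgebra.ι ℂ (Sum.inl (HTwC.of k M.1))) 1

/-- The localized Hall algebra `DH(A) = H_tw(C(P))[[M]⁻¹ : H_*(M) = 0]`, that is, the universal
complex algebra under `H_tw(C(P))` in which the classes of the acyclic complexes are invertible. -/
def DH : Type (max u v) := RingQuot (DHRel k A)

instance : Ring (DH k A) := inferInstanceAs (Ring (RingQuot (DHRel k A)))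
instance : Algebra ℂ (DH k A) := inferInstanceAs (Algebra ℂ (RingQuot (DHRel k A)))

variable {A} in
/-- The element `[M]` of `DH(A)`. -/
def DH.of (M : ProjCplx A) : DH k A :=
  RingQuot.mkAlgHom ℂ (DHRel k A) (FreeAlgebra.ι ℂ (Sum.inl (HTwC.of k M)))

variable {A} in
/-- The inverse in `DH(A)` of the class `[M]` of an acyclic complex `M`. -/
def DH.inv (M : ProjCplx A) (hM : M.obj.Acyclic) : DH k A :=
  RingQuot.mkAlgHom ℂ (DHRel k A) (FreeAlgebra.ι ℂ (Sum.inr ⟨M, hM⟩))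

/-- The reduced localized Hall algebra: the quotient of `DH(A)` by the relations `[M] = 1` for the
acyclic complexes `M` with `M ≅ M†`. -/
def DHRed : Type (max u v) :=
  RingQuot fun x y : DH k A =>
    ∃ M : ProjCplx A, M.obj.Acyclic ∧ Nonempty (M ≅ M.dag) ∧ x = DH.of k M ∧ y = 1

instance : Ring (DHRed k A) := inferInstanceAs (Ring (RingQuot _))
instance : Algebra ℂ (DHRed k A) := inferInstanceAs (Algebra ℂ (RingQuot _))

/-- The quotient map `DH(A) → DH_red(A)`. -/
def DHRed.mk : DH k A →ₐ[ℂ] DHRed k A := RingQuot.mkAlgHom ℂ _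

end HallC

/-! ### The maps `I_+^e` and `I_-^e` -/

/-- A projective resolution `0 ⟶ P ⟶ Q ⟶ X ⟶ 0`. -/
structure ProjRes {A : Type u} [Category.{v} A] [Abelian A] (X : A) where
  /-- the object in degree 1 -/
  P : A
  /-- the object in degree 0 -/
  Q : A
  projP : Projective P
  projQ : Projective Q
  f : P ⟶ Q
  g : Q ⟶ X
  w : f ≫ g = 0
  shortExact : (ShortComplex.mk f g w).ShortExact

/-- The complex of projectives `P ⟶ Q` in degrees `1 ⟶ 0` attached to a projective resolution. -/
def ProjRes.cplx {A : Type u} [Category.{v} A] [Abelian A] {X : A} (r : ProjRes X) : ProjCplx A :=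
  ProjCplx.ofHom r.projP r.projQ r.f

section Maps

variable (k : Type w) [Field k] {A : Type u} [Category.{v} A] [Abelian A] [Linear k A]

/-- The element `E_X = t ^ ⟨P, X⟩ · K_{-[P]} * [P ⟶ Q]` of `DH(A)`, computed with a projective
resolution `0 ⟶ P ⟶ Q ⟶ X ⟶ 0`. -/
def ProjRes.E {X : A} (r : ProjRes X) : DH k A :=
  tPar k ^ euler k r.P X •
    (DH.inv k (ProjCplx.K r.projP) (ProjCplx.acyclic_K r.projP) * DH.of k r.cplx)

/-- The element `F_X = E_X†` of `DH(A)`, computed with a projective resolution. -/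
def ProjRes.F {X : A} (r : ProjRes X) : DH k A :=
  tPar k ^ euler k r.P X •
    (DH.inv k (ProjCplx.K r.projP).dag (ProjCplx.acyclic_K_dag r.projP) * DH.of k r.cplx.dag)

/-- The element `[K_P] * [K_Q]⁻¹` of `DH(A)`, which is `K_α` for `α = [P] - [Q]`. -/
def DH.KDiff {P Q : A} (hP : Projective P) (hQ : Projective Q) : DH k A :=
  DH.of k (ProjCplx.K hP) * DH.inv k (ProjCplx.K hQ) (ProjCplx.acyclic_K hQ)

/-- The element `[K_P†] * [K_Q†]⁻¹` of `DH(A)`, which is `K_α†` for `α = [P] - [Q]`. -/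
def DH.KDiffDag {P Q : A} (hP : Projective P) (hQ : Projective Q) : DH k A :=
  DH.of k (ProjCplx.K hP).dag * DH.inv k (ProjCplx.K hQ).dag (ProjCplx.acyclic_K_dag hQ)

variable [EnoughProjectives A] [∀ X Y : A, Finite (X ⟶ Y)] [∀ X : A, HasProjectiveDimensionLE X 1]

/-- The algebra homomorphism `I` is `I_+^e`: it maps `[X]` to `E_X` and `K_α` to `K_α`, whichever
projective resolution of `X` (for instance a minimal one), respectively whichever expression
`α = [P] - [Q]` with `P` and `Q` projective, is used to compute these elements of `DH(A)`. -/
structure IsIPlus (I : HTwE k A →ₐ[ℂ] DH k A) : Prop where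
  map_of : ∀ (X : A) (r : ProjRes X), I (HTwE.of k X) = r.E k
  map_K : ∀ (P Q : A) (hP : Projective P) (hQ : Projective Q),
    I (HTwE.K k (cl P - cl Q)) = DH.KDiff k hP hQ

/-- The algebra homomorphism `I` is `I_-^e`: it maps `[X]` to `F_X` and `K_α` to `K_α†`, whichever
projective resolutions and whichever expressions `α = [P] - [Q]` are used. -/
structure IsIMinus (I : HTwE k A →ₐ[ℂ] DH k A) : Prop where
  map_of : ∀ (X : A) (r : ProjRes X), I (HTwE.of k X) = r.F k
  map_K : ∀ (P Q : A) (hP : Projective P) (hQ : Projective Q),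
    I (HTwE.K k (cl P - cl Q)) = DH.KDiffDag k hP hQ

end Maps

end HallComplexes

end

open HallComplexes

/-!
Bridgeland's construction of a doubled Hall algebra: the localized Hall algebra `DH(A)` of
`ℤ/2`-graded complexes of projectives is, as a vector space, the tensor square of the extended
twisted Hall algebra of the hereditary category `A`.

*Hall products as sums over differentials.* An extension of a complex of projectives `M` by `N`
splits in each degree, so it is given by a cocycle, the off-diagonal entry of the differential on
`N ⊕ M`, and cohomologous cocycles give equivalent extensions. Hence `[M] * [N]` is a power of `t`
times the sum of the classes of all twisted direct sums `ProjCplx.twist s` (`HTwC.of_mul_of`), and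
associativity says that triangular differentials on a triple sum can be assembled in two ways
(`assoc_bijective`). Likewise, a resolution `P ⟶ Q` of `X` turns `[X] * [Z]` into a sum over
`Hom(P, Z)` (`HTw.of_mul_of`).

*The homomorphisms.* Extensions by and of a contractible complex `K_P` or `K_P†` split, so the
classes of these complexes commute with every class up to a power of `t`. By Schanuel's and the
horseshoe lemma, `[P] ↦ [K_P]` extends to a homomorphism `α ↦ K_α` on the Grothendieck group, and
`E_X` does not depend on the resolution (`ProjRes.E_eq`). The product of the classes of two
resolutions is a sum over resolutions of extensions; comparing it with the product in the Hall
algebra of `A` gives `DH.E_mul_E`, hence `I_+`. The shift carries `I_+` to `I_-`.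

*The basis.* A complex of projectives is a direct sum of the complex of a resolution and of the
shift of another one, because images of maps between projectives are projective
(`ProjCplx.exists_iso_sumDag`), and both parts are determined by the sum as far as needed. A
non-split extension has fewer endomorphisms than the direct sum (`card_end_twist_lt`), so
`[C_r ⊕ C_r'†]` is the leading term of `[C_r] * [C_r'†]` for the order of the endomorphism ring. As
`[C_r]` is `K_P * E_X` up to a unit, it follows that the elements `E_X * K_α * K_β† * F_Y` span
`DH(A)` (`DH.span_triangular_eq_top`). They are linearly independent
(`DH.linearIndependent_triangular`): the acyclic classes generate a submonoid of normal elements, to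
which Ore localization applies, so a relation in `DH(A)` becomes a relation in the Hall algebra of
complexes after multiplication by such classes. This only enlarges the resolutions and leaves the
leading terms distinct. The first isomorphism follows, since it carries a spanning set to nonzero
multiples of this basis.

*The reduced algebra.* An acyclic complex that is isomorphic to its shift is `K_P ⊕ K_Q†` with
`[P] = [Q]`, so the reduced algebra is the quotient by the ideal generated by the
central elements `K_β * K_β† - 1`. Right multiplication by `K_β * K_β†` translates the indices of
the basis from `(α, γ)` to `(α + β, γ + β)`, so the difference `α - γ` survives, and the elements
`E_X * K_α * F_Y` form a basis of the quotient.
-/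

set_option linter.unusedSectionVars false

noncomputable section

namespace HallComplexes

/-! ### Counting fibres -/

section Counting

variable {G H : Type*} [AddCommGroup G] [AddCommGroup H]

lemma card_ker_mul_card_range (δ : H →+ G) :
    Nat.card H = Nat.card δ.ker * Nat.card δ.range := by
  rw [AddSubgroup.card_eq_card_quotient_mul_card_addSubgroup δ.ker, mul_comm,
    Nat.card_congr (QuotientAddGroup.quotientKerEquivRange δ).toEquiv]

/-- If the fibres of a surjection `q` are the cosets of the image of `δ`, then the sizes of a subset
and of its preimage differ by the factor `|im δ| = |H| / |ker δ|`. -/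
lemma card_mul_card_eq_of_fibres_cosets {E : Type*} (δ : H →+ G) (q : G → E)
    (hq : Function.Surjective q) (h : ∀ a b, q a = q b ↔ a - b ∈ δ.range) (T : Set E) :
    Nat.card T * Nat.card H = Nat.card (q ⁻¹' T) * Nat.card δ.ker := by
  choose σ hσ using hq
  have e : (q ⁻¹' T) ≃ T × δ.range :=
    { toFun := fun g => (⟨q g, g.2⟩, ⟨g - σ (q g), (h _ _).1 (hσ _).symm⟩)
      invFun := fun x => ⟨σ x.1 + x.2, by
        have : q (σ x.1 + x.2) = q (σ x.1) := (h _ _).2 (by simp)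
        rw [Set.mem_preimage, this, hσ]
        exact x.1.2⟩
      left_inv := fun g => by simp
      right_inv := fun x => by
        have : q (σ x.1 + x.2) = x.1 := by
          rw [(h (σ x.1 + x.2) (σ x.1)).2 (by simp), hσ]
        ext <;> simp [this] }
  rw [Nat.card_congr e, Nat.card_prod, card_ker_mul_card_range δ]
  ring

end Counting

/-! ### Twisted direct sums of complexes -/

section Twist

variable {C : Type u} [Category.{v} C] [Preadditive C] {ι : Type*} {c : ComplexShape ι}

/-- The families `s i j : M.X i ⟶ N.X j`, supported on the relation of the shape, that
anticommute with the differentials: these are the data turning the graded object `N ⊕ M` into a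
complex with sub-complex `N` and quotient `M`. -/
def Cocycle (M N : HomologicalComplex C c) : AddSubgroup (∀ i j, M.X i ⟶ N.X j) where
  carrier := {s | (∀ i j, ¬ c.Rel i j → s i j = 0) ∧
    ∀ i j k, M.d i j ≫ s j k + s i j ≫ N.d j k = 0}
  zero_mem' := by simp
  add_mem' {s s'} hs hs' := by
    refine ⟨fun i j h => by simp [hs.1 i j h, hs'.1 i j h], fun i j k => ?_⟩
    have h₁ := hs.2 i j k
    have h₂ := hs'.2 i j k
    calc _ = (M.d i j ≫ s j k + s i j ≫ N.d j k) + (M.d i j ≫ s' j k + s' i j ≫ N.d j k) := by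
          simp only [Pi.add_apply, Preadditive.comp_add, Preadditive.add_comp]; abel
      _ = 0 := by rw [h₁, h₂, add_zero]
  neg_mem' {s} hs := by
    refine ⟨fun i j h => by simp [hs.1 i j h], fun i j k => ?_⟩
    have h₁ := hs.2 i j k
    simp only [Pi.neg_apply, Preadditive.comp_neg, Preadditive.neg_comp, ← neg_add, h₁, neg_zero]

variable {M N : HomologicalComplex C c}

lemma cocycle_shape (s : Cocycle M N) (i j : ι) (h : ¬ c.Rel i j) : s.1 i j = 0 := s.2.1 i j h

lemma cocycle_comm (s : Cocycle M N) (i j k : ι) :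
    M.d i j ≫ s.1 j k + s.1 i j ≫ N.d j k = 0 := s.2.2 i j k

lemma cocycle_comm' (s : Cocycle M N) (i j k : ι) :
    M.d i j ≫ s.1 j k = - (s.1 i j ≫ N.d j k) := eq_neg_of_add_eq_zero_left (cocycle_comm s i j k)

lemma cocycle_ext {s s' : Cocycle M N} (h : ∀ i j, c.Rel i j → s.1 i j = s'.1 i j) : s = s' := by
  apply Subtype.ext
  funext i j
  by_cases hij : c.Rel i j
  · exact h i j hij
  · rw [cocycle_shape s i j hij, cocycle_shape s' i j hij]

variable (M N) in
/-- The differential of a family of maps `h i : M.X i ⟶ N.X i` in the complex of graded maps. -/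
def coboundary : (∀ i, M.X i ⟶ N.X i) →+ Cocycle M N where
  toFun h := ⟨fun i j => h i ≫ N.d i j - M.d i j ≫ h j,
    fun i j hij => by simp [M.shape i j hij, N.shape i j hij], fun i j k => by simp⟩
  map_zero' := by apply Subtype.ext; funext i j; simp
  map_add' h h' := by
    apply Subtype.ext; funext i j
    simp only [Pi.add_apply, Preadditive.comp_add, Preadditive.add_comp, AddSubgroup.coe_add]
    abel

@[simp]
lemma coboundary_apply (h : ∀ i, M.X i ⟶ N.X i) (i j : ι) :
    (coboundary M N h).1 i j = h i ≫ N.d i j - M.d i j ≫ h j := rfl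

/-- The cycles in degree zero of the complex of graded maps are the morphisms of complexes. -/
lemma card_ker_coboundary : Nat.card (coboundary M N).ker = Nat.card (M ⟶ N) := by
  refine Nat.card_congr
    { toFun := fun h =>
        { f := h.1
          comm' := fun i j _ => sub_eq_zero.1
            (congrFun (congrFun (congrArg Subtype.val h.2) i) j) }
      invFun := fun φ => ⟨φ.f, by
        rw [AddMonoidHom.mem_ker]; apply Subtype.ext; funext i j; simp⟩
      left_inv := fun _ => rfl
      right_inv := fun _ => rfl }

instance finite_hom_complex [Finite ι] [∀ X Y : C, Finite (X ⟶ Y)] : Finite (M ⟶ N) :=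
  Finite.of_injective (fun φ : M ⟶ N => φ.f) fun _ _ h => HomologicalComplex.hom_ext _ _
    fun i => congrFun h i

variable [HasBinaryBiproducts C]

/-- The direct sum `N ⊕ M` with the differential twisted by a cocycle. -/
def twist (s : Cocycle M N) : HomologicalComplex C c where
  X i := N.X i ⊞ M.X i
  d i j := biprod.desc (N.d i j ≫ biprod.inl) (s.1 i j ≫ biprod.inl + M.d i j ≫ biprod.inr)
  shape i j h := biprod.hom_ext' _ _ (by simp [N.shape i j h])
    (by simp [M.shape i j h, cocycle_shape s i j h])
  d_comp_d' i j k _ _ := by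
    ext <;> simp [cocycle_comm' s]

section Components

variable (s : Cocycle M N) (i j : ι)

/-- The inclusion of the first summand of a twisted direct sum, in a given degree. -/
def tInl : N.X i ⟶ (twist s).X i := (biprod.inl : N.X i ⟶ N.X i ⊞ M.X i)

/-- The inclusion of the second summand of a twisted direct sum, in a given degree. -/
def tInr : M.X i ⟶ (twist s).X i := (biprod.inr : M.X i ⟶ N.X i ⊞ M.X i)

/-- The projection to the first summand of a twisted direct sum, in a given degree. -/
def tFst : (twist s).X i ⟶ N.X i := (biprod.fst : N.X i ⊞ M.X i ⟶ N.X i)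

/-- The projection to the second summand of a twisted direct sum, in a given degree. -/
def tSnd : (twist s).X i ⟶ M.X i := (biprod.snd : N.X i ⊞ M.X i ⟶ M.X i)

@[simp] lemma tInl_tFst : tInl s i ≫ tFst s i = 𝟙 _ := biprod.inl_fst
@[simp] lemma tInl_tSnd : tInl s i ≫ tSnd s i = 0 := biprod.inl_snd
@[simp] lemma tInr_tFst : tInr s i ≫ tFst s i = 0 := biprod.inr_fst
@[simp] lemma tInr_tSnd : tInr s i ≫ tSnd s i = 𝟙 _ := biprod.inr_snd

@[simp] lemma tInl_tFst_assoc {Z : C} (f : N.X i ⟶ Z) : tInl s i ≫ tFst s i ≫ f = f := by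
  rw [← Category.assoc, tInl_tFst]; exact Category.id_comp f
@[simp] lemma tInl_tSnd_assoc {Z : C} (f : M.X i ⟶ Z) : tInl s i ≫ tSnd s i ≫ f = 0 := by
  rw [← Category.assoc, tInl_tSnd]; exact zero_comp
@[simp] lemma tInr_tFst_assoc {Z : C} (f : N.X i ⟶ Z) : tInr s i ≫ tFst s i ≫ f = 0 := by
  rw [← Category.assoc, tInr_tFst]; exact zero_comp
@[simp] lemma tInr_tSnd_assoc {Z : C} (f : M.X i ⟶ Z) : tInr s i ≫ tSnd s i ≫ f = f := by
  rw [← Category.assoc, tInr_tSnd]; exact Category.id_comp f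

lemma twist_hom_ext_from {Z : C} {f g : (twist s).X i ⟶ Z} (h₁ : tInl s i ≫ f = tInl s i ≫ g)
    (h₂ : tInr s i ≫ f = tInr s i ≫ g) : f = g := biprod.hom_ext' _ _ h₁ h₂

lemma twist_hom_ext_to {Z : C} {f g : Z ⟶ (twist s).X i} (h₁ : f ≫ tFst s i = g ≫ tFst s i)
    (h₂ : f ≫ tSnd s i = g ≫ tSnd s i) : f = g := biprod.hom_ext _ _ h₁ h₂

/-- The morphism from a component of a twisted direct sum with given restrictions. -/
def tDesc {Z : C} (f : N.X i ⟶ Z) (g : M.X i ⟶ Z) : (twist s).X i ⟶ Z :=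
  (biprod.desc f g : N.X i ⊞ M.X i ⟶ Z)

@[simp] lemma tInl_tDesc {Z : C} (f : N.X i ⟶ Z) (g : M.X i ⟶ Z) :
    tInl s i ≫ tDesc s i f g = f := biprod.inl_desc _ _
@[simp] lemma tInr_tDesc {Z : C} (f : N.X i ⟶ Z) (g : M.X i ⟶ Z) :
    tInr s i ≫ tDesc s i f g = g := biprod.inr_desc _ _
@[simp] lemma tInl_tDesc_assoc {Z Z' : C} (f : N.X i ⟶ Z) (g : M.X i ⟶ Z) (h : Z ⟶ Z') :
    tInl s i ≫ tDesc s i f g ≫ h = f ≫ h := by rw [← Category.assoc, tInl_tDesc]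
@[simp] lemma tInr_tDesc_assoc {Z Z' : C} (f : N.X i ⟶ Z) (g : M.X i ⟶ Z) (h : Z ⟶ Z') :
    tInr s i ≫ tDesc s i f g ≫ h = g ≫ h := by rw [← Category.assoc, tInr_tDesc]

@[simp] lemma tInl_d : tInl s i ≫ (twist s).d i j = N.d i j ≫ tInl s j := biprod.inl_desc _ _
@[simp] lemma tInr_d : tInr s i ≫ (twist s).d i j = s.1 i j ≫ tInl s j + M.d i j ≫ tInr s j :=
  biprod.inr_desc _ _
@[simp] lemma tInl_d_assoc {Z : C} (f : (twist s).X j ⟶ Z) :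
    tInl s i ≫ (twist s).d i j ≫ f = N.d i j ≫ tInl s j ≫ f := by
  rw [← Category.assoc, tInl_d, Category.assoc]
@[simp] lemma tInr_d_assoc {Z : C} (f : (twist s).X j ⟶ Z) :
    tInr s i ≫ (twist s).d i j ≫ f = s.1 i j ≫ tInl s j ≫ f + M.d i j ≫ tInr s j ≫ f := by
  rw [← Category.assoc, tInr_d, Preadditive.add_comp, Category.assoc, Category.assoc]

lemma twist_id : tFst s i ≫ tInl s i + tSnd s i ≫ tInr s i = 𝟙 _ := biprod.total

@[simp] lemma d_tSnd : (twist s).d i j ≫ tSnd s j = tSnd s i ≫ M.d i j := by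
  apply twist_hom_ext_from <;> simp
@[simp] lemma d_tFst : (twist s).d i j ≫ tFst s j = tFst s i ≫ N.d i j + tSnd s i ≫ s.1 i j := by
  apply twist_hom_ext_from <;> simp

end Components

/-- The inclusion of the sub-complex of a twisted direct sum. -/
def twistInl (s : Cocycle M N) : N ⟶ twist s where
  f i := tInl s i

/-- The projection to the quotient complex of a twisted direct sum. -/
def twistSnd (s : Cocycle M N) : twist s ⟶ M where
  f i := tSnd s i

@[simp] lemma twistInl_f (s : Cocycle M N) (i : ι) : (twistInl s).f i = tInl s i := rfl
@[simp] lemma twistSnd_f (s : Cocycle M N) (i : ι) : (twistSnd s).f i = tSnd s i := rfl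

lemma twistInl_twistSnd (s : Cocycle M N) : twistInl s ≫ twistSnd s = 0 := by
  ext i; simp

/-- Cohomologous cocycles give isomorphic twisted direct sums. -/
def twistIso (s s' : Cocycle M N) (h : ∀ i, M.X i ⟶ N.X i) (hs : s - s' = coboundary M N h) :
    twist s ≅ twist s' :=
  have hs' (i j : ι) : s.1 i j = s'.1 i j + h i ≫ N.d i j - M.d i j ≫ h j := by
    have : s.1 i j - s'.1 i j = _ := congrFun (congrFun (congrArg Subtype.val hs) i) j
    rw [sub_eq_iff_eq_add.1 this, coboundary_apply]; abel
  HomologicalComplex.Hom.isoOfComponents (fun i =>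
    { hom := tDesc s i (tInl s' i) (h i ≫ tInl s' i + tInr s' i)
      inv := tDesc s' i (tInl s i) (- h i ≫ tInl s i + tInr s i)
      hom_inv_id := by apply twist_hom_ext_from <;> simp
      inv_hom_id := by apply twist_hom_ext_from <;> simp }) (by
    intro i j _
    apply twist_hom_ext_from
    · simp
    · simp only [hs', tInr_tDesc_assoc, Preadditive.add_comp, Category.assoc, tInl_d, tInr_d,
        tInr_d_assoc, tInl_tDesc, tInr_tDesc, Preadditive.sub_comp, Preadditive.comp_add]
      abel)

lemma twistInl_twistIso (s s' : Cocycle M N) (h : ∀ i, M.X i ⟶ N.X i)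
    (hs : s - s' = coboundary M N h) : twistInl s ≫ (twistIso s s' h hs).hom = twistInl s' := by
  ext i
  simp [twistIso]

lemma twistIso_twistSnd (s s' : Cocycle M N) (h : ∀ i, M.X i ⟶ N.X i)
    (hs : s - s' = coboundary M N h) : (twistIso s s' h hs).hom ≫ twistSnd s' = twistSnd s := by
  ext i
  apply twist_hom_ext_from <;> simp [twistIso]

/-- A morphism of twisted direct sums that is the identity on the sub-complex and on the quotient
exhibits the cocycles as cohomologous. -/
lemma sub_mem_range_coboundary (s s' : Cocycle M N) (φ : twist s ⟶ twist s')
    (h₁ : twistInl s ≫ φ = twistInl s') (h₂ : φ ≫ twistSnd s' = twistSnd s) :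
    s - s' ∈ (coboundary M N).range := by
  refine ⟨fun i => tInr s i ≫ φ.f i ≫ tFst s' i, ?_⟩
  apply cocycle_ext
  intro i j hij
  have e₁ (i) : tInl s i ≫ φ.f i = tInl s' i := HomologicalComplex.congr_hom h₁ i
  have e₂ (i) : φ.f i ≫ tSnd s' i = tSnd s i := HomologicalComplex.congr_hom h₂ i
  have := congrArg (fun f => tInr s i ≫ f ≫ tFst s' j) (φ.comm i j)
  simp only [Category.assoc, d_tFst, tInr_d_assoc, reassoc_of% e₁, tInl_tFst, Category.comp_id,
    Preadditive.comp_add, reassoc_of% e₂, tInr_tSnd_assoc] at this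
  change _ = s.1 i j - s'.1 i j
  simp only [coboundary_apply, Category.assoc]
  rw [sub_eq_sub_iff_add_eq_add, this]

end Twist

/-! ### Extensions -/

section Extensions

variable {C : Type u} [Category.{v} C] [Abelian C]

lemma extension_equiv_of_hom {X Z : C} (E F : Extension X Z) (φ : E.mid ⟶ F.mid)
    (h₁ : E.i ≫ φ = F.i) (h₂ : φ ≫ F.p = E.p) : (extensionSetoid X Z).r E F := by
  let ψ : ShortComplex.mk E.i E.p E.w ⟶ ShortComplex.mk F.i F.p F.w :=
    { τ₁ := 𝟙 _, τ₂ := φ, τ₃ := 𝟙 _, comm₁₂ := by simpa using h₁.symm, comm₂₃ := by simpa using h₂ }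
  have : IsIso ψ.τ₁ := inferInstanceAs (IsIso (𝟙 Z))
  have : IsIso ψ.τ₃ := inferInstanceAs (IsIso (𝟙 X))
  have : IsIso φ := ShortComplex.isIso₂_of_shortExact_of_isIso₁₃ ψ E.shortExact F.shortExact
  exact ⟨asIso φ, h₁, h₂⟩

/-- The transport of an extension along isomorphisms of its outer terms. -/
def extensionCongr {X X' Z Z' : C} (a : X ≅ X') (b : Z ≅ Z') (E : Extension X Z) :
    Extension X' Z' where
  mid := E.mid
  i := b.inv ≫ E.i
  p := E.p ≫ a.hom
  w := by simp [reassoc_of% E.w]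
  shortExact := by
    let S' : ShortComplex C :=
      ShortComplex.mk (b.inv ≫ E.i) (E.p ≫ a.hom) (by simp [reassoc_of% E.w])
    let e : ShortComplex.mk E.i E.p E.w ≅ S' :=
      ShortComplex.isoMk b (Iso.refl E.mid) a (by simp [S']) (by simp [S'])
    exact ShortComplex.shortExact_of_iso e E.shortExact

lemma extensionCongr_equiv {X X' Z Z' : C} (a : X ≅ X') (b : Z ≅ Z') (E F : Extension X Z)
    (h : (extensionSetoid X Z).r E F) :
    (extensionSetoid X' Z').r (extensionCongr a b E) (extensionCongr a b F) := by
  obtain ⟨φ, h₁, h₂⟩ := h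
  exact ⟨φ, by simp [extensionCongr, h₁], by simp [extensionCongr, reassoc_of% h₂]⟩

/-- The bijection of sets of extensions induced by isomorphisms of the outer terms. -/
def yExtCongr {X X' Z Z' : C} (a : X ≅ X') (b : Z ≅ Z') : YExt X Z ≃ YExt X' Z' where
  toFun := Quotient.map (sa := extensionSetoid X Z) (sb := extensionSetoid X' Z')
    (extensionCongr a b) (extensionCongr_equiv a b)
  invFun := Quotient.map (sa := extensionSetoid X' Z') (sb := extensionSetoid X Z)
    (extensionCongr a.symm b.symm) (extensionCongr_equiv a.symm b.symm)
  left_inv := by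
    rintro ⟨E⟩
    refine Quotient.sound (s := extensionSetoid X Z) ⟨Iso.refl _, ?_, ?_⟩ <;> simp [extensionCongr]
  right_inv := by
    rintro ⟨E⟩
    refine Quotient.sound (s := extensionSetoid X' Z') ⟨Iso.refl _, ?_, ?_⟩ <;>
      simp [extensionCongr]

lemma hallNumber_congr {X X' Z Z' Y Y' : C} (a : X ≅ X') (b : Z ≅ Z') (e : Y ≅ Y') :
    hallNumber X Z Y = hallNumber X' Z' Y' := by
  have h₁ : Nat.card (X ⟶ Z) = Nat.card (X' ⟶ Z') := Nat.card_congr (a.homCongr b)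
  have h₂ : Nat.card (extWithMiddle X Z Y) = Nat.card (extWithMiddle X' Z' Y') := by
    refine Nat.card_congr ((yExtCongr a b).subtypeEquiv fun ξ => ?_)
    constructor
    · rintro ⟨E, rfl, ⟨f⟩⟩
      exact ⟨extensionCongr a b E, rfl, ⟨f ≪≫ e⟩⟩
    · rintro ⟨E, hE, ⟨f⟩⟩
      refine ⟨extensionCongr a.symm b.symm E, ?_, ⟨f ≪≫ e.symm⟩⟩
      apply (yExtCongr a b).injective
      rw [← hE]
      exact Quotient.sound (s := extensionSetoid X' Z')
        ⟨Iso.refl _, by simp [extensionCongr], by simp [extensionCongr]⟩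
  rw [hallNumber, hallNumber, h₁, h₂]

/-- If the extensions of `X` by `Z` are parametrised by the elements of a finite group `G`, so that
the parameters of an extension form a coset of the image of `δ : H → G` and `Hom(X, Z)` is the
kernel of `δ`, then the Hall number counts parameters. -/
lemma hallNumber_eq_of_param {G H : Type*} [AddCommGroup G] [AddCommGroup H] [Finite H]
    {X Z : C} (Y : C) (δ : H →+ G) (E : G → Extension X Z)
    (hE : ∀ F : Extension X Z, ∃ g, (extensionSetoid X Z).r (E g) F)
    (h : ∀ a b, (extensionSetoid X Z).r (E a) (E b) ↔ a - b ∈ δ.range)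
    (hδ : Nat.card δ.ker = Nat.card (X ⟶ Z)) :
    hallNumber X Z Y = (Nat.card {g // Nonempty ((E g).mid ≅ Y)} : ℂ) / Nat.card H := by
  have key := card_mul_card_eq_of_fibres_cosets δ
    (fun g => (Quotient.mk (extensionSetoid X Z) (E g) : YExt X Z))
    (by rintro ⟨F⟩; obtain ⟨g, hg⟩ := hE F; exact ⟨g, Quotient.sound (s := extensionSetoid X Z) hg⟩)
    (fun a b => by rw [← h]; exact Quotient.eq (r := extensionSetoid X Z))
    (extWithMiddle X Z Y)
  have hpre : Nat.card ((fun g => (Quotient.mk (extensionSetoid X Z) (E g) : YExt X Z)) ⁻¹'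
      extWithMiddle X Z Y) = Nat.card {g // Nonempty ((E g).mid ≅ Y)} := by
    refine Nat.card_congr (Equiv.subtypeEquivRight fun g => ?_)
    constructor
    · rintro ⟨F, hF, ⟨f⟩⟩
      obtain ⟨φ, -, -⟩ := Quotient.exact (s := extensionSetoid X Z) hF
      exact ⟨φ.symm ≪≫ f⟩
    · rintro ⟨f⟩
      exact ⟨E g, rfl, ⟨f⟩⟩
  rw [hpre, hδ] at key
  have : Finite (X ⟶ Z) := by
    apply Nat.finite_of_card_ne_zero
    rw [← hδ]
    exact Nat.card_pos.ne'
  have h₁ : (Nat.card (X ⟶ Z) : ℂ) ≠ 0 := by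
    rw [← hδ]; exact_mod_cast Nat.card_pos.ne'
  have h₂ : (Nat.card H : ℂ) ≠ 0 := by exact_mod_cast Nat.card_pos.ne'
  rw [hallNumber, div_eq_div_iff h₁ h₂]
  exact_mod_cast key

end Extensions

/-! ### Extensions of degreewise projective complexes -/

section TwistExtension

variable {C : Type u} [Category.{v} C] [Abelian C] {ι : Type*} {c : ComplexShape ι}
  {M N : HomologicalComplex C c}

/-- The twisted direct sum as an extension. -/
def twistExt (s : Cocycle M N) : Extension M N where
  mid := twist s
  i := twistInl s
  p := twistSnd s
  w := twistInl_twistSnd s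
  shortExact := by
    apply HomologicalComplex.shortExact_of_degreewise_shortExact
    intro i
    refine ShortComplex.Splitting.shortExact
      { r := tFst s i, s := tInr s i, f_r := ?_, s_g := ?_, id := ?_ }
    · exact tInl_tFst s i
    · exact tInr_tSnd s i
    · exact twist_id s i

/-- An extension of a degreewise projective complex splits degreewise, and the differential of its
middle term is then upper triangular with a cocycle as its off-diagonal entry. -/
lemma exists_twistExt_equiv (hM : ∀ i, Projective (M.X i)) (E : Extension M N) :
    ∃ s : Cocycle M N, (extensionSetoid M N).r (twistExt s) E := by
  have hE (i : ι) : (ShortComplex.mk (E.i.f i) (E.p.f i)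
      (by rw [← HomologicalComplex.comp_f, E.w]; rfl)).ShortExact :=
    E.shortExact.map_of_exact (HomologicalComplex.eval C c i)
  have (i : ι) : Mono (E.i.f i) := (hE i).mono_f
  have (i : ι) : Epi (E.p.f i) := (hE i).epi_g
  let σ (i : ι) : M.X i ⟶ E.mid.X i := Projective.factorThru (𝟙 _) (E.p.f i)
  have hσ (i : ι) : σ i ≫ E.p.f i = 𝟙 _ := Projective.factorThru_comp _ _
  have hl (i j : ι) : (σ i ≫ E.mid.d i j - M.d i j ≫ σ j) ≫ E.p.f j = 0 := by
    rw [Preadditive.sub_comp, Category.assoc, Category.assoc, ← E.p.comm, reassoc_of% (hσ i), hσ,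
      Category.comp_id, sub_self]
  let s (i j : ι) : M.X i ⟶ N.X j := (hE j).exact.lift _ (hl i j)
  have hs (i j : ι) : s i j ≫ E.i.f j = σ i ≫ E.mid.d i j - M.d i j ≫ σ j :=
    (hE j).exact.lift_f _ _
  let S : Cocycle M N := ⟨s, fun i j hij => by
    rw [← cancel_mono (E.i.f j), hs, E.mid.shape i j hij, M.shape i j hij]; simp, fun i j k => by
    rw [← cancel_mono (E.i.f k)]
    simp only [Preadditive.add_comp, Category.assoc, hs, ← E.i.comm, reassoc_of% hs,
      Preadditive.comp_sub, Preadditive.sub_comp, HomologicalComplex.d_comp_d,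
      HomologicalComplex.d_comp_d_assoc, comp_zero, zero_comp]
    abel⟩
  refine ⟨S, extension_equiv_of_hom _ _
    { f := fun i => tDesc S i (E.i.f i) (σ i), comm' := fun i j _ => ?_ } ?_ ?_⟩
  · apply twist_hom_ext_from
    · simp [twistExt]
    · have : S.1 i j ≫ E.i.f j = σ i ≫ E.mid.d i j - M.d i j ≫ σ j := hs i j
      simp [twistExt, this]
  · ext i
    simp [twistExt]
  · ext i
    apply twist_hom_ext_from
    · simpa [twistExt] using HomologicalComplex.congr_hom E.w i
    · simp [twistExt, hσ]

/-- Two cocycles give equivalent extensions if and only if they are cohomologous, so that the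
extension classes are the cocycles modulo the coboundaries. -/
lemma twistExt_equiv_iff (s s' : Cocycle M N) :
    (extensionSetoid M N).r (twistExt s) (twistExt s') ↔ s - s' ∈ (coboundary M N).range := by
  constructor
  · rintro ⟨φ, h₁, h₂⟩
    exact sub_mem_range_coboundary s s' φ.hom h₁ h₂
  · rintro ⟨h, hh⟩
    exact ⟨twistIso s s' h hh.symm, twistInl_twistIso _ _ _ _, twistIso_twistSnd _ _ _ _⟩

/-- Hall numbers of complexes count twisted differentials. -/
lemma hallNumber_complex [Finite ι] [∀ X Y : C, Finite (X ⟶ Y)]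
    (hM : ∀ i, Projective (M.X i)) (L : HomologicalComplex C c) :
    hallNumber M N L = (Nat.card {s : Cocycle M N // Nonempty (twist s ≅ L)} : ℂ) /
      Nat.card (∀ i, M.X i ⟶ N.X i) :=
  hallNumber_eq_of_param L (coboundary M N) twistExt (exists_twistExt_equiv hM)
    twistExt_equiv_iff card_ker_coboundary

end TwistExtension

/-! ### Iterated twisted direct sums -/

section Assoc

variable {C : Type u} [Category.{v} C] [Preadditive C] [HasBinaryBiproducts C] {ι : Type*}
  {c : ComplexShape ι} {M N L : HomologicalComplex C c}

/-- The part from `N` to `L` of a cocycle on a twisted direct sum `N ⊕ M` with values in `L`. -/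
def assocFst (s : Cocycle M N) (r : Cocycle (twist s) L) : Cocycle N L :=
  ⟨fun i j => tInl s i ≫ r.1 i j, fun i j h => by simp [cocycle_shape r i j h], fun i j l => by
    have := tInl s i ≫= cocycle_comm r i j l
    simpa using this⟩

/-- The part out of `M`, with values in a twisted direct sum `L ⊕ N`, of a pair of cocycles. -/
def assocSnd (s : Cocycle M N) (r : Cocycle (twist s) L) : Cocycle M (twist (assocFst s r)) :=
  ⟨fun i j => (tInr s i ≫ r.1 i j) ≫ tInl (assocFst s r) j + s.1 i j ≫ tInr (assocFst s r) j,
    fun i j h => by simp [cocycle_shape r i j h, cocycle_shape s i j h], fun i j l => by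
    have h₁ := tInr s i ≫= cocycle_comm r i j l
    have h₂ := cocycle_comm s i j l
    simp only [Preadditive.comp_add, tInr_d_assoc, comp_zero] at h₁
    apply twist_hom_ext_to
    · simp only [Preadditive.comp_add, Preadditive.add_comp, Category.assoc, tInl_tFst,
        tInr_tFst, tInl_d_assoc, tInr_d_assoc, comp_zero, add_zero, zero_comp,
        Category.comp_id]
      rw [← h₁]
      simp only [assocFst]
      abel
    · simp only [Preadditive.comp_add, Preadditive.add_comp, Category.assoc, tInl_tSnd,
        tInr_tSnd, tInl_d_assoc, tInr_d_assoc, comp_zero, zero_add, zero_comp,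
        Category.comp_id]
      rw [← h₂]⟩

lemma assocFst_apply (s : Cocycle M N) (r : Cocycle (twist s) L) (i j : ι) :
    (assocFst s r).1 i j = tInl s i ≫ r.1 i j := rfl

lemma assocSnd_apply (s : Cocycle M N) (r : Cocycle (twist s) L) (i j : ι) :
    (assocSnd s r).1 i j =
      (tInr s i ≫ r.1 i j) ≫ tInl (assocFst s r) j + s.1 i j ≫ tInr (assocFst s r) j := rfl

/-- Both ways of iterating twisted direct sums amount to a differential on `L ⊕ N ⊕ M` that is
triangular with the given diagonal entries. -/
lemma assoc_bijective : Function.Bijective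
    (fun x : (s : Cocycle M N) × Cocycle (twist s) L =>
      (⟨assocFst x.1 x.2, assocSnd x.1 x.2⟩ :
        (r : Cocycle N L) × Cocycle M (twist r))) := by
  let Ψ (y : (r : Cocycle N L) × Cocycle M (twist r)) :
      (∀ i j, N.X i ⟶ L.X j) × (∀ i j, M.X i ⟶ L.X j) × (∀ i j, M.X i ⟶ N.X j) :=
    (y.1.1, fun i j => y.2.1 i j ≫ tFst y.1 j, fun i j => y.2.1 i j ≫ tSnd y.1 j)
  have hΨ : Function.Injective Ψ := by
    rintro ⟨r, s⟩ ⟨r', s'⟩ h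
    obtain rfl : r = r' := Subtype.ext (congrArg Prod.fst h)
    have h₁ := congrArg (fun x => x.2.1) h
    have h₂ := congrArg (fun x => x.2.2) h
    congr 1
    apply Subtype.ext
    funext i j
    exact twist_hom_ext_to _ _ (congrFun (congrFun h₁ i) j) (congrFun (congrFun h₂ i) j)
  have hΨ' (x : (s : Cocycle M N) × Cocycle (twist s) L) :
      Ψ ⟨assocFst x.1 x.2, assocSnd x.1 x.2⟩ = (fun i j => tInl x.1 i ≫ x.2.1 i j,
        fun i j => tInr x.1 i ≫ x.2.1 i j, x.1.1) := by
    refine Prod.ext rfl (Prod.ext ?_ ?_) <;>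
    · funext i j
      simp [Ψ, assocSnd]
  constructor
  · rintro ⟨s, r⟩ ⟨s', r'⟩ h
    have h' := congrArg Ψ h
    rw [hΨ', hΨ'] at h'
    obtain rfl : s = s' := Subtype.ext (congrArg (fun x => x.2.2) h')
    have h₁ := congrArg Prod.fst h'
    have h₂ := congrArg (fun x => x.2.1) h'
    congr 1
    apply Subtype.ext
    funext i j
    exact twist_hom_ext_from _ _ (congrFun (congrFun h₁ i) j) (congrFun (congrFun h₂ i) j)
  · rintro ⟨r, s⟩
    let s' : Cocycle M N := ⟨fun i j => s.1 i j ≫ tSnd r j,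
      fun i j h => by simp [cocycle_shape s i j h], fun i j l => by
        have := cocycle_comm s i j l =≫ tSnd r l
        simpa using this⟩
    let r' : Cocycle (twist s') L := ⟨fun i j => tDesc s' i (r.1 i j) (s.1 i j ≫ tFst r j),
      fun i j h => by
        apply twist_hom_ext_from <;> simp [cocycle_shape s i j h, cocycle_shape r i j h],
      fun i j l => by
        apply twist_hom_ext_from
        · simpa using cocycle_comm r i j l
        · have := cocycle_comm s i j l =≫ tFst r l
          simp only [Preadditive.add_comp, Category.assoc, d_tFst, Preadditive.comp_add,
            zero_comp] at this
          simp only [Preadditive.comp_add, tInr_d_assoc, tInl_tDesc, tInr_tDesc, comp_zero,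
            tInr_tDesc_assoc, Category.assoc]
          rw [← this]
          simp only [s', Category.assoc]
          abel⟩
    refine ⟨⟨s', r'⟩, hΨ ?_⟩
    rw [hΨ']
    refine Prod.ext ?_ (Prod.ext ?_ ?_) <;>
    · funext i j
      simp [Ψ, s', r']

/-- The two iterated twisted direct sums are isomorphic. -/
def twistAssoc (s : Cocycle M N) (r : Cocycle (twist s) L) :
    twist r ≅ twist (assocSnd s r) :=
  HomologicalComplex.Hom.isoOfComponents (fun i =>
    { hom := tDesc r i (tInl (assocFst s r) i ≫ tInl (assocSnd s r) i)
        (tDesc s i (tInr (assocFst s r) i ≫ tInl (assocSnd s r) i) (tInr (assocSnd s r) i))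
      inv := tDesc (assocSnd s r) i
        (tDesc (assocFst s r) i (tInl r i) (tInl s i ≫ tInr r i)) (tInr s i ≫ tInr r i)
      hom_inv_id := by
        apply twist_hom_ext_from
        · simp
        · apply twist_hom_ext_from <;> simp
      inv_hom_id := by
        apply twist_hom_ext_from
        · apply twist_hom_ext_from <;> simp
        · simp }) (by
    intro i j _
    apply twist_hom_ext_from
    · simp
    · apply twist_hom_ext_from <;> simp [assocSnd_apply, assocFst_apply, add_assoc])

end Assoc

section Congr

variable {C : Type u} [Category.{v} C] [Preadditive C] {ι : Type*}
  {c : ComplexShape ι} {M N M' N' : HomologicalComplex C c}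

variable [HasBinaryBiproducts C]

/-- The direct sum of two complexes, realised as the twisted direct sum of the zero cocycle, is
symmetric. -/
def twistZeroSwap (M N : HomologicalComplex C c) :
    twist (0 : Cocycle M N) ≅ twist (0 : Cocycle N M) :=
  HomologicalComplex.Hom.isoOfComponents (fun i =>
    { hom := tDesc _ i (tInr _ i) (tInl _ i)
      inv := tDesc _ i (tInr _ i) (tInl _ i)
      hom_inv_id := by apply twist_hom_ext_from <;> simp
      inv_hom_id := by apply twist_hom_ext_from <;> simp }) (by
    intro i j _
    apply twist_hom_ext_from <;> simp)

/-- Direct sums respect isomorphisms. -/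
def twistZeroCongr (a : M ≅ M') (b : N ≅ N') :
    twist (0 : Cocycle M N) ≅ twist (0 : Cocycle M' N') :=
  HomologicalComplex.Hom.isoOfComponents (fun i =>
    { hom := tDesc _ i (b.hom.f i ≫ tInl _ i) (a.hom.f i ≫ tInr _ i)
      inv := tDesc _ i (b.inv.f i ≫ tInl _ i) (a.inv.f i ≫ tInr _ i)
      hom_inv_id := by
        apply twist_hom_ext_from <;> simp [← HomologicalComplex.comp_f_assoc]
      inv_hom_id := by
        apply twist_hom_ext_from <;> simp [← HomologicalComplex.comp_f_assoc] }) (by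
    intro i j _
    apply twist_hom_ext_from <;> simp)

/-- A twisted direct sum with zero quotient complex. -/
def twistIsoOfIsZeroRight (s : Cocycle M N) (h : ∀ i, IsZero (M.X i)) : twist s ≅ N :=
  HomologicalComplex.Hom.isoOfComponents (fun i =>
    { hom := tFst s i
      inv := tInl s i
      hom_inv_id := twist_hom_ext_from _ _ (by simp) ((h i).eq_of_src _ _) }) (by
    intro i j _
    exact twist_hom_ext_from _ _ (by simp) ((h i).eq_of_src _ _))

/-- A twisted direct sum with zero sub-complex. -/
def twistIsoOfIsZeroLeft (s : Cocycle M N) (h : ∀ i, IsZero (N.X i)) : twist s ≅ M :=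
  HomologicalComplex.Hom.isoOfComponents (fun i =>
    { hom := tSnd s i
      inv := tInr s i
      hom_inv_id := twist_hom_ext_from _ _ ((h i).eq_of_src _ _) (by simp) }) (by
    intro i j _
    exact twist_hom_ext_from _ _ ((h i).eq_of_src _ _) (by simp))

end Congr

/-! ### Classes in the Grothendieck group and counting of morphisms -/

section Classes

variable {A : Type u} [Category.{v} A] [Abelian A]

lemma cl_shortExact {S : ShortComplex A} (hS : S.ShortExact) : cl S.X₂ = cl S.X₁ + cl S.X₃ := by
  have : (QuotientAddGroup.mk (FreeAbelianGroup.of S.X₂ - FreeAbelianGroup.of S.X₁ -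
      FreeAbelianGroup.of S.X₃) : K₀ A) = 0 :=
    (QuotientAddGroup.eq_zero_iff _).2 (AddSubgroup.subset_closure ⟨S, hS, rfl⟩)
  change cl S.X₂ - cl S.X₁ - cl S.X₃ = 0 at this
  rw [sub_sub, sub_eq_zero] at this
  exact this

lemma cl_isZero {X : A} (hX : IsZero X) : cl X = 0 := by
  have h : (ShortComplex.mk (0 : X ⟶ X) (0 : X ⟶ X) zero_comp).ShortExact :=
    { exact := ShortComplex.exact_of_isZero_X₂ _ hX
      mono_f := ⟨fun _ _ _ => hX.eq_of_tgt _ _⟩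
      epi_g := ⟨fun _ _ _ => hX.eq_of_src _ _⟩ }
  have := cl_shortExact h
  simpa using this

lemma cl_congr {X Y : A} (e : X ≅ Y) : cl X = cl Y := by
  have h : (ShortComplex.mk e.hom (0 : Y ⟶ 0) comp_zero).ShortExact :=
    { exact := (ShortComplex.exact_iff_epi _ rfl).2 (inferInstanceAs (Epi e.hom))
      mono_f := inferInstanceAs (Mono e.hom)
      epi_g := ⟨fun _ _ _ => (isZero_zero A).eq_of_src _ _⟩ }
  have := cl_shortExact h
  simpa [cl_isZero (isZero_zero A)] using this.symm

lemma cl_biprod (X Y : A) : cl (X ⊞ Y) = cl X + cl Y := by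
  have h : (ShortComplex.mk (biprod.inl : X ⟶ X ⊞ Y) biprod.snd (by simp)).ShortExact :=
    ShortComplex.Splitting.shortExact
      { r := biprod.fst, s := biprod.inr, f_r := by simp, s_g := by simp, id := biprod.total }
  exact cl_shortExact h

end Classes

lemma card_pi_zmod_two (F : ZMod 2 → Type*) :
    Nat.card (∀ i, F i) = Nat.card (F 0) * Nat.card (F 1) := by
  rw [← Nat.card_prod]
  exact Nat.card_congr (piFinTwoEquiv F)

lemma tPar_sq (k : Type w) : tPar k ^ 2 = Nat.card k := by
  unfold tPar
  rw [← Complex.ofReal_pow, Real.sq_sqrt (Nat.cast_nonneg _)]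
  simp

section EulerCount

variable (k : Type w) [Field k] [Finite k]

lemma tPar_ne_zero : tPar k ≠ 0 := by
  unfold tPar
  have : (0 : ℝ) < Nat.card k := by exact_mod_cast Nat.card_pos
  exact_mod_cast (Real.sqrt_pos.2 this).ne'

lemma tPar_zpow_add (a b : ℤ) : tPar k ^ (a + b) = tPar k ^ a * tPar k ^ b :=
  zpow_add₀ (tPar_ne_zero k) a b

lemma tPar_zpow_ne_zero (a : ℤ) : tPar k ^ a ≠ 0 := zpow_ne_zero _ (tPar_ne_zero k)

variable {A : Type u} [Category.{v} A] [Abelian A] [Linear k A]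
  [EnoughProjectives A] [∀ X Y : A, Finite (X ⟶ Y)] [∀ X : A, HasProjectiveDimensionLE X 1]

lemma card_hom_of_projective (P Y : A) [Projective P] :
    (Nat.card (P ⟶ Y) : ℂ) = tPar k ^ (2 * eulerK k A (cl P) (cl Y)) := by
  let := HasExt.standard A
  have h₁ : ∀ Y : A, Subsingleton (Ext.{max u v} P Y 1) := fun Y =>
    projective_iff_subsingleton_ext_one.1 ‹Projective P› (Y := Y)
  have : Module.Finite k (P ⟶ Y) := Module.Finite.of_finite
  rw [eulerK_cl, euler_eq, Module.finrank_zero_of_subsingleton (M := Ext.{max u v} P Y 1),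
    (Ext.linearEquiv₀ (R := k) (X := P) (Y := Y)).finrank_eq, zpow_mul]
  rw [show tPar k ^ (2 : ℤ) = Nat.card k from tPar_sq k]
  simp only [CharP.cast_eq_zero, sub_zero, zpow_natCast]
  exact_mod_cast Module.natCard_eq_pow_finrank (K := k) (V := P ⟶ Y)

/-- The form `⟨M₀, N₀⟩ + ⟨M₁, N₁⟩` on complexes. -/
def eulerC (M N : ProjCplx A) : ℤ :=
  eulerK k A (cl (M.obj.X 0)) (cl (N.obj.X 0)) + eulerK k A (cl (M.obj.X 1)) (cl (N.obj.X 1))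

lemma card_graded_hom (M N : ProjCplx A) :
    (Nat.card (∀ i, M.obj.X i ⟶ N.obj.X i) : ℂ) = tPar k ^ (2 * eulerC k M N) := by
  have := M.property 0
  have := M.property 1
  rw [card_pi_zmod_two fun i => (M.obj.X i ⟶ N.obj.X i)]
  push_cast
  rw [card_hom_of_projective k, card_hom_of_projective k, ← tPar_zpow_add, eulerC, mul_add]

end EulerCount

/-! ### The twisted Hall algebra of complexes of projectives -/

section IsoClasses

variable {C : Type u} [Category.{v} C]

lemma isoCl_eq_iff {X Y : C} : isoCl X = isoCl Y ↔ Nonempty (X ≅ Y) :=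
  Quotient.eq (r := isIsomorphicSetoid C)

lemma isoCl_out (x : IsoCl C) : isoCl x.out = x := Quotient.out_eq x

/-- A chosen isomorphism from the representative of an isomorphism class. -/
def outIso (X : C) : (isoCl X).out ≅ X := (isoCl_eq_iff.1 (isoCl_out (isoCl X))).some

/-- A finite sum over the fibres of a map, weighted with the sizes of the fibres. -/
lemma finsum_card_fibre {G Y V : Type*} [Fintype G] [AddCommGroup V] [Module ℂ V] (f : G → Y)
    (F : Y → V) : ∑ᶠ y, (Nat.card {g // f g = y} : ℂ) • F y = ∑ g, F (f g) := by
  classical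
  rw [Finset.sum_comp F f, finsum_eq_sum_of_support_subset (s := Finset.univ.image f)]
  · refine Finset.sum_congr rfl fun y _ => ?_
    rw [Nat.card_eq_fintype_card, Fintype.card_subtype, Nat.cast_smul_eq_nsmul]
  · intro y hy
    by_contra hc
    refine hy ?_
    have : IsEmpty {g // f g = y} := ⟨fun g => hc (by simpa using ⟨g.1, g.2⟩)⟩
    simp

end IsoClasses

section HallComplexAlgebra

variable {A : Type u} [Category.{v} A] [Abelian A]

/-- The twisted direct sum of two complexes of projectives. -/
def ProjCplx.twist {M N : ProjCplx A} (s : Cocycle M.obj N.obj) : ProjCplx A :=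
  ⟨HallComplexes.twist s, fun i => by
    have := M.property i
    have := N.property i
    exact inferInstanceAs (Projective (N.obj.X i ⊞ M.obj.X i))⟩

lemma ProjCplx.cl_twist {M N : ProjCplx A} (s : Cocycle M.obj N.obj) (i : ZMod 2) :
    cl ((ProjCplx.twist s).obj.X i) = cl (N.obj.X i) + cl (M.obj.X i) :=
  cl_biprod (N.obj.X i) (M.obj.X i)

lemma ProjCplx.isoCl_eq_iff {M N : ProjCplx A} : isoCl M = isoCl N ↔ Nonempty (M.obj ≅ N.obj) :=
  HallComplexes.isoCl_eq_iff.trans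
    ⟨fun ⟨e⟩ => ⟨(ObjectProperty.ι _).mapIso e⟩, fun ⟨e⟩ => ⟨ObjectProperty.isoMk _ e⟩⟩

lemma isZero_zero_X (i : ZMod 2) : IsZero ((ProjCplx.zero : ProjCplx A).obj.X i) :=
  (HomologicalComplex.eval A (ComplexShape.up (ZMod 2)) i).map_isZero (isZero_zero _)

variable (k : Type w) [Field k] [Linear k A]

lemma HTwC.of_congr {M N : ProjCplx A} (e : M.obj ≅ N.obj) : HTwC.of k M = HTwC.of k N := by
  rw [HTwC.of, HTwC.of, ProjCplx.isoCl_eq_iff.2 ⟨e⟩]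

lemma HTwC.of_out (x : IsoCl (ProjCplx A)) : HTwC.of k x.out = (Finsupp.single x (1 : ℂ) :) := by
  rw [HTwC.of, isoCl_out]

lemma HTwC.induction {p : HTwC k A → Prop} (h0 : p 0) (hadd : ∀ x y, p x → p y → p (x + y))
    (hsmul : ∀ (c : ℂ) x, p x → p (c • x)) (hof : ∀ M, p (HTwC.of k M)) (x : HTwC k A) : p x := by
  refine Finsupp.induction_linear (motive := p) x h0 hadd fun a c => ?_
  have : (Finsupp.single a c : IsoCl (ProjCplx A) →₀ ℂ) = c • HTwC.of k a.out := by
    rw [HTwC.of_out]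
    exact (Finsupp.smul_single_one a c).symm
  rw [this]
  exact hsmul _ _ (hof _)

lemma HTwC.mul_def (x y : HTwC k A) : x * y = HTwC.mulLin k A x y := rfl

lemma HTwC.mulLin_single (x z : IsoCl (ProjCplx A)) :
    HTwC.mulLin k A (Finsupp.single x (1 : ℂ) :) (Finsupp.single z (1 : ℂ) :) =
      tPar k ^ (euler k (x.out.obj.X 0) (z.out.obj.X 0) +
          euler k (x.out.obj.X 1) (z.out.obj.X 1)) •
        ∑ᶠ y : IsoCl (ProjCplx A),
          hallNumber x.out.obj z.out.obj y.out.obj • HTwC.of k y.out := by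
  unfold HTwC.mulLin
  erw [Finsupp.lsum_single, LinearMap.toSpanSingleton_apply, one_smul, Finsupp.lsum_single,
    LinearMap.toSpanSingleton_apply, one_smul]

instance [∀ X Y : A, Finite (X ⟶ Y)] (M N : Z2Cplx A) : Fintype (Cocycle M N) :=
  Fintype.ofFinite _

variable [Finite k] [EnoughProjectives A] [∀ X Y : A, Finite (X ⟶ Y)]
  [∀ X : A, HasProjectiveDimensionLE X 1]

lemma eulerC_congr {M M' N N' : ProjCplx A} (a : M.obj ≅ M'.obj) (b : N.obj ≅ N'.obj) :
    eulerC k M N = eulerC k M' N' := by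
  have ha (i : ZMod 2) : cl (M.obj.X i) = cl (M'.obj.X i) :=
    cl_congr ((HomologicalComplex.eval A _ i).mapIso a)
  have hb (i : ZMod 2) : cl (N.obj.X i) = cl (N'.obj.X i) :=
    cl_congr ((HomologicalComplex.eval A _ i).mapIso b)
  simp only [eulerC, ha, hb]

/-- The product of two classes is the sum over all twisted differentials on the direct sum. -/
lemma HTwC.of_mul_of (M N : ProjCplx A) : HTwC.of k M * HTwC.of k N =
    tPar k ^ (- eulerC k M N) •
      ∑ s : Cocycle M.obj N.obj, HTwC.of k (ProjCplx.twist s) := by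
  have h₀ : HTwC.of k M * HTwC.of k N = tPar k ^ (euler k ((isoCl M).out.obj.X 0)
      ((isoCl N).out.obj.X 0) + euler k ((isoCl M).out.obj.X 1) ((isoCl N).out.obj.X 1)) •
        ∑ᶠ y : IsoCl (ProjCplx A),
          hallNumber (isoCl M).out.obj (isoCl N).out.obj y.out.obj • HTwC.of k y.out := by
    exact HTwC.mulLin_single k _ _
  let eM : (isoCl M).out.obj ≅ M.obj := (ObjectProperty.ι _).mapIso (outIso M)
  let eN : (isoCl N).out.obj ≅ N.obj := (ObjectProperty.ι _).mapIso (outIso N)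
  have h₁ : euler k ((isoCl M).out.obj.X 0)
      ((isoCl N).out.obj.X 0) + euler k ((isoCl M).out.obj.X 1) ((isoCl N).out.obj.X 1) =
      eulerC k M N := by
    rw [← eulerC_congr k eM eN, eulerC, eulerK_cl, eulerK_cl]
  have h₂ (y : IsoCl (ProjCplx A)) :
      hallNumber (isoCl M).out.obj (isoCl N).out.obj y.out.obj • HTwC.of k y.out =
      (Nat.card {s : Cocycle M.obj N.obj // isoCl (ProjCplx.twist s) = y} : ℂ) •
        (tPar k ^ (- (2 * eulerC k M N)) • HTwC.of k y.out) := by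
    rw [hallNumber_congr eM eN (Iso.refl _), hallNumber_complex M.property, card_graded_hom k,
      zpow_neg, div_eq_mul_inv, mul_smul]
    have hc : Nat.card {s : Cocycle M.obj N.obj // Nonempty (twist s ≅ y.out.obj)} =
        Nat.card {s : Cocycle M.obj N.obj // isoCl (ProjCplx.twist s) = y} :=
      Nat.card_congr (Equiv.subtypeEquivRight fun s => by
        rw [← isoCl_out y, ProjCplx.isoCl_eq_iff, isoCl_out]; rfl)
    rw [hc]
  rw [h₀, h₁, finsum_congr h₂,
    finsum_card_fibre _ fun y : IsoCl (ProjCplx A) =>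
      tPar k ^ (- (2 * eulerC k M N)) • HTwC.of k y.out, ← Finset.smul_sum, smul_smul,
      ← tPar_zpow_add]
  congr 1
  · congr 1; ring
  · refine Finset.sum_congr rfl fun s _ => ?_
    rw [HTwC.of_out, HTwC.of]

lemma HTwC.add_mul' (x y z : HTwC k A) : (x + y) * z = x * z + y * z := by
  simp [HTwC.mul_def]

lemma HTwC.mul_add' (x y z : HTwC k A) : x * (y + z) = x * y + x * z := by
  simp [HTwC.mul_def]

lemma HTwC.smul_mul' (c : ℂ) (x y : HTwC k A) : (c • x) * y = c • (x * y) := by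
  simp [HTwC.mul_def]

lemma HTwC.mul_smul' (c : ℂ) (x y : HTwC k A) : x * (c • y) = c • (x * y) := by
  simp [HTwC.mul_def]

lemma HTwC.zero_mul' (x : HTwC k A) : 0 * x = 0 := by simp [HTwC.mul_def]

lemma HTwC.mul_zero' (x : HTwC k A) : x * 0 = 0 := by simp [HTwC.mul_def]

lemma HTwC.sum_mul' {ι : Type*} (s : Finset ι) (f : ι → HTwC k A) (x : HTwC k A) :
    (∑ i ∈ s, f i) * x = ∑ i ∈ s, f i * x := by simp [HTwC.mul_def]

lemma HTwC.mul_sum' {ι : Type*} (s : Finset ι) (f : ι → HTwC k A) (x : HTwC k A) :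
    x * (∑ i ∈ s, f i) = ∑ i ∈ s, x * f i := by simp [HTwC.mul_def]

/-- Associativity: both sides sum over all triangular differentials on the direct sum of the three
complexes. -/
lemma HTwC.of_mul_of_mul_of (M N L : ProjCplx A) :
    HTwC.of k M * HTwC.of k N * HTwC.of k L = HTwC.of k M * (HTwC.of k N * HTwC.of k L) := by
  have h₁ (s : Cocycle M.obj N.obj) : HTwC.of k (ProjCplx.twist s) * HTwC.of k L =
      tPar k ^ (- (eulerC k M L + eulerC k N L)) •
        ∑ r : Cocycle (twist s) L.obj, HTwC.of k (ProjCplx.twist (M := ProjCplx.twist s) r) := by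
    rw [HTwC.of_mul_of]
    congr 3
    simp only [eulerC, ProjCplx.cl_twist, map_add, AddMonoidHom.add_apply]
    ring
  have h₂ (r : Cocycle N.obj L.obj) : HTwC.of k M * HTwC.of k (ProjCplx.twist r) =
      tPar k ^ (- (eulerC k M L + eulerC k M N)) •
        ∑ s : Cocycle M.obj (twist r), HTwC.of k (ProjCplx.twist (N := ProjCplx.twist r) s) := by
    rw [HTwC.of_mul_of]
    congr 3
    simp only [eulerC, ProjCplx.cl_twist, map_add]
    ring
  rw [HTwC.of_mul_of, HTwC.of_mul_of, HTwC.smul_mul', HTwC.sum_mul', HTwC.mul_smul',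
    HTwC.mul_sum', Finset.sum_congr rfl fun s _ => h₁ s, Finset.sum_congr rfl fun s _ => h₂ s,
    ← Finset.smul_sum, ← Finset.smul_sum, smul_smul, smul_smul, ← tPar_zpow_add, ← tPar_zpow_add,
    ← Fintype.sum_sigma', ← Fintype.sum_sigma']
  congr 1
  · congr 1; ring
  · refine Fintype.sum_bijective _ assoc_bijective _ _ fun x => ?_
    exact HTwC.of_congr k (twistAssoc x.1 x.2)

lemma HTwC.mul_assoc' (x y z : HTwC k A) : x * y * z = x * (y * z) := by
  refine HTwC.induction k (p := fun x => x * y * z = x * (y * z)) ?_ ?_ ?_ (fun M => ?_) x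
  · simp only [HTwC.zero_mul']
  · intro a b ha hb; simp only [HTwC.add_mul', ha, hb]
  · intro c a ha; simp only [HTwC.smul_mul', ha]
  refine HTwC.induction k (p := fun y => HTwC.of k M * y * z = HTwC.of k M * (y * z))
    ?_ ?_ ?_ (fun N => ?_) y
  · simp only [HTwC.zero_mul', HTwC.mul_zero']
  · intro a b ha hb; simp only [HTwC.add_mul', HTwC.mul_add', ha, hb]
  · intro c a ha; simp only [HTwC.smul_mul', HTwC.mul_smul', ha]
  refine HTwC.induction k
    (p := fun z => HTwC.of k M * HTwC.of k N * z = HTwC.of k M * (HTwC.of k N * z))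
    ?_ ?_ ?_ (fun L => ?_) z
  · simp only [HTwC.mul_zero']
  · intro a b ha hb; simp only [HTwC.mul_add', ha, hb]
  · intro c a ha; simp only [HTwC.mul_smul', ha]
  exact HTwC.of_mul_of_mul_of k M N L

lemma HTwC.one_def : (1 : HTwC k A) = HTwC.of k ProjCplx.zero := rfl

lemma HTwC.one_mul' (x : HTwC k A) : 1 * x = x := by
  refine HTwC.induction k (p := fun x => 1 * x = x) ?_ ?_ ?_ (fun N => ?_) x
  · simp only [HTwC.mul_zero']
  · intro a b ha hb; simp only [HTwC.mul_add', ha, hb]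
  · intro c a ha; simp only [HTwC.mul_smul', ha]
  have : Unique (Cocycle (ProjCplx.zero : ProjCplx A).obj N.obj) :=
    { default := 0, uniq := fun s => cocycle_ext fun i j _ => (isZero_zero_X i).eq_of_src _ _ }
  rw [HTwC.one_def, HTwC.of_mul_of, eulerC]
  simp only [cl_isZero (isZero_zero_X _), map_zero, AddMonoidHom.zero_apply,
    add_zero, neg_zero, zpow_zero, one_smul]
  rw [Fintype.sum_unique]
  exact HTwC.of_congr k (twistIsoOfIsZeroRight _ isZero_zero_X)

lemma HTwC.mul_one' (x : HTwC k A) : x * 1 = x := by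
  refine HTwC.induction k (p := fun x => x * 1 = x) ?_ ?_ ?_ (fun N => ?_) x
  · simp only [HTwC.zero_mul']
  · intro a b ha hb; simp only [HTwC.add_mul', ha, hb]
  · intro c a ha; simp only [HTwC.smul_mul', ha]
  have : Unique (Cocycle N.obj (ProjCplx.zero : ProjCplx A).obj) :=
    { default := 0, uniq := fun s => cocycle_ext fun i j _ => (isZero_zero_X j).eq_of_tgt _ _ }
  rw [HTwC.one_def, HTwC.of_mul_of, eulerC]
  simp only [cl_isZero (isZero_zero_X _), map_zero,
    add_zero, neg_zero, zpow_zero, one_smul]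
  rw [Fintype.sum_unique]
  exact HTwC.of_congr k (twistIsoOfIsZeroLeft _ isZero_zero_X)

instance : Ring (HTwC k A) :=
  { (inferInstance : AddCommGroup (HTwC k A)), (inferInstance : Mul (HTwC k A)),
    (inferInstance : One (HTwC k A)) with
    left_distrib := HTwC.mul_add' k
    right_distrib := HTwC.add_mul' k
    zero_mul := HTwC.zero_mul' k
    mul_zero := HTwC.mul_zero' k
    mul_assoc := HTwC.mul_assoc' k
    one_mul := HTwC.one_mul' k
    mul_one := HTwC.mul_one' k }

instance : Algebra ℂ (HTwC k A) := Algebra.ofModule (HTwC.smul_mul' k) (fun c x y =>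
  HTwC.mul_smul' k c x y)

end HallComplexAlgebra

/-! ### Endomorphisms of extensions -/

lemma card_le_of_ker_le {G H K : Type*} [AddCommGroup G] [AddCommGroup H] [Finite H] [Finite K]
    (δ : G →+ H) (j : K → G) (hj : ∀ g, δ g = 0 → ∃ x, j x = g) :
    Nat.card G ≤ Nat.card K * Nat.card δ.range := by
  rw [card_ker_mul_card_range δ]
  refine Nat.mul_le_mul_right _ ?_
  choose f hf using fun g : δ.ker => hj g.1 g.2
  exact Nat.card_le_card_of_injective f fun a b h => Subtype.ext (by rw [← hf, ← hf, h])

section EndCount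

variable {D : Type u} [Category.{v} D] [Abelian D] [∀ X Y : D, Finite (X ⟶ Y)]

lemma card_hom_pos (X Y : D) : 0 < Nat.card (X ⟶ Y) := Nat.card_pos

lemma card_hom_to_le {S : ShortComplex D} (hS : S.ShortExact) (X : D) :
    Nat.card (X ⟶ S.X₂) ≤ Nat.card (X ⟶ S.X₁) * Nat.card (X ⟶ S.X₃) := by
  have := hS.mono_f
  refine (card_le_of_ker_le (Preadditive.rightComp X S.g) (fun f : X ⟶ S.X₁ => f ≫ S.f)
    fun g hg => ⟨hS.exact.lift g hg, hS.exact.lift_f _ _⟩).trans ?_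
  exact Nat.mul_le_mul_left _ (Nat.card_le_card_of_injective _ Subtype.val_injective)

lemma card_hom_from_le {S : ShortComplex D} (hS : S.ShortExact) (X : D) :
    Nat.card (S.X₂ ⟶ X) ≤ Nat.card (S.X₃ ⟶ X) * Nat.card (S.X₁ ⟶ X) := by
  have := hS.epi_g
  refine (card_le_of_ker_le (Preadditive.leftComp X S.f) (fun f : S.X₃ ⟶ X => S.g ≫ f)
    fun g hg => ⟨hS.exact.desc g hg, hS.exact.g_desc _ _⟩).trans ?_
  exact Nat.mul_le_mul_left _ (Nat.card_le_card_of_injective _ Subtype.val_injective)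

/-- If the identity of `S.X₁` does not extend to `S.X₂` then left exactness of `Hom(-, S.X₁)` gives
a strict inequality. -/
lemma card_hom_from_lt {S : ShortComplex D} (hS : S.ShortExact)
    (h : ¬ ∃ r : S.X₂ ⟶ S.X₁, S.f ≫ r = 𝟙 _) :
    Nat.card (S.X₂ ⟶ S.X₁) < Nat.card (S.X₃ ⟶ S.X₁) * Nat.card (S.X₁ ⟶ S.X₁) := by
  have := hS.epi_g
  refine (card_le_of_ker_le (Preadditive.leftComp S.X₁ S.f) (fun f : S.X₃ ⟶ S.X₁ => S.g ≫ f)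
    fun g hg => ⟨hS.exact.desc g hg, hS.exact.g_desc _ _⟩).trans_lt ?_
  refine Nat.mul_lt_mul_of_pos_left ?_ (card_hom_pos _ _)
  refine lt_of_le_of_ne (Nat.card_le_card_of_injective _ Subtype.val_injective) fun hc => h ?_
  have : (Preadditive.leftComp S.X₁ S.f).range = ⊤ := AddSubgroup.eq_top_of_card_eq _ hc
  obtain ⟨r, hr⟩ := (this ▸ AddSubgroup.mem_top (𝟙 S.X₁) :
    𝟙 S.X₁ ∈ (Preadditive.leftComp S.X₁ S.f).range)
  exact ⟨r, hr⟩

/-- The middle term of a non-split extension has fewer endomorphisms than the direct sum of the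
outer terms. -/
lemma card_end_lt_of_not_split {S : ShortComplex D} (hS : S.ShortExact)
    (h : ¬ ∃ r : S.X₂ ⟶ S.X₁, S.f ≫ r = 𝟙 _) :
    Nat.card (S.X₂ ⟶ S.X₂) < Nat.card (S.X₃ ⟶ S.X₁) * Nat.card (S.X₁ ⟶ S.X₁) *
      (Nat.card (S.X₃ ⟶ S.X₃) * Nat.card (S.X₁ ⟶ S.X₃)) :=
  (card_hom_to_le hS S.X₂).trans_lt (Nat.mul_lt_mul_of_lt_of_le (card_hom_from_lt hS h)
    (card_hom_from_le hS S.X₃) (Nat.mul_pos (card_hom_pos _ _) (card_hom_pos _ _)))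

end EndCount

section TwistEnd

variable {C : Type u} [Category.{v} C] [Preadditive C] [HasBinaryBiproducts C] {ι : Type*}
  {c : ComplexShape ι} {M N : HomologicalComplex C c}

variable (M N) in
/-- The inclusion of the second summand of a direct sum. -/
def sumInr : M ⟶ twist (0 : Cocycle M N) where
  f i := tInr _ i

variable (M N) in
/-- The projection to the first summand of a direct sum. -/
def sumFst : twist (0 : Cocycle M N) ⟶ N where
  f i := tFst _ i

lemma card_end_sum : Nat.card (twist (0 : Cocycle M N) ⟶ twist (0 : Cocycle M N)) =
    Nat.card (M ⟶ N) * Nat.card (N ⟶ N) * (Nat.card (M ⟶ M) * Nat.card (N ⟶ M)) := by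
  rw [← Nat.card_prod, ← Nat.card_prod, ← Nat.card_prod]
  refine Nat.card_congr
    { toFun := fun f => ((sumInr M N ≫ f ≫ sumFst M N, twistInl 0 ≫ f ≫ sumFst M N),
        (sumInr M N ≫ f ≫ twistSnd 0, twistInl 0 ≫ f ≫ twistSnd 0))
      invFun := fun x => sumFst M N ≫ (x.1.2 ≫ twistInl 0 + x.2.2 ≫ sumInr M N) +
        twistSnd 0 ≫ (x.1.1 ≫ twistInl 0 + x.2.1 ≫ sumInr M N)
      left_inv := fun f => ?_
      right_inv := fun x => ?_ }
  · ext i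
    apply twist_hom_ext_from <;> apply twist_hom_ext_to <;> simp [sumInr, sumFst]
  · refine Prod.ext (Prod.ext ?_ ?_) (Prod.ext ?_ ?_) <;> ext i <;> simp [sumInr, sumFst]

end TwistEnd

/-- Among the twisted direct sums, the split ones have the largest number of endomorphisms. This is
the order with respect to which products of classes are triangular. -/
lemma card_end_twist_lt {A : Type u} [Category.{v} A] [Abelian A] [∀ X Y : A, Finite (X ⟶ Y)]
    {M N : Z2Cplx A} (s : Cocycle M N) (hs : s ∉ (coboundary M N).range) :
    Nat.card (twist s ⟶ twist s) <
      Nat.card (twist (0 : Cocycle M N) ⟶ twist (0 : Cocycle M N)) := by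
  rw [card_end_sum]
  refine card_end_lt_of_not_split (twistExt s).shortExact ?_
  rintro ⟨r, hr⟩
  change twist s ⟶ N at r
  change twistInl s ≫ r = 𝟙 _ at hr
  -- A retraction of the inclusion of `N` is `(1, h)` with `h` a primitive of `s`.
  refine hs ⟨fun i => tInr s i ≫ r.f i, cocycle_ext fun i j _ => ?_⟩
  have h₁ : tInl s j ≫ r.f j = 𝟙 _ := HomologicalComplex.congr_hom hr j
  have h₂ := tInr s i ≫= r.comm i j
  rw [tInr_d_assoc, h₁, Category.comp_id] at h₂
  rw [coboundary_apply, Category.assoc, h₂]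
  abel

/-! ### Products of classes of complexes -/

section Products

variable {A : Type u} [Category.{v} A] [Abelian A]

/-- The direct sum of two complexes of projectives, with the second one as sub-complex. -/
def ProjCplx.sum (M N : ProjCplx A) : ProjCplx A := ProjCplx.twist (0 : Cocycle M.obj N.obj)

/-- The class `[M₀] - [M₁]` of a complex in the Grothendieck group. -/
def ProjCplx.hat (M : ProjCplx A) : K₀ A := cl (M.obj.X 0) - cl (M.obj.X 1)

lemma ProjCplx.hat_sum (M N : ProjCplx A) : (M.sum N).hat = M.hat + N.hat := by
  simp only [ProjCplx.hat, ProjCplx.sum, ProjCplx.cl_twist]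
  abel

lemma ProjCplx.hat_congr {M N : ProjCplx A} (e : M.obj ≅ N.obj) : M.hat = N.hat := by
  have h (i : ZMod 2) : cl (M.obj.X i) = cl (N.obj.X i) :=
    cl_congr ((HomologicalComplex.eval A _ i).mapIso e)
  simp only [ProjCplx.hat, h]

/-- The number of endomorphisms of a complex of projectives. -/
def ProjCplx.endCard (M : ProjCplx A) : ℕ := Nat.card (M.obj ⟶ M.obj)

variable (k : Type w) [Field k] [Finite k] [Linear k A] [EnoughProjectives A]
  [∀ X Y : A, Finite (X ⟶ Y)] [∀ X : A, HasProjectiveDimensionLE X 1]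

/-- The class of the direct sum is the leading term of a product. -/
lemma HTwC.of_mul_of_sub_mem (M N : ProjCplx A) : ∃ c : ℂ, c ≠ 0 ∧
    HTwC.of k M * HTwC.of k N - c • HTwC.of k (M.sum N) ∈
      Submodule.span ℂ (HTwC.of k '' {L | L.endCard < (M.sum N).endCard}) := by
  classical
  let B := Finset.univ.filter fun s : Cocycle M.obj N.obj => s ∈ (coboundary M.obj N.obj).range
  refine ⟨tPar k ^ (- eulerC k M N) * B.card,
    mul_ne_zero (tPar_zpow_ne_zero k _) (Nat.cast_ne_zero.2 (Finset.card_ne_zero.2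
      ⟨0, Finset.mem_filter.2 ⟨Finset.mem_univ _, zero_mem _⟩⟩)), ?_⟩
  have h₁ : ∑ s ∈ B, HTwC.of k (ProjCplx.twist s) = (B.card : ℂ) • HTwC.of k (M.sum N) := by
    rw [Finset.sum_congr rfl (g := fun _ => HTwC.of k (M.sum N)), Finset.sum_const,
      Nat.cast_smul_eq_nsmul]
    intro s hs
    obtain ⟨h, hh⟩ := (Finset.mem_filter.1 hs).2
    exact HTwC.of_congr k (twistIso s 0 h (by rw [sub_zero, hh]))
  rw [HTwC.of_mul_of, ← Finset.sum_filter_add_sum_filter_not Finset.univ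
    (fun s : Cocycle M.obj N.obj => s ∈ (coboundary M.obj N.obj).range), h₁, smul_add, smul_smul,
    add_sub_cancel_left]
  refine Submodule.smul_mem _ _ (Submodule.sum_mem _ fun s hs => Submodule.subset_span ⟨_, ?_, rfl⟩)
  exact card_end_twist_lt s (Finset.mem_filter.1 hs).2

/-- If all extensions split then a product is a multiple of the class of the direct sum. -/
lemma HTwC.of_mul_of_of_split (M N : ProjCplx A)
    (h : ∀ s : Cocycle M.obj N.obj, s ∈ (coboundary M.obj N.obj).range) :
    HTwC.of k M * HTwC.of k N =
      (tPar k ^ eulerC k M N / Nat.card (M.obj ⟶ N.obj)) • HTwC.of k (M.sum N) := by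
  have h₁ (s : Cocycle M.obj N.obj) :
      HTwC.of k (ProjCplx.twist s) = HTwC.of k (M.sum N) := by
    obtain ⟨h, hh⟩ := h s
    exact HTwC.of_congr k (twistIso s 0 h (by rw [sub_zero, hh]))
  have h₂ : (coboundary M.obj N.obj).range = ⊤ := eq_top_iff.2 fun s _ => h s
  have h₃ := card_ker_mul_card_range (coboundary M.obj N.obj)
  rw [h₂, card_ker_coboundary, Nat.card_congr (AddSubgroup.topEquiv).toEquiv] at h₃
  have h₄ := card_graded_hom k M N
  rw [h₃] at h₄
  push_cast at h₄
  have h₅ : (Nat.card (M.obj ⟶ N.obj) : ℂ) ≠ 0 := by exact_mod_cast Nat.card_pos.ne'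
  rw [HTwC.of_mul_of, Finset.sum_congr rfl fun s _ => h₁ s, Finset.sum_const, Finset.card_univ,
    ← Nat.card_eq_fintype_card, ← Nat.cast_smul_eq_nsmul ℂ, smul_smul,
    ← mul_div_cancel_left₀ (Nat.card (Cocycle M.obj N.obj) : ℂ) h₅, h₄, ← mul_div_assoc,
    ← tPar_zpow_add]
  congr 3
  ring

end Products

/-! ### Two-periodic complexes through their components -/

section ZMod2

variable {A : Type u} [Category.{v} A] [Abelian A]

lemma zmod_two_cases {p : ZMod 2 → Prop} (h0 : p 0) (h1 : p 1) (i : ZMod 2) : p i := by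
  match i with
  | (0 : Fin 2) => exact h0
  | (1 : Fin 2) => exact h1

lemma z2_not_rel (i : ZMod 2) : ¬ (ComplexShape.up (ZMod 2)).Rel i i := by
  change ¬ (i + 1 = i)
  revert i
  decide

lemma z2_hom_ext {M N : Z2Cplx A} {f g : M ⟶ N} (h1 : f.f 1 = g.f 1) (h0 : f.f 0 = g.f 0) :
    f = g := HomologicalComplex.hom_ext _ _ (zmod_two_cases h0 h1)

/-- A morphism of `ℤ/2`-graded complexes from its two components. -/
def z2Hom {M N : Z2Cplx A} (f₁ : M.X 1 ⟶ N.X 1) (f₀ : M.X 0 ⟶ N.X 0)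
    (h₁ : f₁ ≫ N.d 1 0 = M.d 1 0 ≫ f₀) (h₀ : f₀ ≫ N.d 0 1 = M.d 0 1 ≫ f₁) : M ⟶ N where
  f i := match i with
    | (0 : Fin 2) => f₀
    | (1 : Fin 2) => f₁
  comm' i j h := by
    match i, j with
    | (0 : Fin 2), (1 : Fin 2) => exact h₀
    | (1 : Fin 2), (0 : Fin 2) => exact h₁
    | (0 : Fin 2), (0 : Fin 2) => exact absurd h (z2_not_rel _)
    | (1 : Fin 2), (1 : Fin 2) => exact absurd h (z2_not_rel _)

@[simp] lemma z2Hom_f_one {M N : Z2Cplx A} (f₁ : M.X 1 ⟶ N.X 1) (f₀ : M.X 0 ⟶ N.X 0)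
    (h₁ : f₁ ≫ N.d 1 0 = M.d 1 0 ≫ f₀) (h₀ : f₀ ≫ N.d 0 1 = M.d 0 1 ≫ f₁) :
    (z2Hom f₁ f₀ h₁ h₀).f 1 = f₁ := rfl

@[simp] lemma z2Hom_f_zero {M N : Z2Cplx A} (f₁ : M.X 1 ⟶ N.X 1) (f₀ : M.X 0 ⟶ N.X 0)
    (h₁ : f₁ ≫ N.d 1 0 = M.d 1 0 ≫ f₀) (h₀ : f₀ ≫ N.d 0 1 = M.d 0 1 ≫ f₁) :
    (z2Hom f₁ f₀ h₁ h₀).f 0 = f₀ := rfl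

/-- An isomorphism of `ℤ/2`-graded complexes from its two components. -/
def z2Iso {M N : Z2Cplx A} (e₁ : M.X 1 ≅ N.X 1) (e₀ : M.X 0 ≅ N.X 0)
    (h₁ : e₁.hom ≫ N.d 1 0 = M.d 1 0 ≫ e₀.hom) (h₀ : e₀.hom ≫ N.d 0 1 = M.d 0 1 ≫ e₁.hom) :
    M ≅ N where
  hom := z2Hom e₁.hom e₀.hom h₁ h₀
  inv := z2Hom e₁.inv e₀.inv (by rw [Iso.inv_comp_eq, reassoc_of% h₁]; simp)
    (by rw [Iso.inv_comp_eq, reassoc_of% h₀]; simp)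
  hom_inv_id := z2_hom_ext (by simp) (by simp)
  inv_hom_id := z2_hom_ext (by simp) (by simp)

/-- A cocycle of `ℤ/2`-graded complexes from its two components. -/
def z2Cocycle {M N : Z2Cplx A} (s₁ : M.X 1 ⟶ N.X 0) (s₀ : M.X 0 ⟶ N.X 1)
    (h₁ : M.d 1 0 ≫ s₀ + s₁ ≫ N.d 0 1 = 0) (h₀ : M.d 0 1 ≫ s₁ + s₀ ≫ N.d 1 0 = 0) :
    Cocycle M N :=
  ⟨fun i j => match i, j with
    | (0 : Fin 2), (0 : Fin 2) => 0
    | (0 : Fin 2), (1 : Fin 2) => s₀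
    | (1 : Fin 2), (0 : Fin 2) => s₁
    | (1 : Fin 2), (1 : Fin 2) => 0,
    fun i j h => by
      match i, j with
      | (0 : Fin 2), (0 : Fin 2) => rfl
      | (0 : Fin 2), (1 : Fin 2) => exact absurd rfl h
      | (1 : Fin 2), (0 : Fin 2) => exact absurd rfl h
      | (1 : Fin 2), (1 : Fin 2) => rfl,
    fun i j l => by
      match i, j, l with
      | (0 : Fin 2), (1 : Fin 2), (0 : Fin 2) => exact h₀
      | (1 : Fin 2), (0 : Fin 2), (1 : Fin 2) => exact h₁
      | (0 : Fin 2), (0 : Fin 2), (0 : Fin 2) => exact (by simp : M.d 0 0 ≫ 0 + 0 ≫ N.d 0 0 = 0)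
      | (1 : Fin 2), (1 : Fin 2), (1 : Fin 2) => exact (by simp : M.d 1 1 ≫ 0 + 0 ≫ N.d 1 1 = 0)
      | (0 : Fin 2), (0 : Fin 2), (1 : Fin 2) =>
        exact (by simp : M.d 0 0 ≫ s₀ + 0 ≫ N.d 0 1 = 0)
      | (1 : Fin 2), (1 : Fin 2), (0 : Fin 2) =>
        exact (by simp : M.d 1 1 ≫ s₁ + 0 ≫ N.d 1 0 = 0)
      | (0 : Fin 2), (1 : Fin 2), (1 : Fin 2) =>
        exact (by simp : M.d 0 1 ≫ 0 + s₀ ≫ N.d 1 1 = 0)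
      | (1 : Fin 2), (0 : Fin 2), (0 : Fin 2) =>
        exact (by simp : M.d 1 0 ≫ 0 + s₁ ≫ N.d 0 0 = 0)⟩

lemma z2_cocycle_ext {M N : Z2Cplx A} {s s' : Cocycle M N} (h₁ : s.1 1 0 = s'.1 1 0)
    (h₀ : s.1 0 1 = s'.1 0 1) : s = s' := by
  refine cocycle_ext fun i j h => ?_
  match i, j with
  | (0 : Fin 2), (1 : Fin 2) => exact h₀
  | (1 : Fin 2), (0 : Fin 2) => exact h₁
  | (0 : Fin 2), (0 : Fin 2) => exact absurd h (z2_not_rel _)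
  | (1 : Fin 2), (1 : Fin 2) => exact absurd h (z2_not_rel _)

/-- A graded map of `ℤ/2`-graded objects from its two components. -/
def z2Graded {X Y : ZMod 2 → A} (h₁ : X 1 ⟶ Y 1) (h₀ : X 0 ⟶ Y 0) (i : ZMod 2) : X i ⟶ Y i :=
  match i with
  | (0 : Fin 2) => h₀
  | (1 : Fin 2) => h₁

lemma mem_range_coboundary {M N : Z2Cplx A} {s : Cocycle M N} (h₁ : M.X 1 ⟶ N.X 1)
    (h₀ : M.X 0 ⟶ N.X 0) (e₁ : s.1 1 0 = h₁ ≫ N.d 1 0 - M.d 1 0 ≫ h₀)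
    (e₀ : s.1 0 1 = h₀ ≫ N.d 0 1 - M.d 0 1 ≫ h₁) : s ∈ (coboundary M N).range :=
  ⟨z2Graded (X := M.X) (Y := N.X) h₁ h₀, z2_cocycle_ext e₁.symm e₀.symm⟩

/-- A complex isomorphic to some `K_P`: the differential in degrees `1 ⟶ 0` is invertible, and the
other one vanishes. -/
structure IsDisk (K : Z2Cplx A) : Prop where
  iso : IsIso (K.d 1 0)
  zero : K.d 0 1 = 0

/-- Contractible complexes are projective relative to the degreewise split sequences. -/
lemma IsDisk.left_split {K : Z2Cplx A} (hK : IsDisk K) {M : Z2Cplx A} (s : Cocycle K M) :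
    s ∈ (coboundary K M).range := by
  have := hK.iso
  refine mem_range_coboundary 0 (- inv (K.d 1 0) ≫ s.1 1 0) (by simp) ?_
  have := cocycle_comm' s 1 0 1
  rw [hK.zero, zero_comp, sub_zero, Preadditive.neg_comp, Category.assoc, ← Preadditive.comp_neg,
    ← this, IsIso.inv_hom_id_assoc]

/-- Contractible complexes are injective relative to the degreewise split sequences. -/
lemma IsDisk.right_split {K : Z2Cplx A} (hK : IsDisk K) {M : Z2Cplx A} (s : Cocycle M K) :
    s ∈ (coboundary M K).range := by
  have := hK.iso
  refine mem_range_coboundary (s.1 1 0 ≫ inv (K.d 1 0)) 0 (by simp) ?_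
  have := cocycle_comm' s 0 1 0
  rw [zero_comp, zero_sub, ← Category.assoc, this, Preadditive.neg_comp, Category.assoc,
    IsIso.hom_inv_id, Category.comp_id, neg_neg]

lemma IsDisk.card_hom_from {K : Z2Cplx A} (hK : IsDisk K) (M : Z2Cplx A) :
    Nat.card (K ⟶ M) = Nat.card (K.X 1 ⟶ M.X 1) := by
  have := hK.iso
  refine Nat.card_congr
    { toFun := fun f => f.f 1
      invFun := fun f => z2Hom f (inv (K.d 1 0) ≫ f ≫ M.d 1 0) (by simp) (by simp [hK.zero])
      left_inv := fun f => z2_hom_ext rfl ?_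
      right_inv := fun f => rfl }
  simp

lemma IsDisk.card_hom_to {K : Z2Cplx A} (hK : IsDisk K) (M : Z2Cplx A) :
    Nat.card (M ⟶ K) = Nat.card (M.X 0 ⟶ K.X 0) := by
  have := hK.iso
  refine Nat.card_congr
    { toFun := fun f => f.f 0
      invFun := fun f => z2Hom (M.d 1 0 ≫ f ≫ inv (K.d 1 0)) f (by simp) (by simp [hK.zero])
      left_inv := fun f => z2_hom_ext ?_ rfl
      right_inv := fun f => rfl }
  rw [z2Hom_f_one, ← f.comm_assoc, IsIso.hom_inv_id, Category.comp_id]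

end ZMod2

section DiskProducts

variable {A : Type u} [Category.{v} A] [Abelian A]

lemma IsDisk.cl_eq {K : Z2Cplx A} (hK : IsDisk K) : cl (K.X 0) = cl (K.X 1) :=
  have := hK.iso
  (cl_congr (asIso (K.d 1 0))).symm

lemma ProjCplx.isDisk_K {P : A} (hP : Projective P) : IsDisk (ProjCplx.K hP).obj :=
  ⟨inferInstanceAs (IsIso (𝟙 P)), rfl⟩

variable (k : Type w) [Field k] [Finite k] [Linear k A] [EnoughProjectives A]
  [∀ X Y : A, Finite (X ⟶ Y)] [∀ X : A, HasProjectiveDimensionLE X 1]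

lemma HTwC.disk_mul {K : ProjCplx A} (hK : IsDisk K.obj) (M : ProjCplx A) :
    HTwC.of k K * HTwC.of k M =
      tPar k ^ eulerK k A (cl (K.obj.X 1)) M.hat • HTwC.of k (K.sum M) := by
  have := K.property 1
  rw [HTwC.of_mul_of_of_split k K M hK.left_split, hK.card_hom_from, card_hom_of_projective k,
    div_eq_mul_inv, ← zpow_neg, ← tPar_zpow_add, eulerC, hK.cl_eq, ProjCplx.hat, map_sub]
  congr 2
  ring

lemma HTwC.mul_disk {K : ProjCplx A} (hK : IsDisk K.obj) (M : ProjCplx A) :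
    HTwC.of k M * HTwC.of k K =
      tPar k ^ (- eulerK k A M.hat (cl (K.obj.X 1))) • HTwC.of k (M.sum K) := by
  have := M.property 0
  rw [HTwC.of_mul_of_of_split k M K hK.right_split, hK.card_hom_to, card_hom_of_projective k,
    div_eq_mul_inv, ← zpow_neg, ← tPar_zpow_add, eulerC, hK.cl_eq, ProjCplx.hat, map_sub,
    AddMonoidHom.sub_apply]
  congr 2
  ring

lemma HTwC.of_sum_comm (M N : ProjCplx A) : HTwC.of k (M.sum N) = HTwC.of k (N.sum M) :=
  HTwC.of_congr k (twistZeroSwap M.obj N.obj)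

lemma HTwC.disk_comm {K : ProjCplx A} (hK : IsDisk K.obj) (M : ProjCplx A) :
    HTwC.of k K * HTwC.of k M =
      tPar k ^ symEuler k A (cl (K.obj.X 1)) M.hat • (HTwC.of k M * HTwC.of k K) := by
  rw [HTwC.disk_mul k hK, HTwC.mul_disk k hK, smul_smul, ← tPar_zpow_add, HTwC.of_sum_comm,
    symEuler]
  congr 2
  ring

end DiskProducts

/-! ### The shift of complexes -/

section Dag

variable {A : Type u} [Category.{v} A] [Abelian A]

/-- The shift of an isomorphism. -/
def dagIso {M N : Z2Cplx A} (e : M ≅ N) : dag M ≅ dag N :=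
  HomologicalComplex.Hom.isoOfComponents
    (fun i => (HomologicalComplex.eval A _ (i + 1)).mapIso e) (by
      intro i j _
      simp [dag])

/-- Shifting twice gives back the complex. -/
def dagDag (M : Z2Cplx A) : dag (dag M) ≅ M :=
  z2Iso (M := dag (dag M)) (Iso.refl (M.X 1)) (Iso.refl (M.X 0))
    ((Category.id_comp _).trans ((neg_neg (M.d 1 0)).symm.trans (Category.comp_id _).symm))
    ((Category.id_comp _).trans ((neg_neg (M.d 0 1)).symm.trans (Category.comp_id _).symm))

/-- The shift of a cocycle. -/
def dagCocycle {M N : Z2Cplx A} (s : Cocycle M N) : Cocycle (dag M) (dag N) :=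
  ⟨fun i j => - s.1 (i + 1) (j + 1), fun i j h =>
    neg_eq_zero.2 (cocycle_shape s _ _ fun h' => h (add_right_cancel h')), fun i j l => by
    have h := cocycle_comm s (i + 1) (j + 1) (l + 1)
    have h' : (-M.d (i + 1) (j + 1)) ≫ (-s.1 (j + 1) (l + 1)) +
        (-s.1 (i + 1) (j + 1)) ≫ (-N.d (j + 1) (l + 1)) = 0 := by simpa using h
    exact h'⟩

lemma dagCocycle_bijective {M N : Z2Cplx A} :
    Function.Bijective (dagCocycle : Cocycle M N → Cocycle (dag M) (dag N)) := by
  constructor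
  · intro s s' h
    have h' (i j : ZMod 2) : - s.1 (i + 1) (j + 1) = - s'.1 (i + 1) (j + 1) :=
      congrFun (congrFun (congrArg Subtype.val h) i) j
    exact z2_cocycle_ext (neg_injective (h' 0 1)) (neg_injective (h' 1 0))
  · intro s
    let σ : M.X 1 ⟶ N.X 0 := s.1 0 1
    let τ : M.X 0 ⟶ N.X 1 := s.1 1 0
    have h₁ : (-M.d 1 0) ≫ τ + σ ≫ (-N.d 0 1) = 0 := cocycle_comm s 0 1 0
    have h₀ : (-M.d 0 1) ≫ σ + τ ≫ (-N.d 1 0) = 0 := cocycle_comm s 1 0 1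
    exact ⟨z2Cocycle (-σ) (-τ) (by simpa using h₁) (by simpa using h₀),
      z2_cocycle_ext (neg_neg τ) (neg_neg σ)⟩

/-- The shift commutes with twisted direct sums. -/
def dagTwist {M N : Z2Cplx A} (s : Cocycle M N) : dag (twist s) ≅ twist (dagCocycle s) :=
  have h {X Y X' Y' : A} (a : X ⟶ X') (b : Y ⟶ X') (d : Y ⟶ Y') :
      -biprod.desc (a ≫ biprod.inl) (b ≫ biprod.inl + d ≫ biprod.inr) =
        biprod.desc ((-a) ≫ biprod.inl) ((-b) ≫ biprod.inl + (-d) ≫ biprod.inr) :=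
    biprod.hom_ext' _ _ (by simp) (by simp [add_comm])
  HomologicalComplex.Hom.isoOfComponents (C₁ := dag (twist s))
    (C₂ := twist (dagCocycle s)) (fun i => Iso.refl (N.X (i + 1) ⊞ M.X (i + 1))) fun i j _ =>
    (Category.id_comp _).trans ((h (N.d (i + 1) (j + 1)) (s.1 (i + 1) (j + 1))
      (M.d (i + 1) (j + 1))).symm.trans (Category.comp_id _).symm)

lemma dag_acyclic {M : Z2Cplx A} (hM : M.Acyclic) : (dag M).Acyclic := by
  have key (i j : ZMod 2) (hij : i + 1 = j) (hji : j + 1 = i) :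
      ((dag M).sc' i j i).Exact := by
    have h := (M.exactAt_iff' (i + 1) (j + 1) (i + 1)
      (ComplexShape.prev_eq' _ (by rw [← hij]; rfl))
      (ComplexShape.next_eq' _ (by rw [← hji]; rfl))).1
      (hM (j + 1))
    refine ShortComplex.exact_of_iso (ShortComplex.isoMk (S₁ := M.sc' (i + 1) (j + 1) (i + 1))
      (S₂ := (dag M).sc' i j i) (Iso.refl (M.X (i + 1))) (-Iso.refl (M.X (j + 1)))
      (Iso.refl (M.X (i + 1))) ?_ ?_) h
    · have : 𝟙 _ ≫ (-M.d (i + 1) (j + 1)) = M.d (i + 1) (j + 1) ≫ (-𝟙 _) := by simp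
      exact this
    · have : (-𝟙 _) ≫ (-M.d (j + 1) (i + 1)) = M.d (j + 1) (i + 1) ≫ 𝟙 _ := by simp
      exact this
  intro i
  match i with
  | (0 : Fin 2) => exact ((dag M).exactAt_iff' (1 : ZMod 2) (0 : ZMod 2) (1 : ZMod 2)
      (ComplexShape.prev_eq' _ rfl) (ComplexShape.next_eq' _ rfl)).2 (key 1 0 rfl rfl)
  | (1 : Fin 2) => exact ((dag M).exactAt_iff' (0 : ZMod 2) (1 : ZMod 2) (0 : ZMod 2)
      (ComplexShape.prev_eq' _ rfl) (ComplexShape.next_eq' _ rfl)).2 (key 0 1 rfl rfl)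

variable (A) in
/-- The shift on isomorphism classes of complexes of projectives. -/
def dagCl : IsoCl (ProjCplx A) → IsoCl (ProjCplx A) :=
  Quotient.map (sa := isIsomorphicSetoid _) (sb := isIsomorphicSetoid _) ProjCplx.dag
    fun _ _ ⟨e⟩ => ⟨ObjectProperty.isoMk _ (dagIso ((ObjectProperty.ι _).mapIso e))⟩

lemma ProjCplx.hat_dag (M : ProjCplx A) : M.dag.hat = - M.hat := by
  change cl (M.obj.X 1) - cl (M.obj.X 0) = _
  rw [ProjCplx.hat, neg_sub]

variable (k : Type w) [Field k] [Linear k A]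

/-- The shift as a linear endomorphism of the twisted Hall algebra of complexes. -/
def HTwC.dagLin : HTwC k A →ₗ[ℂ] HTwC k A := Finsupp.lmapDomain ℂ ℂ (dagCl A)

lemma HTwC.dagLin_of (M : ProjCplx A) : HTwC.dagLin k (HTwC.of k M) = HTwC.of k M.dag :=
  Finsupp.mapDomain_single

variable [Finite k] [EnoughProjectives A]
  [∀ X Y : A, Finite (X ⟶ Y)] [∀ X : A, HasProjectiveDimensionLE X 1]

lemma eulerC_dag (M N : ProjCplx A) : eulerC k M.dag N.dag = eulerC k M N := by
  change eulerK k A (cl (M.obj.X 1)) (cl (N.obj.X 1)) +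
    eulerK k A (cl (M.obj.X 0)) (cl (N.obj.X 0)) = _
  rw [eulerC, add_comm]

lemma HTwC.dagLin_mul (x y : HTwC k A) :
    HTwC.dagLin k (x * y) = HTwC.dagLin k x * HTwC.dagLin k y := by
  refine HTwC.induction k (p := fun x => dagLin k (x * y) = dagLin k x * dagLin k y)
    ?_ ?_ ?_ (fun M => ?_) x
  · simp only [zero_mul, map_zero]
  · intro a b ha hb; simp only [add_mul, map_add, ha, hb]
  · intro c a ha; simp only [Algebra.smul_mul_assoc, map_smul, ha]
  refine HTwC.induction k
    (p := fun y => dagLin k (of k M * y) = dagLin k (of k M) * dagLin k y)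
    ?_ ?_ ?_ (fun N => ?_) y
  · simp only [mul_zero, map_zero]
  · intro a b ha hb; simp only [mul_add, map_add, ha, hb]
  · intro c a ha; simp only [Algebra.mul_smul_comm, map_smul, ha]
  rw [dagLin_of, dagLin_of, of_mul_of, of_mul_of, map_smul, map_sum, eulerC_dag]
  congr 1
  refine Fintype.sum_bijective dagCocycle dagCocycle_bijective _ _ fun s => ?_
  rw [dagLin_of]
  exact HTwC.of_congr k (dagTwist s)

/-- The shift as an algebra endomorphism of the twisted Hall algebra of complexes. -/
def HTwC.dagHom : HTwC k A →ₐ[ℂ] HTwC k A :=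
  AlgHom.ofLinearMap (HTwC.dagLin k) (by
    refine (HTwC.dagLin_of k _).trans (HTwC.of_congr k ?_)
    exact z2Iso ((isZero_zero_X (1 + 1)).iso (isZero_zero_X 1))
      ((isZero_zero_X (0 + 1)).iso (isZero_zero_X 0)) ((isZero_zero_X (1 + 1)).eq_of_src _ _)
      ((isZero_zero_X (0 + 1)).eq_of_src _ _)) (HTwC.dagLin_mul k)

lemma HTwC.dagHom_of (M : ProjCplx A) : HTwC.dagHom k (HTwC.of k M) = HTwC.of k M.dag :=
  HTwC.dagLin_of k M

lemma HTwC.dag_disk_mul {K : ProjCplx A} (hK : IsDisk K.obj) (M : ProjCplx A) :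
    HTwC.of k K.dag * HTwC.of k M =
      tPar k ^ (- eulerK k A (cl (K.obj.X 1)) M.hat) • HTwC.of k (K.dag.sum M) := by
  have h := congrArg (HTwC.dagHom k) (HTwC.disk_mul k hK M.dag)
  have h₁ : HTwC.of k M.dag.dag = HTwC.of k M := HTwC.of_congr k (dagDag M.obj)
  rw [map_mul, map_smul, HTwC.dagHom_of, HTwC.dagHom_of, HTwC.dagHom_of, h₁, ProjCplx.hat_dag,
    map_neg] at h
  rw [h]
  congr 1
  refine HTwC.of_congr k ((dagTwist _).trans ?_)
  have : dagCocycle (0 : Cocycle K.obj M.dag.obj) = 0 := by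
    apply Subtype.ext; funext i j; exact neg_zero
  rw [this]
  exact twistZeroCongr (Iso.refl _) (dagDag M.obj)

lemma HTwC.dag_disk_comm {K : ProjCplx A} (hK : IsDisk K.obj) (M : ProjCplx A) :
    HTwC.of k K.dag * HTwC.of k M =
      tPar k ^ (- symEuler k A (cl (K.obj.X 1)) M.hat) • (HTwC.of k M * HTwC.of k K.dag) := by
  have h := congrArg (HTwC.dagHom k) (HTwC.disk_comm k hK M.dag)
  have h₁ : HTwC.of k M.dag.dag = HTwC.of k M := HTwC.of_congr k (dagDag M.obj)
  rw [map_mul, map_smul, map_mul, HTwC.dagHom_of, HTwC.dagHom_of, h₁, ProjCplx.hat_dag] at h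
  rw [h]
  congr 2
  simp only [symEuler, map_neg, AddMonoidHom.neg_apply]
  ring

end Dag

/-! ### The localized Hall algebra -/

section Localized

variable (k : Type w) [Field k] [Finite k] {A : Type u} [Category.{v} A] [Abelian A] [Linear k A]
  [EnoughProjectives A] [∀ X Y : A, Finite (X ⟶ Y)] [∀ X : A, HasProjectiveDimensionLE X 1]

/-- The presentation of the localization as a quotient of a free algebra. -/
def DH.mkFree : FreeAlgebra ℂ (HTwC k A ⊕ AcyclicCplx A) →ₐ[ℂ] DH k A :=
  RingQuot.mkAlgHom ℂ (DHRel k A)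

/-- The canonical algebra homomorphism from the Hall algebra to its localization. -/
def DH.fromH : HTwC k A →ₐ[ℂ] DH k A :=
  AlgHom.ofLinearMap
    { toFun := fun x => RingQuot.mkAlgHom ℂ (DHRel k A) (FreeAlgebra.ι ℂ (Sum.inl x))
      map_add' := fun x y => (RingQuot.mkAlgHom_rel ℂ (DHRel.add x y)).trans (map_add _ _ _)
      map_smul' := fun c x => (RingQuot.mkAlgHom_rel ℂ (DHRel.smul c x)).trans (map_smul _ _ _) }
    ((RingQuot.mkAlgHom_rel ℂ DHRel.one).trans (map_one _))
    fun x y => (RingQuot.mkAlgHom_rel ℂ (DHRel.mul x y)).trans (map_mul _ _ _)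

lemma DH.fromH_of (M : ProjCplx A) : DH.fromH k (HTwC.of k M) = DH.of k M := rfl

variable {k}

lemma DH.of_mul_inv (M : ProjCplx A) (hM : M.obj.Acyclic) : DH.of k M * DH.inv k M hM = 1 := by
  have := RingQuot.mkAlgHom_rel ℂ (DHRel.mul_inv (k := k) ⟨M, hM⟩)
  rwa [map_mul, map_one] at this

lemma DH.inv_mul_of (M : ProjCplx A) (hM : M.obj.Acyclic) : DH.inv k M hM * DH.of k M = 1 := by
  have := RingQuot.mkAlgHom_rel ℂ (DHRel.inv_mul (k := k) ⟨M, hM⟩)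
  rwa [map_mul, map_one] at this

/-- The universal property of the localization. -/
def DH.lift {B : Type*} [Ring B] [Algebra ℂ B] (φ : HTwC k A →ₐ[ℂ] B) (ψ : AcyclicCplx A → B)
    (h₁ : ∀ M, φ (HTwC.of k M.1) * ψ M = 1) (h₂ : ∀ M, ψ M * φ (HTwC.of k M.1) = 1) :
    DH k A →ₐ[ℂ] B :=
  RingQuot.liftAlgHom ℂ ⟨FreeAlgebra.lift ℂ (Sum.elim φ ψ), by
    intro x y h
    cases h <;> simp [h₁, h₂]⟩

variable {B : Type*} [Ring B] [Algebra ℂ B] (φ : HTwC k A →ₐ[ℂ] B) (ψ : AcyclicCplx A → B)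
    (h₁ : ∀ M, φ (HTwC.of k M.1) * ψ M = 1) (h₂ : ∀ M, ψ M * φ (HTwC.of k M.1) = 1)

lemma DH.lift_fromH (x : HTwC k A) : DH.lift φ ψ h₁ h₂ (DH.fromH k x) = φ x := by
  change RingQuot.liftAlgHom ℂ _ (RingQuot.mkAlgHom ℂ (DHRel k A) _) = _
  rw [RingQuot.liftAlgHom_mkAlgHom_apply, FreeAlgebra.lift_ι_apply, Sum.elim_inl]

lemma DH.lift_of (M : ProjCplx A) : DH.lift φ ψ h₁ h₂ (DH.of k M) = φ (HTwC.of k M) :=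
  DH.lift_fromH φ ψ h₁ h₂ _

lemma DH.lift_inv (M : ProjCplx A) (hM : M.obj.Acyclic) :
    DH.lift φ ψ h₁ h₂ (DH.inv k M hM) = ψ ⟨M, hM⟩ := by
  change RingQuot.liftAlgHom ℂ _ (RingQuot.mkAlgHom ℂ (DHRel k A) _) = _
  rw [RingQuot.liftAlgHom_mkAlgHom_apply, FreeAlgebra.lift_ι_apply, Sum.elim_inr]

/-- A subspace of the localization that is stable under left multiplication by the generators and
contains `1` is the whole localization. -/
lemma DH.eq_top_of_mul_mem (W : Submodule ℂ (DH k A)) (h1 : 1 ∈ W)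
    (hof : ∀ M : ProjCplx A, ∀ x ∈ W, DH.of k M * x ∈ W)
    (hinv : ∀ (M : ProjCplx A) (hM : M.obj.Acyclic), ∀ x ∈ W, DH.inv k M hM * x ∈ W) :
    W = ⊤ := by
  refine eq_top_iff.2 fun z _ => ?_
  suffices h : ∀ a : FreeAlgebra ℂ (HTwC k A ⊕ AcyclicCplx A), ∀ x ∈ W,
      DH.mkFree k a * x ∈ W by
    obtain ⟨a, rfl⟩ := RingQuot.mkAlgHom_surjective ℂ (DHRel k A) z
    have := h a 1 h1
    rwa [mul_one] at this
  intro a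
  induction a using FreeAlgebra.induction with
  | grade0 r =>
    intro x hx
    rw [AlgHom.commutes, ← Algebra.smul_def]
    exact W.smul_mem r hx
  | grade1 g =>
    intro x hx
    rcases g with h | M
    · change DH.fromH k h * x ∈ W
      refine HTwC.induction k (p := fun h => DH.fromH k h * x ∈ W) ?_ ?_ ?_ (fun M => hof M x hx) h
      · simp
      · intro a b ha hb
        rw [map_add, add_mul]
        exact W.add_mem ha hb
      · intro c a ha
        rw [map_smul, Algebra.smul_mul_assoc]
        exact W.smul_mem c ha
    · exact hinv M.1 M.2 x hx
  | mul a b ha hb =>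
    intro x hx
    rw [map_mul, mul_assoc]
    exact ha _ (hb _ hx)
  | add a b ha hb =>
    intro x hx
    rw [map_add, add_mul]
    exact W.add_mem (ha _ hx) (hb _ hx)

end Localized

/-! ### Projective resolutions and extensions -/

section Resolutions

variable {A : Type u} [Category.{v} A] [Abelian A]

lemma ProjRes.mono_f {X : A} (r : ProjRes X) : Mono r.f := r.shortExact.mono_f

lemma ProjRes.epi_g {X : A} (r : ProjRes X) : Epi r.g := r.shortExact.epi_g

/-- A morphism to `r.Q` that is killed by `r.g` lifts to `r.P`. -/
lemma ProjRes.exists_lift {X T : A} (r : ProjRes X) (t : T ⟶ r.Q) (h : t ≫ r.g = 0) :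
    ∃ l : T ⟶ r.P, l ≫ r.f = t :=
  have := r.mono_f
  ⟨r.shortExact.exact.lift t h, r.shortExact.exact.lift_f _ _⟩

/-- In a hereditary category, subobjects of projectives are projective. -/
lemma projective_of_mono [∀ X : A, HasProjectiveDimensionLE X 1] {P Q : A} (f : P ⟶ Q) [Mono f]
    [Projective Q] : Projective P := by
  have hS : (ShortComplex.mk f (cokernel.π f) (cokernel.condition f)).ShortExact :=
    { exact := ShortComplex.exact_of_g_is_cokernel _ (cokernelIsCokernel f) }
  rw [projective_iff_hasProjectiveDimensionLT_one]
  exact hS.hasProjectiveDimensionLT_X₁ 1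
    (projective_iff_hasProjectiveDimensionLT_one.1 inferInstance)
    (inferInstanceAs (HasProjectiveDimensionLE (cokernel f) 1))

/-- The resolution of the cokernel of a monomorphism of projectives. -/
def ProjRes.ofMono {P Q : A} (hP : Projective P) (hQ : Projective Q) (f : P ⟶ Q) [Mono f] :
    ProjRes (cokernel f) where
  P := P
  Q := Q
  projP := hP
  projQ := hQ
  f := f
  g := cokernel.π f
  w := cokernel.condition f
  shortExact := { exact := ShortComplex.exact_of_g_is_cokernel _ (cokernelIsCokernel f) }

/-- A chosen projective resolution of length one. -/
def ProjRes.default [EnoughProjectives A] [∀ X : A, HasProjectiveDimensionLE X 1] (X : A) :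
    ProjRes X where
  P := kernel (Projective.π X)
  Q := Projective.over X
  projP := projective_of_mono (kernel.ι _)
  projQ := inferInstance
  f := kernel.ι _
  g := Projective.π X
  w := kernel.condition _
  shortExact := { exact := ShortComplex.exact_of_f_is_kernel _ (kernelIsKernel _) }

/-- The resolution `0 ⟶ P ⟶ P ⟶ 0` of the zero object. -/
def ProjRes.zero {P : A} (hP : Projective P) : ProjRes (0 : A) where
  P := P
  Q := P
  projP := hP
  projQ := hP
  f := 𝟙 P
  g := 0
  w := comp_zero
  shortExact :=
    { exact := (ShortComplex.exact_iff_epi _ rfl).2 (inferInstanceAs (Epi (𝟙 P)))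
      mono_f := inferInstanceAs (Mono (𝟙 P))
      epi_g := ⟨fun _ _ _ => (isZero_zero A).eq_of_src _ _⟩ }

lemma ProjRes.cl_eq {X : A} (r : ProjRes X) : cl X = cl r.Q - cl r.P :=
  eq_sub_of_add_eq' (cl_shortExact r.shortExact).symm

variable {X Z : A} (r : ProjRes X)

/-- The middle term of the extension of `X` by `Z` with parameter `φ : P ⟶ Z`, where `P ⟶ Q ⟶ X`
is a resolution. -/
def pushMid (φ : r.P ⟶ Z) : A := cokernel (biprod.lift φ (-r.f))

/-- The projection of `Z ⊕ Q` to the middle term of an extension. -/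
def pushπ (φ : r.P ⟶ Z) : Z ⊞ r.Q ⟶ pushMid r φ := cokernel.π _

/-- The inclusion of `Z` in the middle term of an extension. -/
def pushInl (φ : r.P ⟶ Z) : Z ⟶ pushMid r φ := biprod.inl ≫ pushπ r φ

/-- The map from `Q` to the middle term of an extension. -/
def pushInr (φ : r.P ⟶ Z) : r.Q ⟶ pushMid r φ := biprod.inr ≫ pushπ r φ

lemma push_comm (φ : r.P ⟶ Z) : φ ≫ pushInl r φ = r.f ≫ pushInr r φ := by
  have h : biprod.lift φ (-r.f) ≫ pushπ r φ = 0 := cokernel.condition _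
  rw [biprod.lift_eq] at h
  simp only [Preadditive.add_comp, Category.assoc, Preadditive.neg_comp] at h
  exact eq_of_sub_eq_zero (by rw [sub_eq_add_neg]; exact h)

lemma push_hom_ext (φ : r.P ⟶ Z) {T : A} {a b : pushMid r φ ⟶ T}
    (h₁ : pushInl r φ ≫ a = pushInl r φ ≫ b) (h₂ : pushInr r φ ≫ a = pushInr r φ ≫ b) : a = b := by
  have : Epi (pushπ r φ) := inferInstanceAs (Epi (cokernel.π _))
  rw [← cancel_epi (pushπ r φ)]
  apply biprod.hom_ext'
  · simpa [pushInl] using h₁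
  · simpa [pushInr] using h₂

/-- The universal property of the middle term as a pushout. -/
def pushDesc (φ : r.P ⟶ Z) {T : A} (a : Z ⟶ T) (b : r.Q ⟶ T) (h : φ ≫ a = r.f ≫ b) :
    pushMid r φ ⟶ T :=
  cokernel.desc _ (biprod.desc a b) (by rw [biprod.lift_desc, h]; simp)

@[simp] lemma pushInl_desc (φ : r.P ⟶ Z) {T : A} (a : Z ⟶ T) (b : r.Q ⟶ T)
    (h : φ ≫ a = r.f ≫ b) : pushInl r φ ≫ pushDesc r φ a b h = a := by
  change (biprod.inl ≫ cokernel.π _) ≫ cokernel.desc _ _ _ = a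
  rw [Category.assoc, cokernel.π_desc, biprod.inl_desc]

@[simp] lemma pushInl_desc_assoc (φ : r.P ⟶ Z) {T T' : A} (a : Z ⟶ T) (b : r.Q ⟶ T)
    (h : φ ≫ a = r.f ≫ b) (t : T ⟶ T') : pushInl r φ ≫ pushDesc r φ a b h ≫ t = a ≫ t := by
  rw [← Category.assoc, pushInl_desc]

@[simp] lemma pushInr_desc (φ : r.P ⟶ Z) {T : A} (a : Z ⟶ T) (b : r.Q ⟶ T)
    (h : φ ≫ a = r.f ≫ b) : pushInr r φ ≫ pushDesc r φ a b h = b := by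
  change (biprod.inr ≫ cokernel.π _) ≫ cokernel.desc _ _ _ = b
  rw [Category.assoc, cokernel.π_desc, biprod.inr_desc]

@[simp] lemma pushInr_desc_assoc (φ : r.P ⟶ Z) {T T' : A} (a : Z ⟶ T) (b : r.Q ⟶ T)
    (h : φ ≫ a = r.f ≫ b) (t : T ⟶ T') : pushInr r φ ≫ pushDesc r φ a b h ≫ t = b ≫ t := by
  rw [← Category.assoc, pushInr_desc]

/-- Pairs of morphisms to `Z` and `Q` that cancel in the middle term come from `P`. -/
lemma push_exact (φ : r.P ⟶ Z) {T : A} (a : T ⟶ Z) (b : T ⟶ r.Q)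
    (h : a ≫ pushInl r φ = b ≫ pushInr r φ) : ∃ l : T ⟶ r.P, l ≫ φ = a ∧ l ≫ r.f = b := by
  have := r.mono_f
  have hm : Mono (biprod.lift φ (-r.f)) := by
    have : Mono (biprod.lift φ (-r.f) ≫ biprod.snd) := by
      rw [biprod.lift_snd]; infer_instance
    exact mono_of_mono _ biprod.snd
  have he : (ShortComplex.mk (biprod.lift φ (-r.f)) (pushπ r φ) (cokernel.condition _)).Exact :=
    ShortComplex.exact_of_g_is_cokernel _ (cokernelIsCokernel _)
  have hab : biprod.lift a (-b) ≫ pushπ r φ = 0 := by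
    rw [biprod.lift_eq]
    simp only [Preadditive.add_comp, Category.assoc, Preadditive.neg_comp]
    change a ≫ pushInl r φ + -(b ≫ pushInr r φ) = 0
    rw [h, add_neg_cancel]
  have hl := he.lift_f (biprod.lift a (-b)) hab
  refine ⟨he.lift (biprod.lift a (-b)) hab, ?_, ?_⟩
  · simpa using hl =≫ biprod.fst
  · simpa using hl =≫ biprod.snd

/-- The projection of the middle term of an extension to the quotient. -/
def pushP (φ : r.P ⟶ Z) : pushMid r φ ⟶ X := pushDesc r φ 0 r.g (by rw [comp_zero, r.w])

lemma pushInl_p (φ : r.P ⟶ Z) : pushInl r φ ≫ pushP r φ = 0 := pushInl_desc _ _ _ _ _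

lemma pushInr_p (φ : r.P ⟶ Z) : pushInr r φ ≫ pushP r φ = r.g := pushInr_desc _ _ _ _ _

/-- The extension with parameter `φ : P ⟶ Z`, that is the pushout of the resolution along `φ`. -/
def pushExt (φ : r.P ⟶ Z) : Extension X Z where
  mid := pushMid r φ
  i := pushInl r φ
  p := pushP r φ
  w := pushInl_p r φ
  shortExact := by
    have := r.mono_f
    have := r.epi_g
    have hp : Epi (pushP r φ) := epi_of_epi_fac (pushInr_p r φ)
    refine
      { exact := ShortComplex.exact_of_g_is_cokernel _
          (CokernelCofork.IsColimit.ofπ _ _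
            (fun t ht => r.shortExact.exact.desc (pushInr r φ ≫ t) ?_) (fun t ht => ?_)
            (fun t ht m hm => ?_))
        mono_f := Preadditive.mono_of_cancel_zero _ fun h hh => ?_
        epi_g := hp }
    · rw [← reassoc_of% (push_comm r φ), ht, comp_zero]
    · apply push_hom_ext
      · rw [← Category.assoc, pushInl_p, zero_comp]
        exact ht.symm
      · rw [← Category.assoc, pushInr_p]
        exact r.shortExact.exact.g_desc _ _
    · have h₁ : r.g ≫ m = pushInr r φ ≫ t := by
        rw [← pushInr_p r φ, Category.assoc]
        exact congrArg _ hm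
      rw [← cancel_epi r.g, h₁]
      exact (r.shortExact.exact.g_desc _ _).symm
    · obtain ⟨l, h₁, h₂⟩ := push_exact r φ h 0 (by rw [zero_comp]; exact hh)
      rw [← h₁, zero_of_comp_mono r.f h₂, zero_comp]

/-- Every extension is a pushout of the resolution, because `Q` is projective. -/
lemma pushExt_surjective (F : Extension X Z) :
    ∃ φ : r.P ⟶ Z, (extensionSetoid X Z).r (pushExt r φ) F := by
  have := r.projQ
  have := F.shortExact.mono_f
  have := F.shortExact.epi_g
  let l : r.Q ⟶ F.mid := Projective.factorThru r.g F.p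
  have hl : l ≫ F.p = r.g := Projective.factorThru_comp _ _
  have h0 : (r.f ≫ l) ≫ F.p = 0 := by rw [Category.assoc, hl, r.w]
  let φ := F.shortExact.exact.lift (r.f ≫ l) h0
  have hφ : φ ≫ F.i = r.f ≫ l := F.shortExact.exact.lift_f _ _
  refine ⟨φ, extension_equiv_of_hom _ _ (pushDesc r φ F.i l hφ) (pushInl_desc _ _ _ _ _) ?_⟩
  refine push_hom_ext r φ ?_ ?_
  · exact (pushInl_desc_assoc r φ F.i l hφ F.p).trans (F.w.trans (pushInl_p r φ).symm)
  · exact (pushInr_desc_assoc r φ F.i l hφ F.p).trans (hl.trans (pushInr_p r φ).symm)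

/-- Two parameters give equivalent extensions if and only if their difference extends to `Q`. -/
lemma pushExt_equiv_iff (φ ψ : r.P ⟶ Z) : (extensionSetoid X Z).r (pushExt r φ) (pushExt r ψ) ↔
    φ - ψ ∈ (Preadditive.leftComp Z r.f).range := by
  constructor
  · rintro ⟨(θ : pushMid r φ ≅ pushMid r ψ), h₁, h₂⟩
    change pushInl r φ ≫ θ.hom = pushInl r ψ at h₁
    change θ.hom ≫ pushP r ψ = pushP r φ at h₂
    have : Mono (pushInl r ψ) := (pushExt r ψ).shortExact.mono_f
    have h₅ : (pushInr r φ ≫ θ.hom - pushInr r ψ) ≫ pushP r ψ = 0 := by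
      rw [Preadditive.sub_comp, Category.assoc, h₂, pushInr_p, pushInr_p, sub_self]
    obtain ⟨h, hl⟩ : ∃ h : r.Q ⟶ Z, h ≫ pushInl r ψ = pushInr r φ ≫ θ.hom - pushInr r ψ :=
      have := (pushExt r ψ).shortExact.mono_f
      ⟨_, (pushExt r ψ).shortExact.exact.lift_f _ h₅⟩
    refine ⟨h, ?_⟩
    change r.f ≫ h = φ - ψ
    rw [← cancel_mono (pushInl r ψ), Category.assoc, hl, Preadditive.comp_sub,
      ← reassoc_of% (push_comm r φ), h₁, Preadditive.sub_comp, push_comm r ψ]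
  · rintro ⟨h, hh⟩
    change r.f ≫ h = φ - ψ at hh
    have hφ : φ ≫ pushInl r ψ = r.f ≫ (pushInr r ψ + h ≫ pushInl r ψ) := by
      rw [Preadditive.comp_add, ← push_comm, ← Category.assoc, hh, Preadditive.sub_comp]
      abel
    have h₃ : pushDesc r φ _ _ hφ ≫ pushP r ψ = pushP r φ := by
      apply push_hom_ext
      · rw [pushInl_desc_assoc, pushInl_p, pushInl_p]
      · rw [pushInr_desc_assoc, Preadditive.add_comp, Category.assoc, pushInl_p, pushInr_p,
          pushInr_p, comp_zero, add_zero]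
    exact extension_equiv_of_hom _ _ (pushDesc r φ (pushInl r ψ) _ hφ) (pushInl_desc _ _ _ _ _) h₃

/-- Hall numbers of `A` count morphisms out of the first syzygy. -/
lemma hallNumber_eq_card [∀ X Y : A, Finite (X ⟶ Y)] (Y : A) :
    hallNumber X Z Y = (Nat.card {φ : r.P ⟶ Z // Nonempty (pushMid r φ ≅ Y)} : ℂ) /
      Nat.card (r.Q ⟶ Z) := by
  refine hallNumber_eq_of_param Y (Preadditive.leftComp Z r.f) (pushExt r) (pushExt_surjective r)
    (pushExt_equiv_iff r) ?_
  have := r.epi_g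
  refine Nat.card_congr
    { toFun := fun h => r.shortExact.exact.desc h.1 h.2
      invFun := fun h => ⟨r.g ≫ h, by
        change r.f ≫ r.g ≫ h = 0
        rw [← Category.assoc, r.w, zero_comp]⟩
      left_inv := fun h => Subtype.ext (r.shortExact.exact.g_desc _ _)
      right_inv := fun h => ?_ }
  rw [← cancel_epi r.g]
  exact r.shortExact.exact.g_desc _ _

variable (r' : ProjRes Z) (s : r.P ⟶ r'.Q)

/-- The differential of the resolution of an extension. -/
def extendF : r'.P ⊞ r.P ⟶ r'.Q ⊞ r.Q :=
  biprod.desc (r'.f ≫ biprod.inl) (s ≫ biprod.inl + r.f ≫ biprod.inr)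

/-- The augmentation of the resolution of an extension. -/
def extendG : r'.Q ⊞ r.Q ⟶ pushMid r (s ≫ r'.g) :=
  biprod.desc (r'.g ≫ pushInl r _) (-pushInr r _)

lemma comp_extendF {T : A} (t : T ⟶ r'.P ⊞ r.P) : t ≫ extendF r r' s =
    ((t ≫ biprod.fst) ≫ r'.f + (t ≫ biprod.snd) ≫ s) ≫ biprod.inl +
      ((t ≫ biprod.snd) ≫ r.f) ≫ biprod.inr := by
  rw [extendF, biprod.desc_eq]
  simp only [Preadditive.comp_add, Preadditive.add_comp, Category.assoc]
  abel

lemma comp_extendG {T : A} (t : T ⟶ r'.Q ⊞ r.Q) : t ≫ extendG r r' s =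
    ((t ≫ biprod.fst) ≫ r'.g) ≫ pushInl r _ - (t ≫ biprod.snd) ≫ pushInr r _ := by
  rw [extendG, biprod.desc_eq]
  simp only [Preadditive.comp_add, Preadditive.comp_neg, Category.assoc, sub_eq_add_neg]

lemma extendF_extendG : extendF r r' s ≫ extendG r r' s = 0 := by
  have h := push_comm r (s ≫ r'.g)
  have h₁ : extendF r r' s ≫ biprod.fst = biprod.fst ≫ r'.f + biprod.snd ≫ s := by
    simpa using (comp_extendF r r' s (𝟙 _)) =≫ biprod.fst
  have h₂ : extendF r r' s ≫ biprod.snd = biprod.snd ≫ r.f := by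
    simpa using (comp_extendF r r' s (𝟙 _)) =≫ biprod.snd
  rw [comp_extendG, h₁, h₂, Category.assoc biprod.snd, ← h, Preadditive.add_comp,
    Category.assoc biprod.fst, r'.w, comp_zero, zero_add]
  simp only [Category.assoc, sub_self]

lemma extendF_mono : Mono (extendF r r' s) := by
  have := r.mono_f
  have := r'.mono_f
  refine Preadditive.mono_of_cancel_zero _ fun h hh => ?_
  rw [comp_extendF] at hh
  have h₁ : (h ≫ biprod.snd) ≫ r.f = 0 := by simpa using hh =≫ biprod.snd
  have h₂ := zero_of_comp_mono r.f h₁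
  rw [h₂, zero_comp, add_zero, zero_comp, zero_comp, add_zero] at hh
  have h₃ : (h ≫ biprod.fst) ≫ r'.f = 0 := by simpa using hh =≫ biprod.fst
  apply biprod.hom_ext
  · rw [zero_of_comp_mono r'.f h₃, zero_comp]
  · rw [h₂, zero_comp]

lemma extendG_epi : Epi (extendG r r' s) := by
  have := r'.epi_g
  refine Preadditive.epi_of_cancel_zero _ fun t ht => push_hom_ext r _ ?_ ?_
  · have := biprod.inl ≫= ht
    rw [extendG, biprod.inl_desc_assoc, comp_zero, Category.assoc] at this
    rw [comp_zero]
    exact zero_of_epi_comp r'.g this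
  · have := biprod.inr ≫= ht
    rw [extendG, biprod.inr_desc_assoc, comp_zero, Preadditive.neg_comp, neg_eq_zero] at this
    rw [this, comp_zero]

lemma exists_lift_extendF {T : A} (t : T ⟶ r'.Q ⊞ r.Q) (ht : t ≫ extendG r r' s = 0) :
    ∃ l, l ≫ extendF r r' s = t := by
  rw [comp_extendG, sub_eq_zero] at ht
  obtain ⟨l, h₁, h₂⟩ := push_exact r _ _ _ ht
  obtain ⟨u, hu⟩ := r'.exists_lift (t ≫ biprod.fst - l ≫ s) (by
    rw [Preadditive.sub_comp, Category.assoc l, h₁, sub_self])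
  refine ⟨biprod.lift u l, ?_⟩
  rw [comp_extendF, biprod.lift_fst, biprod.lift_snd, hu, sub_add_cancel, h₂]
  apply biprod.hom_ext <;> simp

/-- The resolution of the middle term of an extension assembled from resolutions of the outer
terms and a lift `s` of the parameter of the extension. -/
def ProjRes.extend : ProjRes (pushMid r (s ≫ r'.g)) where
  P := r'.P ⊞ r.P
  Q := r'.Q ⊞ r.Q
  projP := have := r.projP; have := r'.projP; inferInstance
  projQ := have := r.projQ; have := r'.projQ; inferInstance
  f := extendF r r' s
  g := extendG r r' s
  w := extendF_extendG r r' s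
  shortExact :=
    have := extendF_mono r r' s
    { exact := ShortComplex.exact_of_f_is_kernel _ (KernelFork.IsLimit.ofι' _ _ fun t ht =>
        ⟨(exists_lift_extendF r r' s t ht).choose, (exists_lift_extendF r r' s t ht).choose_spec⟩)
      mono_f := extendF_mono r r' s
      epi_g := extendG_epi r r' s }

end Resolutions

/-! ### Comparison of projective resolutions -/

section Comparison

variable {A : Type u} [Category.{v} A] [Abelian A]

/-- A resolution of an object, seen as a resolution of an isomorphic object. -/
def ProjRes.ofIso {X Y : A} (r : ProjRes X) (e : X ≅ Y) : ProjRes Y where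
  P := r.P
  Q := r.Q
  projP := r.projP
  projQ := r.projQ
  f := r.f
  g := r.g ≫ e.hom
  w := by rw [← Category.assoc, r.w, zero_comp]
  shortExact := ShortComplex.shortExact_of_iso
    (ShortComplex.isoMk (S₁ := ShortComplex.mk r.f r.g r.w)
      (S₂ := ShortComplex.mk r.f (r.g ≫ e.hom) _) (Iso.refl _) (Iso.refl _) e
      ((Category.id_comp _).trans (Category.comp_id _).symm) (Category.id_comp _)) r.shortExact

/-- The cocycle of the complexes of two resolutions with component `s`. -/
def extCocycle {X Z : A} (r : ProjRes X) (r' : ProjRes Z) (s : r.P ⟶ r'.Q) :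
    Cocycle r.cplx.obj r'.cplx.obj :=
  z2Cocycle (M := r.cplx.obj) (N := r'.cplx.obj) s 0
    ((congrArg₂ (· + ·) (comp_zero : r.f ≫ (0 : r.Q ⟶ r'.P) = 0)
      (comp_zero : s ≫ (0 : r'.Q ⟶ r'.P) = 0)).trans (add_zero _))
    ((congrArg₂ (· + ·) (zero_comp : (0 : r.Q ⟶ r.P) ≫ s = 0)
      (zero_comp : (0 : r.Q ⟶ r'.P) ≫ r'.f = 0)).trans (add_zero _))

/-- All cocycles between the complexes of two resolutions have a single component. -/
lemma extCocycle_bijective {X Z : A} (r : ProjRes X) (r' : ProjRes Z) :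
    Function.Bijective (extCocycle r r') := by
  constructor
  · intro s s' h
    exact congrFun (congrFun (congrArg Subtype.val h) 1) 0
  · intro s
    refine ⟨s.1 1 0, z2_cocycle_ext rfl ?_⟩
    let t : r.Q ⟶ r'.P := s.1 0 1
    let u : r.P ⟶ r'.Q := s.1 1 0
    have h : (0 : r.Q ⟶ r.P) ≫ u + t ≫ r'.f = 0 := cocycle_comm s 0 1 0
    have := r'.mono_f
    rw [zero_comp, zero_add] at h
    exact (zero_of_comp_mono r'.f h).symm

/-- The twisted direct sum of the complexes of two resolutions is the complex of a resolution of
an extension. -/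
def twistExtend {X Z : A} (r : ProjRes X) (r' : ProjRes Z) (s : r.P ⟶ r'.Q) :
    twist (extCocycle r r' s) ≅ (r.extend r' s).cplx.obj :=
  z2Iso (M := twist (extCocycle r r' s)) (N := (r.extend r' s).cplx.obj)
    (Iso.refl (r'.P ⊞ r.P)) (Iso.refl (r'.Q ⊞ r.Q))
    ((Category.id_comp _).trans (Category.comp_id (extendF r r' s)).symm) (by
      have h : biprod.desc ((0 : r'.Q ⟶ r'.P) ≫ biprod.inl)
          ((0 : r.Q ⟶ r'.P) ≫ biprod.inl + (0 : r.Q ⟶ r.P) ≫ biprod.inr) =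
          (0 : r'.Q ⊞ r.Q ⟶ r'.P ⊞ r.P) := by
        apply biprod.hom_ext' <;> simp
      exact (Category.id_comp _).trans (h.symm.trans (Category.comp_id _).symm))

lemma twistExtend_zero {X Z : A} (r : ProjRes X) (r' : ProjRes Z) :
    Nonempty ((r.cplx.sum r'.cplx).obj ≅ (r.extend r' 0).cplx.obj) := by
  have : extCocycle r r' 0 = 0 := z2_cocycle_ext rfl rfl
  exact ⟨(eqToIso (by rw [this]; rfl) : (r.cplx.sum r'.cplx).obj ≅ _) ≪≫ twistExtend r r' 0⟩

/-- The complex of a resolution is determined by its augmentation. -/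
lemma ProjRes.cplx_iso_of_comp {X X' : A} (r : ProjRes X) (r' : ProjRes X') (e : r.Q ≅ r'.Q)
    (i : X ≅ X') (h : e.hom ≫ r'.g = r.g ≫ i.hom) : Nonempty (r.cplx.obj ≅ r'.cplx.obj) := by
  have := r.mono_f
  have := r'.mono_f
  have h' : e.inv ≫ r.g = r'.g ≫ i.inv := by
    rw [Iso.inv_comp_eq, ← Category.assoc, h, Category.assoc, i.hom_inv_id, Category.comp_id]
  obtain ⟨a, ha⟩ := r'.exists_lift (r.f ≫ e.hom) (by
    rw [Category.assoc, h, ← Category.assoc, r.w, zero_comp])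
  obtain ⟨b, hb⟩ := r.exists_lift (r'.f ≫ e.inv) (by
    rw [Category.assoc, h', ← Category.assoc, r'.w, zero_comp])
  let e₁ : r.P ≅ r'.P :=
    { hom := a
      inv := b
      hom_inv_id := by
        rw [← cancel_mono r.f, Category.assoc, hb, ← Category.assoc, ha]; simp
      inv_hom_id := by
        rw [← cancel_mono r'.f, Category.assoc, ha, ← Category.assoc, hb]; simp }
  exact ⟨z2Iso (M := r.cplx.obj) (N := r'.cplx.obj) e₁ e ha
    ((comp_zero : e.hom ≫ (0 : r'.Q ⟶ r'.P) = 0).trans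
      (zero_comp : (0 : r.Q ⟶ r.P) ≫ a = 0).symm)⟩

instance isIso_pushInl {X : A} (r : ProjRes (0 : A)) (φ : r.P ⟶ X) : IsIso (pushInl r φ) := by
  have : Mono (pushInl r φ) := (pushExt r φ).shortExact.mono_f
  have : Epi (pushInl r φ) := ((ShortComplex.exact_iff_epi _
    ((isZero_zero A).eq_of_tgt _ _)).1 (pushExt r φ).shortExact.exact)
  exact isIso_of_mono_of_epi _

lemma extendG_zero {X : A} (z : ProjRes (0 : A)) [Epi z.f] (r : ProjRes X) :
    extendG z r 0 = biprod.fst ≫ r.g ≫ pushInl z _ := by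
  have h (φ : z.P ⟶ X) (hφ : φ = 0) : pushInr z φ = 0 := by
    have := push_comm z φ
    rw [hφ, zero_comp] at this
    rw [hφ]
    exact zero_of_epi_comp z.f this.symm
  rw [extendG, h _ zero_comp, neg_zero]
  apply biprod.hom_ext' <;> simp

/-- Schanuel's lemma: two resolutions agree after adding contractible complexes. -/
lemma ProjRes.schanuel {X : A} (r r' : ProjRes X) :
    Nonempty (((ProjCplx.K r'.projQ).sum r.cplx).obj ≅
      ((ProjCplx.K r.projQ).sum r'.cplx).obj) := by
  have := r.projQ
  have := r'.projQ
  have := r.epi_g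
  have := r'.epi_g
  let a : r.Q ⟶ r'.Q := Projective.factorThru r.g r'.g
  let b : r'.Q ⟶ r.Q := Projective.factorThru r'.g r.g
  have ha : a ≫ r'.g = r.g := Projective.factorThru_comp _ _
  have hb : b ≫ r.g = r'.g := Projective.factorThru_comp _ _
  let e : r.Q ⊞ r'.Q ≅ r'.Q ⊞ r.Q :=
    { hom := biprod.desc (biprod.lift a (𝟙 _)) (biprod.lift (𝟙 _ - b ≫ a) (-b))
      inv := biprod.desc (biprod.lift b (𝟙 _)) (biprod.lift (𝟙 _ - a ≫ b) (-a))
      hom_inv_id := by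
        apply biprod.hom_ext' <;> apply biprod.hom_ext <;>
          simp [biprod.lift_desc]
      inv_hom_id := by
        apply biprod.hom_ext' <;> apply biprod.hom_ext <;>
          simp [biprod.lift_desc] }
  let z := ProjRes.zero r.projQ
  let z' := ProjRes.zero r'.projQ
  have : Epi z.f := inferInstanceAs (Epi (𝟙 r.Q))
  have : Epi z'.f := inferInstanceAs (Epi (𝟙 r'.Q))
  obtain ⟨i₁⟩ := twistExtend_zero z' r
  obtain ⟨i₂⟩ := twistExtend_zero z r'
  have he : e.hom ≫ biprod.fst ≫ r'.g = biprod.fst ≫ r.g := by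
    apply biprod.hom_ext'
    · rw [biprod.inl_desc_assoc, biprod.lift_fst_assoc, ha, biprod.inl_fst_assoc]
    · rw [biprod.inr_desc_assoc, biprod.lift_fst_assoc, Preadditive.sub_comp, Category.assoc, ha,
        hb, Category.id_comp, sub_self, biprod.inr_fst_assoc, zero_comp]
  obtain ⟨i⟩ := (z'.extend r 0).cplx_iso_of_comp (z.extend r' 0) e
    ((asIso (pushInl z' ((0 : z'.P ⟶ r.Q) ≫ r.g))).symm ≪≫
      asIso (pushInl z ((0 : z.P ⟶ r'.Q) ≫ r'.g))) (by
      change e.hom ≫ extendG z r' 0 = extendG z' r 0 ≫ inv (pushInl z' _) ≫ pushInl z _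
      rw [extendG_zero z r', extendG_zero z' r, Category.assoc, Category.assoc,
        IsIso.hom_inv_id_assoc]
      have := he =≫ pushInl z ((0 : z.P ⟶ r'.Q) ≫ r'.g)
      simp only [Category.assoc] at this
      exact this)
  exact ⟨i₁ ≪≫ i ≪≫ i₂.symm⟩

end Comparison

/-! ### The invertible elements attached to the Grothendieck group -/

section Units

variable {A : Type u} [Category.{v} A] [Abelian A]

lemma IsDisk.nonempty_iso {K L : Z2Cplx A} (hK : IsDisk K) (hL : IsDisk L) (e : K.X 1 ≅ L.X 1) :
    Nonempty (K ≅ L) := by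
  have := hK.iso
  have := hL.iso
  exact ⟨z2Iso e ((asIso (K.d 1 0)).symm ≪≫ e ≪≫ asIso (L.d 1 0)) (by simp)
    (by rw [hK.zero, hL.zero, comp_zero, zero_comp])⟩

lemma ProjCplx.isDisk_sum_K {P Q : A} (hP : Projective P) (hQ : Projective Q) :
    IsDisk ((ProjCplx.K hP).sum (ProjCplx.K hQ)).obj := by
  have h₁ : biprod.desc (𝟙 Q ≫ biprod.inl) ((0 : P ⟶ Q) ≫ biprod.inl + 𝟙 P ≫ biprod.inr) =
      𝟙 (Q ⊞ P) := by
    apply biprod.hom_ext' <;> simp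
  have h₂ : biprod.desc ((0 : Q ⟶ Q) ≫ biprod.inl)
      ((0 : P ⟶ Q) ≫ biprod.inl + (0 : P ⟶ P) ≫ biprod.inr) = (0 : Q ⊞ P ⟶ Q ⊞ P) := by
    apply biprod.hom_ext' <;> simp
  refine ⟨?_, h₂⟩
  have : IsIso (𝟙 (Q ⊞ P)) := inferInstance
  rw [← h₁] at this
  exact this

lemma projective_biprod {P Q : A} (hP : Projective P) (hQ : Projective Q) : Projective (P ⊞ Q) :=
  inferInstance

lemma ProjCplx.hat_K {P : A} (hP : Projective P) : (ProjCplx.K hP).hat = 0 := sub_self _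

end Units

section KHom

variable (k : Type w) [Field k] [Finite k] {A : Type u} [Category.{v} A] [Abelian A] [Linear k A]
  [EnoughProjectives A] [∀ X Y : A, Finite (X ⟶ Y)] [∀ X : A, HasProjectiveDimensionLE X 1]

/-- The class of `K_P` as a unit. -/
def DH.kUnit {P : A} (hP : Projective P) : (DH k A)ˣ where
  val := DH.of k (ProjCplx.K hP)
  inv := DH.inv k (ProjCplx.K hP) (ProjCplx.acyclic_K hP)
  val_inv := DH.of_mul_inv _ _
  inv_val := DH.inv_mul_of _ _

lemma DH.of_congr {M N : ProjCplx A} (e : M.obj ≅ N.obj) : DH.of k M = DH.of k N := by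
  rw [← DH.fromH_of, ← DH.fromH_of, HTwC.of_congr k e]

lemma DH.disk_mul {K : ProjCplx A} (hK : IsDisk K.obj) (M : ProjCplx A) :
    DH.of k K * DH.of k M = tPar k ^ eulerK k A (cl (K.obj.X 1)) M.hat • DH.of k (K.sum M) := by
  have := congrArg (DH.fromH k) (HTwC.disk_mul k hK M)
  rwa [map_mul, map_smul] at this

lemma DH.disk_comm {K : ProjCplx A} (hK : IsDisk K.obj) (M : ProjCplx A) :
    DH.of k K * DH.of k M =
      tPar k ^ symEuler k A (cl (K.obj.X 1)) M.hat • (DH.of k M * DH.of k K) := by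
  have := congrArg (DH.fromH k) (HTwC.disk_comm k hK M)
  rwa [map_mul, map_smul, map_mul] at this

lemma DH.kUnit_mul {P Q : A} (hP : Projective P) (hQ : Projective Q) :
    DH.kUnit k hP * DH.kUnit k hQ = DH.kUnit k (projective_biprod hQ hP) := by
  refine Units.ext ((DH.disk_mul k (ProjCplx.isDisk_K hP) _).trans ?_)
  rw [ProjCplx.hat_K, map_zero, zpow_zero, one_smul]
  obtain ⟨e⟩ := (ProjCplx.isDisk_sum_K hP hQ).nonempty_iso
    (ProjCplx.isDisk_K (projective_biprod hQ hP)) (Iso.refl (Q ⊞ P))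
  exact DH.of_congr k e

lemma DH.kUnit_comm {P Q : A} (hP : Projective P) (hQ : Projective Q) :
    DH.kUnit k hP * DH.kUnit k hQ = DH.kUnit k hQ * DH.kUnit k hP := by
  refine Units.ext ((DH.disk_comm k (ProjCplx.isDisk_K hP) _).trans ?_)
  rw [ProjCplx.hat_K, symEuler, map_zero, map_zero, AddMonoidHom.zero_apply, add_zero, zpow_zero,
    one_smul]
  rfl

lemma DH.kUnit_congr {P Q : A} (hP : Projective P) (hQ : Projective Q) (e : P ≅ Q) :
    DH.kUnit k hP = DH.kUnit k hQ := by
  obtain ⟨i⟩ := (ProjCplx.isDisk_K hP).nonempty_iso (ProjCplx.isDisk_K hQ) e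
  exact Units.ext (DH.of_congr k i)

variable (A) in
/-- The units `[K_P]`. -/
def DH.kSet : Set (DH k A)ˣ := {x | ∃ (P : A) (hP : Projective P), x = DH.kUnit k hP}

variable (A) in
/-- The commutative group generated by the units `[K_P]`. -/
def DH.KGroup : Type (max u v) := Subgroup.closure (DH.kSet k A)

instance : CommGroup (DH.KGroup k A) :=
  { (inferInstance : Group (Subgroup.closure (DH.kSet k A))) with
    mul_comm := (Subgroup.isMulCommutative_closure (k := DH.kSet k A) (by
      rintro _ ⟨P, hP, rfl⟩ _ ⟨Q, hQ, rfl⟩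
      exact DH.kUnit_comm k hP hQ)).is_comm.comm }

variable (A) in
/-- The inclusion of the group generated by the `[K_P]` in the group of units. -/
def DH.kVal : DH.KGroup k A →* (DH k A)ˣ := Subgroup.subtype (Subgroup.closure (DH.kSet k A))

/-- The class of `K_P` in the commutative group generated by all of them. -/
def DH.kElt {P : A} (hP : Projective P) : DH.KGroup k A :=
  ⟨DH.kUnit k hP, Subgroup.subset_closure ⟨P, hP, rfl⟩⟩

lemma DH.kElt_mul {P Q : A} (hP : Projective P) (hQ : Projective Q) :
    DH.kElt k hP * DH.kElt k hQ = DH.kElt k (projective_biprod hQ hP) :=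
  Subtype.ext (DH.kUnit_mul k hP hQ)

lemma DH.kElt_congr {P Q : A} (hP : Projective P) (hQ : Projective Q) (e : P ≅ Q) :
    DH.kElt k hP = DH.kElt k hQ :=
  Subtype.ext (DH.kUnit_congr k hP hQ e)

/-- The class of a resolution in the commutative group generated by the `[K_P]`. -/
def ProjRes.kElt {X : A} (r : ProjRes X) : DH.KGroup k A :=
  DH.kElt k r.projQ / DH.kElt k r.projP

/-- By Schanuel's lemma, `[K_Q] / [K_P]` depends on the resolved object only. -/
lemma ProjRes.kElt_eq {X : A} (r r' : ProjRes X) : r.kElt k = r'.kElt k := by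
  obtain ⟨e⟩ := r.schanuel r'
  let e₁ : r.P ⊞ r'.Q ≅ r'.P ⊞ r.Q :=
    { hom := e.hom.f 1
      inv := e.inv.f 1
      hom_inv_id := HomologicalComplex.congr_hom e.hom_inv_id 1
      inv_hom_id := HomologicalComplex.congr_hom e.inv_hom_id 1 }
  have := DH.kElt_congr k (projective_biprod r.projP r'.projQ)
    (projective_biprod r'.projP r.projQ) e₁
  rw [← DH.kElt_mul k r'.projQ r.projP, ← DH.kElt_mul k r.projQ r'.projP] at this
  rw [kElt, kElt, div_eq_div_iff_mul_eq_mul, this]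

lemma ProjRes.kElt_extend {X Z : A} (r : ProjRes X) (r' : ProjRes Z) (s : r.P ⟶ r'.Q) :
    (r.extend r' s).kElt k = r'.kElt k * r.kElt k := by
  change DH.kElt k (projective_biprod r'.projQ r.projQ) /
    DH.kElt k (projective_biprod r'.projP r.projP) = _
  rw [← DH.kElt_mul k r.projQ r'.projQ, ← DH.kElt_mul k r.projP r'.projP, kElt, kElt,
    div_mul_div_comm, mul_comm (DH.kElt k r.projQ), mul_comm (DH.kElt k r.projP)]

/-- The horseshoe lemma gives additivity on short exact sequences. -/
lemma ProjRes.kElt_shortExact {S : ShortComplex A} (hS : S.ShortExact) :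
    (ProjRes.default S.X₂).kElt k =
      (ProjRes.default S.X₁).kElt k * (ProjRes.default S.X₃).kElt k := by
  let r := ProjRes.default S.X₃
  let r' := ProjRes.default S.X₁
  obtain ⟨φ, ⟨(e : pushMid r φ ≅ S.X₂), -⟩⟩ := pushExt_surjective r ⟨S.X₂, S.f, S.g, S.zero, hS⟩
  have := r.projP
  have := r'.epi_g
  obtain ⟨s, rfl⟩ : ∃ s : r.P ⟶ r'.Q, s ≫ r'.g = φ := ⟨_, Projective.factorThru_comp φ r'.g⟩
  rw [← ProjRes.kElt_extend k r r' s, ProjRes.kElt_eq k _ ((r.extend r' s).ofIso e)]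
  rfl

variable (A) in
/-- The homomorphism from the Grothendieck group with values `[P] ↦ [K_P]` on projectives. -/
def DH.kHom : K₀ A →+ Additive (DH.KGroup k A) :=
  QuotientAddGroup.lift (exactRelations A)
    (FreeAbelianGroup.lift fun X : A => Additive.ofMul ((ProjRes.default X).kElt k))
    ((AddSubgroup.closure_le _).2 (by
      rintro _ ⟨S, hS, rfl⟩
      rw [SetLike.mem_coe, AddMonoidHom.mem_ker, map_sub, map_sub, FreeAbelianGroup.lift_apply_of,
        FreeAbelianGroup.lift_apply_of, FreeAbelianGroup.lift_apply_of,
        ProjRes.kElt_shortExact k hS, ofMul_mul]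
      abel))

lemma DH.kHom_cl (X : A) (r : ProjRes X) :
    DH.kHom k A (cl X) = Additive.ofMul (r.kElt k) := by
  rw [r.kElt_eq k (ProjRes.default X)]
  exact FreeAbelianGroup.lift_apply_of _ _

/-- The resolution `0 ⟶ 0 ⟶ P ⟶ P ⟶ 0` of a projective object. -/
def ProjRes.ofProjective {P : A} (hP : Projective P) : ProjRes P where
  P := 0
  Q := P
  projP := inferInstance
  projQ := hP
  f := 0
  g := 𝟙 P
  w := zero_comp
  shortExact :=
    { exact := (ShortComplex.exact_iff_mono _ rfl).2 (inferInstanceAs (Mono (𝟙 P)))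
      mono_f := ⟨fun _ _ _ => (isZero_zero A).eq_of_tgt _ _⟩
      epi_g := inferInstanceAs (Epi (𝟙 P)) }

lemma DH.kElt_isZero {P : A} (hP : Projective P) (h : IsZero P) : DH.kElt k hP = 1 := by
  have := DH.kElt_mul k hP hP
  rw [DH.kElt_congr k (projective_biprod hP hP) hP (((biprod_isZero_iff _ _).2 ⟨h, h⟩).iso h)]
    at this
  exact mul_eq_left.1 this

lemma DH.kHom_cl_projective {P : A} (hP : Projective P) :
    DH.kHom k A (cl P) = Additive.ofMul (DH.kElt k hP) := by
  rw [DH.kHom_cl k P (ProjRes.ofProjective hP), ProjRes.kElt,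
    DH.kElt_isZero k (ProjRes.ofProjective hP).projP (isZero_zero A), div_one]
  rfl

/-- The element `K_α` of the localized Hall algebra. -/
def DH.K (α : K₀ A) : DH k A := (DH.kVal k A (DH.kHom k A α).toMul : (DH k A)ˣ)

lemma DH.K_zero : DH.K k (0 : K₀ A) = 1 := by
  rw [DH.K, map_zero]
  rfl

lemma DH.K_add (α β : K₀ A) : DH.K k (α + β) = DH.K k α * DH.K k β := by
  rw [DH.K, map_add]
  rfl

lemma DH.K_cl {P : A} (hP : Projective P) : DH.K k (cl P) = DH.of k (ProjCplx.K hP) := by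
  rw [DH.K, DH.kHom_cl_projective k hP]
  rfl

lemma DH.K_mul_neg (α : K₀ A) : DH.K k α * DH.K k (-α) = 1 := by
  rw [← DH.K_add, add_neg_cancel, DH.K_zero]

lemma DH.K_neg_mul (α : K₀ A) : DH.K k (-α) * DH.K k α = 1 := by
  rw [← DH.K_add, neg_add_cancel, DH.K_zero]

lemma DH.K_neg_cl {P : A} (hP : Projective P) :
    DH.K k (-cl P) = DH.inv k (ProjCplx.K hP) (ProjCplx.acyclic_K hP) := by
  refine left_inv_eq_right_inv (DH.K_neg_mul k (cl P)) ?_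
  rw [DH.K_cl k hP, DH.of_mul_inv]

lemma DH.K_sub {P Q : A} (hP : Projective P) (hQ : Projective Q) :
    DH.K k (cl P - cl Q) = DH.KDiff k hP hQ := by
  rw [sub_eq_add_neg, DH.K_add, DH.K_cl k hP, DH.K_neg_cl k hQ]
  rfl

/-- Resolutions show that the Grothendieck group is generated by the classes of projectives. -/
lemma K₀.induction_sub (α : K₀ A) :
    ∃ (P Q : A), Projective P ∧ Projective Q ∧ α = cl P - cl Q := by
  obtain ⟨x, rfl⟩ := QuotientAddGroup.mk_surjective α
  induction x using FreeAbelianGroup.induction_on with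
  | zero => exact ⟨0, 0, inferInstance, inferInstance, (sub_self _).symm⟩
  | of X =>
    let r := ProjRes.default X
    exact ⟨r.Q, r.P, r.projQ, r.projP, r.cl_eq⟩
  | neg X h =>
    obtain ⟨P, Q, hP, hQ, h⟩ := h
    exact ⟨Q, P, hQ, hP, by
      rw [QuotientAddGroup.mk_neg, h, neg_sub]⟩
  | add x y hx hy =>
    obtain ⟨P, Q, hP, hQ, h⟩ := hx
    obtain ⟨P', Q', hP', hQ', h'⟩ := hy
    exact ⟨P ⊞ P', Q ⊞ Q', inferInstance, inferInstance, by
      rw [QuotientAddGroup.mk_add, h, h', cl_biprod, cl_biprod]; abel⟩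

end KHom

/-! ### The shift on the localization and commutation relations -/

section Commutation

variable (k : Type w) [Field k] [Finite k] {A : Type u} [Category.{v} A] [Abelian A] [Linear k A]
  [EnoughProjectives A] [∀ X Y : A, Finite (X ⟶ Y)] [∀ X : A, HasProjectiveDimensionLE X 1]

lemma ProjCplx.dag_acyclic {M : ProjCplx A} (hM : M.obj.Acyclic) : M.dag.obj.Acyclic :=
  HallComplexes.dag_acyclic hM

/-- The shift as an algebra endomorphism of the localized Hall algebra. -/
def DH.dagHom : DH k A →ₐ[ℂ] DH k A :=
  DH.lift ((DH.fromH k).comp (HTwC.dagHom k)) (fun M => DH.inv k M.1.dag (ProjCplx.dag_acyclic M.2))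
    (fun M => by
      rw [AlgHom.comp_apply, HTwC.dagHom_of, DH.fromH_of, DH.of_mul_inv])
    (fun M => by
      rw [AlgHom.comp_apply, HTwC.dagHom_of, DH.fromH_of, DH.inv_mul_of])

lemma DH.dagHom_of (M : ProjCplx A) : DH.dagHom k (DH.of k M) = DH.of k M.dag := by
  rw [DH.dagHom, DH.lift_of, AlgHom.comp_apply, HTwC.dagHom_of, DH.fromH_of]

lemma DH.dagHom_inv (M : ProjCplx A) (hM : M.obj.Acyclic) :
    DH.dagHom k (DH.inv k M hM) = DH.inv k M.dag (ProjCplx.dag_acyclic hM) := by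
  rw [DH.dagHom, DH.lift_inv]

/-- The element `K_α†` of the localized Hall algebra. -/
def DH.KDag (α : K₀ A) : DH k A := DH.dagHom k (DH.K k α)

lemma DH.KDag_zero : DH.KDag k (0 : K₀ A) = 1 := by
  rw [DH.KDag, DH.K_zero, map_one]

lemma DH.KDag_add (α β : K₀ A) : DH.KDag k (α + β) = DH.KDag k α * DH.KDag k β := by
  rw [DH.KDag, DH.K_add, map_mul]
  rfl

lemma DH.KDag_cl {P : A} (hP : Projective P) :
    DH.KDag k (cl P) = DH.of k (ProjCplx.K hP).dag := by
  rw [DH.KDag, DH.K_cl k hP, DH.dagHom_of]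

lemma DH.KDag_mul_neg (α : K₀ A) : DH.KDag k α * DH.KDag k (-α) = 1 := by
  rw [← DH.KDag_add, add_neg_cancel, DH.KDag_zero]

lemma DH.KDag_neg_mul (α : K₀ A) : DH.KDag k (-α) * DH.KDag k α = 1 := by
  rw [← DH.KDag_add, neg_add_cancel, DH.KDag_zero]

variable (A) in
lemma symEuler_add_left (α β γ : K₀ A) :
    symEuler k A (α + β) γ = symEuler k A α γ + symEuler k A β γ := by
  simp only [symEuler, map_add, AddMonoidHom.add_apply]
  ring

variable (A) in
lemma symEuler_neg_left (α γ : K₀ A) : symEuler k A (-α) γ = - symEuler k A α γ := by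
  simp only [symEuler, map_neg, AddMonoidHom.neg_apply]
  ring

variable (A) in
lemma symEuler_neg_right (α γ : K₀ A) : symEuler k A α (-γ) = - symEuler k A α γ := by
  simp only [symEuler, map_neg, AddMonoidHom.neg_apply]
  ring

variable (A) in
lemma symEuler_zero_right (α : K₀ A) : symEuler k A α 0 = 0 := by
  simp [symEuler]

lemma DH.K_neg_comm {α : K₀ A} {x : DH k A} {n : ℤ}
    (h : DH.K k α * x = tPar k ^ n • (x * DH.K k α)) :
    DH.K k (-α) * x = tPar k ^ (-n) • (x * DH.K k (-α)) := by
  have h₁ : DH.K k (-α) * (DH.K k α * x) * DH.K k (-α) =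
      tPar k ^ n • (DH.K k (-α) * x) := by
    rw [h, mul_smul_comm, smul_mul_assoc, mul_assoc, mul_assoc x, DH.K_mul_neg, mul_one]
  rw [← mul_assoc, DH.K_neg_mul, one_mul] at h₁
  rw [h₁, smul_smul, ← tPar_zpow_add, neg_add_cancel, zpow_zero, one_smul]

lemma DH.K_comm_of (α : K₀ A) (M : ProjCplx A) :
    DH.K k α * DH.of k M = tPar k ^ symEuler k A α M.hat • (DH.of k M * DH.K k α) := by
  have h {P : A} (hP : Projective P) : DH.K k (cl P) * DH.of k M =
      tPar k ^ symEuler k A (cl P) M.hat • (DH.of k M * DH.K k (cl P)) := by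
    rw [DH.K_cl k hP]
    exact DH.disk_comm k (ProjCplx.isDisk_K hP) M
  obtain ⟨P, Q, hP, hQ, rfl⟩ := K₀.induction_sub α
  rw [sub_eq_add_neg, DH.K_add, mul_assoc, DH.K_neg_comm k (h hQ), mul_smul_comm, ← mul_assoc,
    h hP, smul_mul_assoc, mul_assoc, smul_smul, ← tPar_zpow_add, symEuler_add_left,
    symEuler_neg_left, add_comm]

lemma DH.KDag_comm_of (α : K₀ A) (M : ProjCplx A) :
    DH.KDag k α * DH.of k M =
      tPar k ^ (- symEuler k A α M.hat) • (DH.of k M * DH.KDag k α) := by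
  have h := congrArg (DH.dagHom k) (DH.K_comm_of k α M.dag)
  have h₁ : DH.of k M.dag.dag = DH.of k M := DH.of_congr k (dagDag M.obj)
  rwa [map_mul, map_smul, map_mul, DH.dagHom_of, h₁, ProjCplx.hat_dag, symEuler_neg_right] at h

lemma DH.K_comm_KDag (α β : K₀ A) :
    DH.K k α * DH.KDag k β = DH.KDag k β * DH.K k α := by
  have h {P : A} (hP : Projective P) : Commute (DH.K k α) (DH.KDag k (cl P)) := by
    rw [DH.KDag_cl k hP]
    refine (DH.K_comm_of k α _).trans ?_
    rw [ProjCplx.hat_dag, ProjCplx.hat_K, neg_zero, symEuler_zero_right, zpow_zero, one_smul]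
  obtain ⟨P, Q, hP, hQ, rfl⟩ := K₀.induction_sub β
  rw [sub_eq_add_neg, DH.KDag_add]
  refine ((h hP).mul_right ?_).eq
  let q : (DH k A)ˣ := ⟨_, _, DH.KDag_mul_neg k (cl Q), DH.KDag_neg_mul k (cl Q)⟩
  have : Commute (DH.K k α) (q : DH k A) := h hQ
  exact this.units_inv_right

lemma DH.KDag_sub {P Q : A} (hP : Projective P) (hQ : Projective Q) :
    DH.KDag k (cl P - cl Q) = DH.KDiffDag k hP hQ := by
  rw [DH.KDag, DH.K_sub k hP hQ, DH.KDiff, map_mul, DH.dagHom_of, DH.dagHom_inv]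
  rfl

end Commutation

/-! ### The elements attached to objects -/

section Elements

variable {A : Type u} [Category.{v} A] [Abelian A]

lemma ProjRes.hat_cplx {X : A} (r : ProjRes X) : r.cplx.hat = cl X := r.cl_eq.symm

variable (k : Type w) [Field k] [Finite k] [Linear k A]
  [EnoughProjectives A] [∀ X Y : A, Finite (X ⟶ Y)] [∀ X : A, HasProjectiveDimensionLE X 1]

lemma ProjRes.E_def {X : A} (r : ProjRes X) : r.E k =
    tPar k ^ eulerK k A (cl r.P) (cl X) • (DH.K k (-cl r.P) * DH.of k r.cplx) := by
  rw [eulerK_cl, DH.K_neg_cl k r.projP]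
  rfl

/-- The element `E_X` does not depend on the resolution. -/
lemma ProjRes.E_eq {X : A} (r r' : ProjRes X) : r.E k = r'.E k := by
  have key (r r' : ProjRes X) : DH.of k ((ProjCplx.K r'.projQ).sum r.cplx) =
      tPar k ^ (- eulerK k A (cl r'.Q) (cl X) - eulerK k A (cl r.P) (cl X)) •
        (DH.K k (cl r'.Q + cl r.P) * r.E k) := by
    have h : DH.of k (ProjCplx.K r'.projQ) * DH.of k r.cplx =
        tPar k ^ eulerK k A (cl r'.Q) (cl X) • DH.of k ((ProjCplx.K r'.projQ).sum r.cplx) := by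
      rw [← r.hat_cplx]
      exact DH.disk_mul k (ProjCplx.isDisk_K r'.projQ) r.cplx
    have h₁ : DH.K k (cl r'.Q) = DH.of k (ProjCplx.K r'.projQ) := DH.K_cl k r'.projQ
    rw [r.E_def k, mul_smul_comm, ← mul_assoc, ← DH.K_add, add_neg_cancel_right, h₁, h,
      smul_smul, smul_smul, ← tPar_zpow_add, ← tPar_zpow_add]
    have hab (a b : ℤ) : -a - b + b + a = 0 := by ring
    rw [hab, zpow_zero, one_smul]
  obtain ⟨e⟩ := r.schanuel r'
  have h := DH.of_congr k e
  have hcl : cl r.Q + cl r'.P = cl r'.Q + cl r.P := by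
    have := r.cl_eq.symm.trans r'.cl_eq
    rw [sub_eq_sub_iff_add_eq_add] at this
    rw [this]
  have hn : - eulerK k A (cl r.Q) (cl X) - eulerK k A (cl r'.P) (cl X) =
      - eulerK k A (cl r'.Q) (cl X) - eulerK k A (cl r.P) (cl X) := by
    have := congrArg (fun a => eulerK k A a (cl X)) hcl
    simp only [map_add, AddMonoidHom.add_apply] at this
    omega
  rw [key, key, hcl, hn] at h
  have h₂ := smul_right_injective _ (tPar_zpow_ne_zero k _) h
  have h₃ := congrArg (DH.K k (-(cl r'.Q + cl r.P)) * ·) h₂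
  simpa only [← mul_assoc, DH.K_neg_mul, one_mul] using h₃

/-- The element `E_X` of the localized Hall algebra. -/
def DH.E (X : A) : DH k A := (ProjRes.default X).E k

/-- The element `F_X` of the localized Hall algebra. -/
def DH.F (X : A) : DH k A := DH.dagHom k (DH.E k X)

lemma ProjRes.E_eq_E {X : A} (r : ProjRes X) : r.E k = DH.E k X := r.E_eq k _

lemma ProjRes.F_eq_F {X : A} (r : ProjRes X) : r.F k = DH.F k X := by
  rw [DH.F, ← r.E_eq_E k, ProjRes.E, map_smul, map_mul, DH.dagHom_of, DH.dagHom_inv]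
  rfl

lemma DH.E_congr {X Y : A} (e : X ≅ Y) : DH.E k X = DH.E k Y := by
  rw [← ((ProjRes.default X).ofIso e).E_eq_E k, ← (ProjRes.default X).E_eq_E k, ProjRes.E_def,
    ProjRes.E_def, cl_congr e]
  rfl

/-- The class of the complex of a resolution is `K_P * E_X` up to a power of `t`. -/
lemma ProjRes.of_cplx {X : A} (r : ProjRes X) : DH.of k r.cplx =
    tPar k ^ (- eulerK k A (cl r.P) (cl X)) • (DH.K k (cl r.P) * DH.E k X) := by
  rw [← r.E_eq_E k, r.E_def k, mul_smul_comm, smul_smul, ← tPar_zpow_add, neg_add_cancel, zpow_zero,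
    one_smul, ← mul_assoc, DH.K_mul_neg, one_mul]

/-- The analogue of `ProjRes.of_cplx` for the shift. -/
lemma ProjRes.of_cplx_dag {X : A} (r : ProjRes X) : DH.of k r.cplx.dag =
    tPar k ^ (- eulerK k A (cl r.P) (cl X)) • (DH.KDag k (cl r.P) * DH.F k X) := by
  rw [← DH.dagHom_of, r.of_cplx k, map_smul, map_mul]
  rfl

lemma DH.K_comm_E (α : K₀ A) (X : A) :
    DH.K k α * DH.E k X = tPar k ^ symEuler k A α (cl X) • (DH.E k X * DH.K k α) := by
  rw [DH.E, ProjRes.E_def, mul_smul_comm, ← mul_assoc, ← DH.K_add, add_comm, DH.K_add, mul_assoc,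
    DH.K_comm_of, ProjRes.hat_cplx, mul_smul_comm, smul_mul_assoc, mul_assoc,
    smul_comm (tPar k ^ eulerK k A _ _)]

lemma DH.KDag_comm_E (α : K₀ A) (X : A) :
    DH.KDag k α * DH.E k X = tPar k ^ (- symEuler k A α (cl X)) • (DH.E k X * DH.KDag k α) := by
  rw [DH.E, ProjRes.E_def, mul_smul_comm, ← mul_assoc, ← DH.K_comm_KDag, mul_assoc,
    DH.KDag_comm_of, ProjRes.hat_cplx, mul_smul_comm, smul_mul_assoc, mul_assoc,
    smul_comm (tPar k ^ eulerK k A _ _)]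

lemma DH.dagHom_dagHom (x : DH k A) : DH.dagHom k (DH.dagHom k x) = x := by
  have h : (LinearMap.eqLocus ((DH.dagHom k).toLinearMap ∘ₗ (DH.dagHom k).toLinearMap)
      (LinearMap.id : DH k A →ₗ[ℂ] DH k A)) = ⊤ := by
    have hof (M : ProjCplx A) : DH.of k M.dag.dag = DH.of k M := DH.of_congr k (dagDag M.obj)
    refine DH.eq_top_of_mul_mem _ ?_ ?_ ?_
    · change DH.dagHom k (DH.dagHom k 1) = 1
      rw [map_one, map_one]
    · intro M x hx
      change DH.dagHom k (DH.dagHom k (_ * x)) = _ * x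
      change DH.dagHom k (DH.dagHom k x) = x at hx
      rw [map_mul, map_mul, hx, DH.dagHom_of, DH.dagHom_of, hof]
    · intro M hM x hx
      change DH.dagHom k (DH.dagHom k (_ * x)) = _ * x
      change DH.dagHom k (DH.dagHom k x) = x at hx
      rw [map_mul, map_mul, hx, DH.dagHom_inv, DH.dagHom_inv]
      congr 1
      refine left_inv_eq_right_inv (DH.inv_mul_of _ _) ?_
      rw [hof, DH.of_mul_inv]
  exact (h ▸ Submodule.mem_top : x ∈ LinearMap.eqLocus ((DH.dagHom k).toLinearMap ∘ₗ
    (DH.dagHom k).toLinearMap) (LinearMap.id : DH k A →ₗ[ℂ] DH k A))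

lemma DH.K_comm_F (α : K₀ A) (X : A) :
    DH.K k α * DH.F k X = tPar k ^ (- symEuler k A α (cl X)) • (DH.F k X * DH.K k α) := by
  have h := congrArg (DH.dagHom k) (DH.KDag_comm_E k α X)
  rwa [map_mul, map_smul, map_mul, DH.KDag, DH.dagHom_dagHom] at h

lemma DH.KDag_comm_F (α : K₀ A) (X : A) :
    DH.KDag k α * DH.F k X = tPar k ^ symEuler k A α (cl X) • (DH.F k X * DH.KDag k α) := by
  have h := congrArg (DH.dagHom k) (DH.K_comm_E k α X)
  rwa [map_mul, map_smul, map_mul] at h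

end Elements

/-! ### The Hall algebra of the abelian category -/

section HallAbelian

variable (k : Type w) [Field k] {A : Type u} [Category.{v} A] [Abelian A] [Linear k A]

lemma HTw.of_congr {X Y : A} (e : X ≅ Y) : HTw.of k X = HTw.of k Y := by
  rw [HTw.of, HTw.of, isoCl_eq_iff.2 ⟨e⟩]

lemma HTw.of_out (x : IsoCl A) : HTw.of k x.out = (Finsupp.single x (1 : ℂ) :) := by
  rw [HTw.of, isoCl_out]

lemma HTw.induction {p : HTw k A → Prop} (h0 : p 0) (hadd : ∀ x y, p x → p y → p (x + y))
    (hsmul : ∀ (c : ℂ) x, p x → p (c • x)) (hof : ∀ X, p (HTw.of k X)) (x : HTw k A) : p x := by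
  refine Finsupp.induction_linear (motive := p) x h0 hadd fun a c => ?_
  have : (Finsupp.single a c : IsoCl A →₀ ℂ) = c • HTw.of k a.out := by
    rw [HTw.of_out]
    exact (Finsupp.smul_single_one a c).symm
  rw [this]
  exact hsmul _ _ (hof _)

lemma HTw.mul_def (x y : HTw k A) : x * y = HTw.mulLin k A x y := rfl

lemma HTw.mulLin_single (x z : IsoCl A) :
    HTw.mulLin k A (Finsupp.single x (1 : ℂ) :) (Finsupp.single z (1 : ℂ) :) =
      tPar k ^ euler k x.out z.out •
        ∑ᶠ y : IsoCl A, hallNumber x.out z.out y.out • HTw.of k y.out := by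
  unfold HTw.mulLin
  erw [Finsupp.lsum_single, LinearMap.toSpanSingleton_apply, one_smul, Finsupp.lsum_single,
    LinearMap.toSpanSingleton_apply, one_smul]

variable [Finite k] [EnoughProjectives A] [∀ X Y : A, Finite (X ⟶ Y)]
  [∀ X : A, HasProjectiveDimensionLE X 1]

instance (X Y : A) : Fintype (X ⟶ Y) := Fintype.ofFinite _

/-- The product of two classes is a sum over the morphisms out of the first syzygy. -/
lemma HTw.of_mul_of {X Z : A} (r : ProjRes X) : HTw.of k X * HTw.of k Z =
    tPar k ^ (eulerK k A (cl X) (cl Z) - 2 * eulerK k A (cl r.Q) (cl Z)) •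
      ∑ φ : r.P ⟶ Z, HTw.of k (pushMid r φ) := by
  have h₀ : HTw.of k X * HTw.of k Z = tPar k ^ euler k (isoCl X).out (isoCl Z).out •
      ∑ᶠ y : IsoCl A, hallNumber (isoCl X).out (isoCl Z).out y.out • HTw.of k y.out :=
    HTw.mulLin_single k _ _
  have h₁ : euler k (isoCl X).out (isoCl Z).out = eulerK k A (cl X) (cl Z) := by
    rw [← cl_congr (outIso X), ← cl_congr (outIso Z), eulerK_cl]
  have := r.projQ
  have h₂ (y : IsoCl A) :
      hallNumber (isoCl X).out (isoCl Z).out y.out • HTw.of k y.out =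
      (Nat.card {φ : r.P ⟶ Z // isoCl (pushMid r φ) = y} : ℂ) •
        (tPar k ^ (- (2 * eulerK k A (cl r.Q) (cl Z))) • HTw.of k y.out) := by
    rw [hallNumber_congr (outIso X) (outIso Z) (Iso.refl _), hallNumber_eq_card r,
      card_hom_of_projective k, zpow_neg, div_eq_mul_inv, mul_smul]
    have hc : Nat.card {φ : r.P ⟶ Z // Nonempty (pushMid r φ ≅ y.out)} =
        Nat.card {φ : r.P ⟶ Z // isoCl (pushMid r φ) = y} :=
      Nat.card_congr (Equiv.subtypeEquivRight fun s => by
        rw [← isoCl_out y, isoCl_eq_iff, isoCl_out])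
    rw [hc]
  rw [h₀, h₁, finsum_congr h₂,
    finsum_card_fibre _ fun y : IsoCl A =>
      tPar k ^ (- (2 * eulerK k A (cl r.Q) (cl Z))) • HTw.of k y.out, ← Finset.smul_sum, smul_smul,
      ← tPar_zpow_add, ← sub_eq_add_neg]
  congr 1
  refine Finset.sum_congr rfl fun s _ => ?_
  rw [HTw.of_out, HTw.of]

variable {k}

/-- The universal property of the extended twisted Hall algebra. -/
def HTwE.lift {B : Type*} [Ring B] [Algebra ℂ B] (φ : HTw k A →ₗ[ℂ] B) (κ : K₀ A → B)
    (h_one : φ 1 = 1) (h_mul : ∀ x y, φ (x * y) = φ x * φ y) (hκ_zero : κ 0 = 1)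
    (hκ_add : ∀ α β, κ (α + β) = κ α * κ β)
    (hκ_comm : ∀ α (X : A), κ α * φ (HTw.of k X) =
      tPar k ^ symEuler k A α (cl X) • (φ (HTw.of k X) * κ α)) : HTwE k A →ₐ[ℂ] B :=
  RingQuot.liftAlgHom ℂ ⟨FreeAlgebra.lift ℂ (Sum.elim φ κ), by
    intro x y h
    cases h <;> simp [h_one, h_mul, hκ_zero, hκ_add, hκ_comm]⟩

lemma HTwE.lift_of {B : Type*} [Ring B] [Algebra ℂ B] (φ : HTw k A →ₗ[ℂ] B) (κ : K₀ A → B)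
    (h_one : φ 1 = 1) (h_mul : ∀ x y, φ (x * y) = φ x * φ y) (hκ_zero : κ 0 = 1)
    (hκ_add : ∀ α β, κ (α + β) = κ α * κ β)
    (hκ_comm : ∀ α (X : A), κ α * φ (HTw.of k X) =
      tPar k ^ symEuler k A α (cl X) • (φ (HTw.of k X) * κ α)) (X : A) :
    HTwE.lift φ κ h_one h_mul hκ_zero hκ_add hκ_comm (HTwE.of k X) = φ (HTw.of k X) := by
  change RingQuot.liftAlgHom ℂ _ (RingQuot.mkAlgHom ℂ (HTwERel k A) _) = _
  rw [RingQuot.liftAlgHom_mkAlgHom_apply, FreeAlgebra.lift_ι_apply, Sum.elim_inl]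

lemma HTwE.lift_K {B : Type*} [Ring B] [Algebra ℂ B] (φ : HTw k A →ₗ[ℂ] B) (κ : K₀ A → B)
    (h_one : φ 1 = 1) (h_mul : ∀ x y, φ (x * y) = φ x * φ y) (hκ_zero : κ 0 = 1)
    (hκ_add : ∀ α β, κ (α + β) = κ α * κ β)
    (hκ_comm : ∀ α (X : A), κ α * φ (HTw.of k X) =
      tPar k ^ symEuler k A α (cl X) • (φ (HTw.of k X) * κ α)) (α : K₀ A) :
    HTwE.lift φ κ h_one h_mul hκ_zero hκ_add hκ_comm (HTwE.K k α) = κ α := by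
  change RingQuot.liftAlgHom ℂ _ (RingQuot.mkAlgHom ℂ (HTwERel k A) _) = _
  rw [RingQuot.liftAlgHom_mkAlgHom_apply, FreeAlgebra.lift_ι_apply, Sum.elim_inr]

variable (k)

/-- The canonical linear map from the Hall algebra to the extended Hall algebra. -/
def HTwE.fromHTw : HTw k A →ₗ[ℂ] HTwE k A where
  toFun x := RingQuot.mkAlgHom ℂ (HTwERel k A) (FreeAlgebra.ι ℂ (Sum.inl x))
  map_add' x y := (RingQuot.mkAlgHom_rel ℂ (HTwERel.add x y)).trans (map_add _ _ _)
  map_smul' c x := (RingQuot.mkAlgHom_rel ℂ (HTwERel.smul c x)).trans (map_smul _ _ _)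

lemma HTwE.fromHTw_of (X : A) : HTwE.fromHTw k (HTw.of k X) = HTwE.of k X := rfl

lemma HTwE.fromHTw_mul (x y : HTw k A) :
    HTwE.fromHTw k (x * y) = HTwE.fromHTw k x * HTwE.fromHTw k y :=
  (RingQuot.mkAlgHom_rel ℂ (HTwERel.mul x y)).trans (map_mul _ _ _)

lemma HTwE.of_zero : HTwE.of k (0 : A) = 1 :=
  (RingQuot.mkAlgHom_rel ℂ HTwERel.one).trans (map_one _)

lemma HTwE.K_zero : HTwE.K k (0 : K₀ A) = 1 :=
  (RingQuot.mkAlgHom_rel ℂ HTwERel.K_zero).trans (map_one _)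

lemma HTwE.K_add (α β : K₀ A) : HTwE.K k (α + β) = HTwE.K k α * HTwE.K k β :=
  (RingQuot.mkAlgHom_rel ℂ (HTwERel.K_add α β)).trans (map_mul _ _ _)

lemma HTwE.K_comm (α : K₀ A) (B : A) : HTwE.K k α * HTwE.of k B =
    tPar k ^ symEuler k A α (cl B) • (HTwE.of k B * HTwE.K k α) := by
  have := RingQuot.mkAlgHom_rel ℂ (HTwERel.K_comm (k := k) α B)
  rwa [map_mul, map_smul, map_mul] at this

/-- The presentation of the extended Hall algebra as a quotient of a free algebra. -/
def HTwE.mkFree : FreeAlgebra ℂ (HTw k A ⊕ K₀ A) →ₐ[ℂ] HTwE k A :=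
  RingQuot.mkAlgHom ℂ (HTwERel k A)

/-- A subspace of the extended Hall algebra that contains `1` and is stable under left
multiplication by the generators is everything. -/
lemma HTwE.eq_top_of_mul_mem (W : Submodule ℂ (HTwE k A)) (h1 : 1 ∈ W)
    (hof : ∀ X : A, ∀ x ∈ W, HTwE.of k X * x ∈ W)
    (hK : ∀ α : K₀ A, ∀ x ∈ W, HTwE.K k α * x ∈ W) : W = ⊤ := by
  refine eq_top_iff.2 fun z _ => ?_
  suffices h : ∀ a : FreeAlgebra ℂ (HTw k A ⊕ K₀ A), ∀ x ∈ W, HTwE.mkFree k a * x ∈ W by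
    obtain ⟨a, rfl⟩ := RingQuot.mkAlgHom_surjective ℂ (HTwERel k A) z
    have := h a 1 h1
    rwa [mul_one] at this
  intro a
  induction a using FreeAlgebra.induction with
  | grade0 r =>
    intro x hx
    rw [AlgHom.commutes, ← Algebra.smul_def]
    exact W.smul_mem r hx
  | grade1 g =>
    intro x hx
    rcases g with h | α
    · change HTwE.fromHTw k h * x ∈ W
      refine HTw.induction k (p := fun h => HTwE.fromHTw k h * x ∈ W) ?_ ?_ ?_
        (fun M => hof M x hx) h
      · simp
      · intro a b ha hb
        rw [map_add, add_mul]
        exact W.add_mem ha hb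
      · intro c a ha
        rw [map_smul, Algebra.smul_mul_assoc]
        exact W.smul_mem c ha
    · exact hK α x hx
  | mul a b ha hb =>
    intro x hx
    rw [map_mul, mul_assoc]
    exact ha _ (hb _ hx)
  | add a b ha hb =>
    intro x hx
    rw [map_add, add_mul]
    exact W.add_mem (ha _ hx) (hb _ hx)

/-- The extended Hall algebra is spanned by the products `[X] * K_α`. -/
lemma HTwE.span_eq_top : Submodule.span ℂ
    (Set.range fun p : IsoCl A × K₀ A => HTwE.of k p.1.out * HTwE.K k p.2) = ⊤ := by
  have hmem (x : HTw k A) (α : K₀ A) : HTwE.fromHTw k x * HTwE.K k α ∈ Submodule.span ℂ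
      (Set.range fun p : IsoCl A × K₀ A => HTwE.of k p.1.out * HTwE.K k p.2) := by
    refine HTw.induction k (p := fun x => HTwE.fromHTw k x * HTwE.K k α ∈ Submodule.span ℂ
      (Set.range fun p : IsoCl A × K₀ A => HTwE.of k p.1.out * HTwE.K k p.2)) ?_ ?_ ?_ ?_ x
    · rw [map_zero, zero_mul]; exact Submodule.zero_mem _
    · intro a b ha hb
      rw [map_add, add_mul]
      exact Submodule.add_mem _ ha hb
    · intro c a ha
      rw [map_smul, smul_mul_assoc]
      exact Submodule.smul_mem _ c ha
    · intro X
      refine Submodule.subset_span ⟨(isoCl X, α), ?_⟩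
      change HTwE.of k (isoCl X).out * _ = HTwE.of k X * _
      rw [← HTwE.fromHTw_of, HTw.of_congr k (outIso X), HTwE.fromHTw_of]
  refine HTwE.eq_top_of_mul_mem k _ ?_ ?_ ?_
  · have := hmem (HTw.of k (0 : A)) 0
    rwa [HTwE.fromHTw_of, HTwE.of_zero, HTwE.K_zero, one_mul] at this
  · intro X x hx
    induction hx using Submodule.span_induction with
    | mem x hx =>
      obtain ⟨⟨Y, α⟩, rfl⟩ := hx
      have := hmem (HTw.of k X * HTw.of k Y.out) α
      rwa [HTwE.fromHTw_mul, mul_assoc] at this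
    | zero => rw [mul_zero]; exact Submodule.zero_mem _
    | add x y _ _ hx hy => rw [mul_add]; exact Submodule.add_mem _ hx hy
    | smul c x _ hx => rw [mul_smul_comm]; exact Submodule.smul_mem _ c hx
  · intro α x hx
    induction hx using Submodule.span_induction with
    | mem x hx =>
      obtain ⟨⟨Y, β⟩, rfl⟩ := hx
      change HTwE.K k α * (HTwE.of k Y.out * HTwE.K k β) ∈ _
      rw [← mul_assoc, HTwE.K_comm, smul_mul_assoc, mul_assoc, ← HTwE.K_add]
      exact Submodule.smul_mem _ _ (hmem (HTw.of k Y.out) (α + β))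
    | zero => rw [mul_zero]; exact Submodule.zero_mem _
    | add x y _ _ hx hy => rw [mul_add]; exact Submodule.add_mem _ hx hy
    | smul c x _ hx => rw [mul_smul_comm]; exact Submodule.smul_mem _ c hx

end HallAbelian

/-! ### The homomorphisms to the localized Hall algebra -/

section Homomorphisms

variable (k : Type w) [Field k] [Finite k] {A : Type u} [Category.{v} A] [Abelian A] [Linear k A]
  [EnoughProjectives A] [∀ X Y : A, Finite (X ⟶ Y)] [∀ X : A, HasProjectiveDimensionLE X 1]

/-- The linear map `[X] ↦ E_X`. -/
def HTw.toDH : HTw k A →ₗ[ℂ] DH k A := Finsupp.linearCombination ℂ fun x : IsoCl A => DH.E k x.out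

lemma HTw.toDH_of (X : A) : HTw.toDH k (HTw.of k X) = DH.E k X :=
  (Finsupp.linearCombination_single _ _ _).trans
    ((one_smul _ _).trans (DH.E_congr k (outIso X)))

/-- Summing over all lifts of morphisms to the end of a resolution. -/
lemma sum_comp_g {V : Type*} [AddCommGroup V] [Module ℂ V] {Z P : A} [Projective P]
    (r : ProjRes Z) (F : (P ⟶ Z) → V) : ∑ s : P ⟶ r.Q, F (s ≫ r.g) =
      tPar k ^ (2 * eulerK k A (cl P) (cl r.P)) • ∑ φ : P ⟶ Z, F φ := by
  classical
  have := r.mono_f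
  have := r.epi_g
  have hc (φ : P ⟶ Z) : Nat.card {s : P ⟶ r.Q // s ≫ r.g = φ} = Nat.card (P ⟶ r.P) := by
    let s₀ := Projective.factorThru φ r.g
    have hs₀ : s₀ ≫ r.g = φ := Projective.factorThru_comp _ _
    refine (Nat.card_congr (Equiv.ofBijective
      (fun l : P ⟶ r.P => (⟨s₀ + l ≫ r.f, by
        rw [Preadditive.add_comp, hs₀, Category.assoc, r.w, comp_zero, add_zero]⟩ :
        {s : P ⟶ r.Q // s ≫ r.g = φ})) ⟨?_, ?_⟩)).symm
    · intro l l' h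
      exact (cancel_mono r.f).1 (add_left_cancel (congrArg Subtype.val h))
    · rintro ⟨s, hs⟩
      obtain ⟨l, hl⟩ := r.exists_lift (s - s₀) (by rw [Preadditive.sub_comp, hs, hs₀, sub_self])
      exact ⟨l, Subtype.ext ((congrArg (s₀ + ·) hl).trans (add_sub_cancel _ _))⟩
  rw [← card_hom_of_projective k, ← finsum_card_fibre (fun s : P ⟶ r.Q => s ≫ r.g) F,
    finsum_eq_sum_of_fintype, Finset.smul_sum]
  exact Finset.sum_congr rfl fun φ _ => by rw [hc]

/-- The product `[C_r] * [C_r']` is a sum over the cocycles `P ⟶ Q'`, whose twisted sums are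
resolutions of the extensions of `X` by `Z`. Grouping them by the composite `P ⟶ Q' ⟶ Z`, which is
the parameter of the extension, gives the product of `[X]` and `[Z]`. -/
lemma DH.E_mul_E (X Z : A) :
    HTw.toDH k (HTw.of k X * HTw.of k Z) = DH.E k X * DH.E k Z := by
  let r := ProjRes.default X
  let r' := ProjRes.default Z
  have := r.projP
  have h₁ := congrArg (DH.fromH k) (HTwC.of_mul_of k r.cplx r'.cplx)
  have h₂ (s : r.P ⟶ r'.Q) :
      DH.fromH k (HTwC.of k (ProjCplx.twist (extCocycle r r' s))) =
        tPar k ^ (- eulerK k A (cl r.P + cl r'.P) (cl X + cl Z)) •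
          (DH.K k (cl r.P + cl r'.P) * DH.E k (pushMid r (s ≫ r'.g))) := by
    have h₃ : DH.of k (ProjCplx.twist (extCocycle r r' s)) = DH.of k (r.extend r' s).cplx :=
      DH.of_congr k (twistExtend r r' s)
    have h₄ : cl (r.extend r' s).P = cl r.P + cl r'.P := (cl_biprod _ _).trans (add_comm _ _)
    have h₅ : cl (pushMid r (s ≫ r'.g)) = cl X + cl Z :=
      (cl_shortExact (pushExt r (s ≫ r'.g)).shortExact).trans (add_comm _ _)
    rw [DH.fromH_of, h₃, ProjRes.of_cplx, h₄, h₅]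
  rw [map_mul, map_smul, map_sum, ← (Fintype.sum_bijective (extCocycle r r')
    (extCocycle_bijective r r') _ _ fun s => rfl), Finset.sum_congr rfl fun s _ => h₂ s,
    ← Finset.smul_sum, ← Finset.mul_sum, sum_comp_g k r' fun φ => DH.E k (pushMid r φ),
    DH.fromH_of, DH.fromH_of, r.of_cplx k, r'.of_cplx k, smul_mul_smul_comm, mul_assoc,
    ← mul_assoc (DH.E k X)] at h₁
  have h₆ : DH.E k X * DH.K k (cl r'.P) =
      tPar k ^ (- symEuler k A (cl r'.P) (cl X)) • (DH.K k (cl r'.P) * DH.E k X) := by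
    rw [DH.K_comm_E, smul_smul, ← tPar_zpow_add, neg_add_cancel, zpow_zero, one_smul]
  rw [h₆, smul_mul_assoc, mul_smul_comm, mul_assoc, ← mul_assoc (DH.K k (cl r.P)), ← DH.K_add,
    mul_smul_comm, smul_smul, smul_smul, smul_smul] at h₁
  have h₇ := congrArg (DH.K k (-(cl r.P + cl r'.P)) * ·) h₁
  simp only [mul_smul_comm, ← mul_assoc, DH.K_neg_mul, one_mul, ← tPar_zpow_add] at h₇
  rw [HTw.of_mul_of k r, map_smul, map_sum, Finset.sum_congr rfl fun φ _ => HTw.toDH_of k _]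
  refine smul_right_injective _ (tPar_zpow_ne_zero k (- eulerK k A (cl r.P) (cl X) +
    - eulerK k A (cl r'.P) (cl Z) + - symEuler k A (cl r'.P) (cl X))) ?_
  change _ • _ • _ = _ • (_ * _)
  rw [h₇, smul_smul, ← tPar_zpow_add]
  congr 2
  have h₈ : eulerC k r.cplx r'.cplx =
    eulerK k A (cl r.Q) (cl r'.Q) + eulerK k A (cl r.P) (cl r'.P) := rfl
  rw [symEuler, h₈, r.cl_eq, r'.cl_eq]
  simp only [map_add, map_sub, AddMonoidHom.add_apply, AddMonoidHom.sub_apply]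
  ring

lemma HTw.toDH_mul (x y : HTw k A) : HTw.toDH k (x * y) = HTw.toDH k x * HTw.toDH k y := by
  refine HTw.induction k (p := fun x => toDH k (x * y) = toDH k x * toDH k y)
    ?_ ?_ ?_ (fun M => ?_) x
  · simp only [HTw.mul_def, map_zero, zero_mul, LinearMap.zero_apply]
  · intro a b ha hb
    simp only [HTw.mul_def, map_add, add_mul, LinearMap.add_apply] at ha hb ⊢
    rw [ha, hb]
  · intro c a ha
    simp only [HTw.mul_def, map_smul, smul_mul_assoc, LinearMap.smul_apply] at ha ⊢
    rw [ha]
  refine HTw.induction k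
    (p := fun y => toDH k (of k M * y) = toDH k (of k M) * toDH k y) ?_ ?_ ?_ (fun N => ?_) y
  · simp only [HTw.mul_def, map_zero, mul_zero]
  · intro a b ha hb
    simp only [HTw.mul_def, map_add, mul_add] at ha hb ⊢
    rw [ha, hb]
  · intro c a ha
    simp only [HTw.mul_def, map_smul, mul_smul_comm] at ha ⊢
    rw [ha]
  rw [DH.E_mul_E, toDH_of, toDH_of]

lemma HTw.toDH_one : HTw.toDH k (1 : HTw k A) = 1 := by
  change HTw.toDH k (HTw.of k (0 : A)) = 1
  rw [HTw.toDH_of, ← (ProjRes.zero (inferInstance : Projective (0 : A))).E_eq_E k, ProjRes.E_def,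
    cl_isZero (isZero_zero A), map_zero, zpow_zero, one_smul]
  have : DH.of k (ProjRes.zero (inferInstance : Projective (0 : A))).cplx = DH.K k (cl (0 : A)) :=
    (DH.K_cl k (inferInstance : Projective (0 : A))).symm
  rw [this]
  exact DH.K_neg_mul k _

/-- The homomorphism `I_+^e`. -/
def iPlus : HTwE k A →ₐ[ℂ] DH k A :=
  HTwE.lift (HTw.toDH k) (DH.K k) (HTw.toDH_one k) (HTw.toDH_mul k) (DH.K_zero k) (DH.K_add k)
    fun α X => by rw [HTw.toDH_of]; exact DH.K_comm_E k α X

lemma iPlus_of (X : A) : iPlus k (HTwE.of k X) = DH.E k X :=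
  (HTwE.lift_of _ _ _ _ _ _ _ X).trans (HTw.toDH_of k X)

lemma iPlus_K (α : K₀ A) : iPlus k (HTwE.K k α) = DH.K k α := HTwE.lift_K _ _ _ _ _ _ _ α

lemma HTwE.algHom_ext {B : Type*} [Ring B] [Algebra ℂ B] {f g : HTwE k A →ₐ[ℂ] B}
    (h₁ : ∀ X, f (HTwE.of k X) = g (HTwE.of k X)) (h₂ : ∀ α, f (HTwE.K k α) = g (HTwE.K k α)) :
    f = g := by
  have h : f.toLinearMap = g.toLinearMap := by
    refine LinearMap.ext_on_range (HTwE.span_eq_top k) fun p => ?_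
    change f (_ * _) = g (_ * _)
    rw [map_mul, map_mul, h₁, h₂]
  exact AlgHom.toLinearMap_injective h

/-- Existence and uniqueness of `I_+^e`. -/
lemma isIPlus_iff (I : HTwE k A →ₐ[ℂ] DH k A) : IsIPlus k I ↔ I = iPlus k := by
  constructor
  · intro h
    refine HTwE.algHom_ext k (fun X => ?_) fun α => ?_
    · rw [h.map_of X (ProjRes.default X), iPlus_of]
      rfl
    · obtain ⟨P, Q, hP, hQ, rfl⟩ := K₀.induction_sub α
      rw [h.map_K P Q hP hQ, iPlus_K, DH.K_sub k hP hQ]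
  · rintro rfl
    exact ⟨fun X r => by rw [iPlus_of, r.E_eq_E k], fun P Q hP hQ => by
      rw [iPlus_K, DH.K_sub k hP hQ]⟩

/-- The homomorphism `I_-^e`. -/
def iMinus : HTwE k A →ₐ[ℂ] DH k A := (DH.dagHom k).comp (iPlus k)

lemma iMinus_of (X : A) : iMinus k (HTwE.of k X) = DH.F k X := by
  rw [iMinus, AlgHom.comp_apply, iPlus_of]
  rfl

lemma iMinus_K (α : K₀ A) : iMinus k (HTwE.K k α) = DH.KDag k α := by
  rw [iMinus, AlgHom.comp_apply, iPlus_K]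
  rfl

/-- Existence and uniqueness of `I_-^e`. -/
lemma isIMinus_iff (I : HTwE k A →ₐ[ℂ] DH k A) : IsIMinus k I ↔ I = iMinus k := by
  constructor
  · intro h
    refine HTwE.algHom_ext k (fun X => ?_) fun α => ?_
    · rw [h.map_of X (ProjRes.default X), iMinus_of, ProjRes.F_eq_F]
    · obtain ⟨P, Q, hP, hQ, rfl⟩ := K₀.induction_sub α
      rw [h.map_K P Q hP hQ, iMinus_K, DH.KDag_sub k hP hQ]
  · rintro rfl
    exact ⟨fun X r => by rw [iMinus_of, r.F_eq_F k], fun P Q hP hQ => by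
      rw [iMinus_K, DH.KDag_sub k hP hQ]⟩

end Homomorphisms

/-! ### Decomposition of complexes of projectives -/

section Decomposition

variable {A : Type u} [Category.{v} A] [Abelian A]

/-- The direct sum of the complex of a resolution and of the shift of the complex of another
resolution. -/
def ProjRes.sumDag {X Y : A} (r : ProjRes X) (r' : ProjRes Y) : ProjCplx A :=
  r.cplx.sum r'.cplx.dag

section

variable {X Y : A} (r : ProjRes X) (r' : ProjRes Y)

/-- The differential of `ProjRes.sumDag` in degrees `1 ⟶ 0`. -/
def sumDagD₁ : r'.Q ⊞ r.P ⟶ r'.P ⊞ r.Q := biprod.snd ≫ r.f ≫ biprod.inr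

/-- The differential of `ProjRes.sumDag` in degrees `0 ⟶ 1`. -/
def sumDagD₀ : r'.P ⊞ r.Q ⟶ r'.Q ⊞ r.P := -(biprod.fst ≫ r'.f ≫ biprod.inl)

lemma sumDag_d₁ : (r.sumDag r').obj.d 1 0 = sumDagD₁ r r' := by
  have h : biprod.desc ((-(0 : r'.Q ⟶ r'.P)) ≫ biprod.inl)
      ((0 : r.P ⟶ r'.P) ≫ biprod.inl + r.f ≫ biprod.inr) = sumDagD₁ r r' := by
    apply biprod.hom_ext' <;> simp [sumDagD₁]
  exact h

lemma sumDag_d₀ : (r.sumDag r').obj.d 0 1 = sumDagD₀ r r' := by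
  have h : biprod.desc ((-r'.f) ≫ biprod.inl)
      ((0 : r.Q ⟶ r'.Q) ≫ biprod.inl + (0 : r.Q ⟶ r.P) ≫ biprod.inr) = sumDagD₀ r r' := by
    apply biprod.hom_ext' <;> simp [sumDagD₀]
  exact h

end

/-- The image of a morphism to a projective object is projective, so the kernel of the morphism is
a direct summand. -/
lemma exists_splitting [∀ X : A, HasProjectiveDimensionLE X 1] {M N : A} [Projective N]
    (e : M ⟶ N) : ∃ (s : Abelian.coimage e ⟶ M) (ρ : M ⟶ kernel e),
      s ≫ Abelian.coimage.π e = 𝟙 _ ∧ kernel.ι e ≫ ρ = 𝟙 _ ∧ s ≫ ρ = 0 ∧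
        ρ ≫ kernel.ι e + Abelian.coimage.π e ≫ s = 𝟙 _ := by
  have := projective_of_mono (Abelian.factorThruCoimage e)
  let S := ShortComplex.mk (kernel.ι e) (Abelian.coimage.π e) (cokernel.condition _)
  have hS : S.ShortExact :=
    { exact := ShortComplex.exact_of_g_is_cokernel _ (cokernelIsCokernel _)
      mono_f := inferInstanceAs (Mono (kernel.ι e))
      epi_g := inferInstanceAs (Epi (cokernel.π (kernel.ι e))) }
  have : Projective S.X₃ := this
  let σ := hS.splittingOfProjective
  exact ⟨σ.s, σ.r, σ.s_g, σ.f_r, σ.s_r, σ.id⟩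

/-- Every complex of projectives over a hereditary category is the direct sum of the complex of a
resolution and of the shift of the complex of another resolution. -/
lemma ProjCplx.exists_iso_sumDag [∀ X : A, HasProjectiveDimensionLE X 1] (M : ProjCplx A) :
    ∃ (X Y : A) (r : ProjRes X) (r' : ProjRes Y), Nonempty (M.obj ≅ (r.sumDag r').obj) := by
  let d := M.obj.d 1 0
  let e := M.obj.d 0 1
  have hde : d ≫ e = 0 := M.obj.d_comp_d _ _ _
  have hed : e ≫ d = 0 := M.obj.d_comp_d _ _ _
  have p₀ : Projective (M.obj.X 0) := M.property 0
  have p₁ : Projective (M.obj.X 1) := M.property 1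
  -- `d` and `e` factor over the kernels of one another.
  let f : Abelian.coimage d ⟶ kernel e := kernel.lift e (Abelian.factorThruCoimage d) (by
    rw [← cancel_epi (Abelian.coimage.π d), ← Category.assoc, Abelian.coimage.fac, hde, comp_zero])
  let f' : Abelian.coimage e ⟶ kernel d := kernel.lift d (Abelian.factorThruCoimage e) (by
    rw [← cancel_epi (Abelian.coimage.π e), ← Category.assoc, Abelian.coimage.fac, hed, comp_zero])
  have hf : f ≫ kernel.ι e = Abelian.factorThruCoimage d := kernel.lift_ι _ _ _
  have hf' : f' ≫ kernel.ι d = Abelian.factorThruCoimage e := kernel.lift_ι _ _ _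
  have hd : d = Abelian.coimage.π d ≫ f ≫ kernel.ι e := by rw [hf, Abelian.coimage.fac]
  have he : e = Abelian.coimage.π e ≫ f' ≫ kernel.ι d := by rw [hf', Abelian.coimage.fac]
  have : Mono f := mono_of_mono_fac hf
  have : Mono f' := mono_of_mono_fac hf'
  have : Mono (-f') := Preadditive.mono_of_cancel_zero _ fun g hg => by
    rw [Preadditive.comp_neg, neg_eq_zero] at hg
    exact zero_of_comp_mono f' hg
  obtain ⟨s, ρ, h₁, h₂, h₃, h₄⟩ := exists_splitting e
  obtain ⟨s', ρ', h₁', h₂', h₃', h₄'⟩ := exists_splitting d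
  have hι : kernel.ι e ≫ Abelian.coimage.π e = 0 := cokernel.condition _
  have hι' : kernel.ι d ≫ Abelian.coimage.π d = 0 := cokernel.condition _
  let r := ProjRes.ofMono (projective_of_mono (Abelian.factorThruCoimage d))
    (projective_of_mono (kernel.ι e)) f
  let r' := ProjRes.ofMono (projective_of_mono (Abelian.factorThruCoimage e))
    (projective_of_mono (kernel.ι d)) (-f')
  let e₀ : M.obj.X 0 ≅ Abelian.coimage e ⊞ kernel e :=
    { hom := biprod.lift (Abelian.coimage.π e) ρ
      inv := biprod.desc s (kernel.ι e)
      hom_inv_id := by rw [biprod.lift_desc, add_comm, h₄]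
      inv_hom_id := by apply biprod.hom_ext' <;> apply biprod.hom_ext <;> simp [h₁, h₂, h₃, hι] }
  let e₁ : M.obj.X 1 ≅ kernel d ⊞ Abelian.coimage d :=
    { hom := biprod.lift ρ' (Abelian.coimage.π d)
      inv := biprod.desc (kernel.ι d) s'
      hom_inv_id := by rw [biprod.lift_desc, h₄']
      inv_hom_id := by
        apply biprod.hom_ext' <;> apply biprod.hom_ext <;> simp [h₁', h₂', h₃', hι'] }
  have c₁ : e₁.hom ≫ sumDagD₁ r r' = d ≫ e₀.hom := by
    have hl : d ≫ Abelian.coimage.π e = 0 := by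
      rw [hd, Category.assoc, Category.assoc, hι, comp_zero, comp_zero]
    have hr : d ≫ ρ = Abelian.coimage.π d ≫ f :=
      (hd =≫ ρ).trans (by rw [Category.assoc, Category.assoc, h₂, Category.comp_id])
    change biprod.lift ρ' (Abelian.coimage.π d) ≫ biprod.snd ≫ f ≫ biprod.inr =
      d ≫ biprod.lift (Abelian.coimage.π e) ρ
    apply biprod.hom_ext <;> simp [hl, hr]
  have c₀ : e₀.hom ≫ sumDagD₀ r r' = e ≫ e₁.hom := by
    have hl : e ≫ Abelian.coimage.π d = 0 := by
      rw [he, Category.assoc, Category.assoc, hι', comp_zero, comp_zero]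
    have hr : e ≫ ρ' = Abelian.coimage.π e ≫ f' :=
      (he =≫ ρ').trans (by rw [Category.assoc, Category.assoc, h₂', Category.comp_id])
    change biprod.lift (Abelian.coimage.π e) ρ ≫ (-(biprod.fst ≫ (-f') ≫ biprod.inl)) =
      e ≫ biprod.lift ρ' (Abelian.coimage.π d)
    apply biprod.hom_ext <;> simp [hl, hr]
  exact ⟨_, _, r, r', ⟨z2Iso (M := M.obj) (N := (r.sumDag r').obj) e₁ e₀
    ((congrArg (e₁.hom ≫ ·) (sumDag_d₁ r r')).trans c₁)
    ((congrArg (e₀.hom ≫ ·) (sumDag_d₀ r r')).trans c₀)⟩⟩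

/-- The homology of `C_r ⊕ C_r'†` consists of the two resolved objects. -/
lemma isIso_of_acyclic_sumDag {X Y : A} (r : ProjRes X) (r' : ProjRes Y)
    (h : (r.sumDag r').obj.Acyclic) : IsIso r.f ∧ IsIso r'.f := by
  have := r.mono_f
  have := r'.mono_f
  have := r.projQ
  have := r'.projQ
  have w₁ : sumDagD₁ r r' ≫ sumDagD₀ r r' = 0 := by simp [sumDagD₁, sumDagD₀]
  have w₀ : sumDagD₀ r r' ≫ sumDagD₁ r r' = 0 := by simp [sumDagD₁, sumDagD₀]
  have x₀ : (ShortComplex.mk (sumDagD₁ r r') (sumDagD₀ r r') w₁).Exact := by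
    have := ((r.sumDag r').obj.exactAt_iff' (1 : ZMod 2) (0 : ZMod 2) (1 : ZMod 2)
      (ComplexShape.prev_eq' _ rfl) (ComplexShape.next_eq' _ rfl)).1 (h 0)
    refine ShortComplex.exact_of_iso (ShortComplex.isoMk
      (S₁ := (r.sumDag r').obj.sc' 1 0 1)
      (S₂ := ShortComplex.mk (sumDagD₁ r r') (sumDagD₀ r r') w₁)
      (Iso.refl (r'.Q ⊞ r.P)) (Iso.refl (r'.P ⊞ r.Q)) (Iso.refl (r'.Q ⊞ r.P)) ?_ ?_) this
    · exact (Category.id_comp _).trans ((sumDag_d₁ r r').symm.trans (Category.comp_id _).symm)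
    · exact (Category.id_comp _).trans ((sumDag_d₀ r r').symm.trans (Category.comp_id _).symm)
  have x₁ : (ShortComplex.mk (sumDagD₀ r r') (sumDagD₁ r r') w₀).Exact := by
    have := ((r.sumDag r').obj.exactAt_iff' (0 : ZMod 2) (1 : ZMod 2) (0 : ZMod 2)
      (ComplexShape.prev_eq' _ rfl) (ComplexShape.next_eq' _ rfl)).1 (h 1)
    refine ShortComplex.exact_of_iso (ShortComplex.isoMk
      (S₁ := (r.sumDag r').obj.sc' 0 1 0)
      (S₂ := ShortComplex.mk (sumDagD₀ r r') (sumDagD₁ r r') w₀)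
      (Iso.refl (r'.P ⊞ r.Q)) (Iso.refl (r'.Q ⊞ r.P)) (Iso.refl (r'.P ⊞ r.Q)) ?_ ?_) this
    · exact (Category.id_comp _).trans ((sumDag_d₀ r r').symm.trans (Category.comp_id _).symm)
    · exact (Category.id_comp _).trans ((sumDag_d₁ r r').symm.trans (Category.comp_id _).symm)
  -- Exactness lifts the inclusion of `r.Q`, respectively `r'.Q`, which splits `r.f` and `r'.f`.
  constructor
  · have hl := x₀.liftFromProjective_comp (biprod.inr : r.Q ⟶ r'.P ⊞ r.Q) (by simp [sumDagD₀])
    set l := x₀.liftFromProjective (biprod.inr : r.Q ⟶ r'.P ⊞ r.Q) (by simp [sumDagD₀])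
    have h₁ : (l ≫ biprod.snd) ≫ r.f = 𝟙 _ := by
      have := hl =≫ biprod.snd
      simpa [sumDagD₁] using this
    have : IsSplitEpi r.f := ⟨⟨⟨_, h₁⟩⟩⟩
    exact isIso_of_mono_of_isSplitEpi r.f
  · have hl := x₁.liftFromProjective_comp (biprod.inl : r'.Q ⟶ r'.Q ⊞ r.P) (by simp [sumDagD₁])
    set l := x₁.liftFromProjective (biprod.inl : r'.Q ⟶ r'.Q ⊞ r.P) (by simp [sumDagD₁])
    have h₁ : (-(l ≫ biprod.fst)) ≫ r'.f = 𝟙 _ := by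
      have := hl =≫ biprod.fst
      simpa [sumDagD₀] using this
    have : IsSplitEpi r'.f := ⟨⟨⟨_, h₁⟩⟩⟩
    exact isIso_of_mono_of_isSplitEpi r'.f

/-- The part `r` of the decomposition is determined up to isomorphism of the resolved object, and
its terms are determined in the Grothendieck group. -/
lemma sumDag_iso_left {X Y X₂ Y₂ : A} {r : ProjRes X} {r' : ProjRes Y} {s : ProjRes X₂}
    {s' : ProjRes Y₂} (φ : (r.sumDag r').obj ≅ (s.sumDag s').obj) :
    Nonempty (X ≅ X₂) ∧ cl r.P = cl s.P := by
  have key {X Y X₂ Y₂ : A} (r : ProjRes X) (r' : ProjRes Y) (s : ProjRes X₂)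
      (s' : ProjRes Y₂) (φ : (r.sumDag r').obj ⟶ (s.sumDag s').obj) :
      ∃ (a : r.Q ⟶ s.Q) (p : r.P ⟶ s.P),
        biprod.inr ≫ (φ.f 0 : r'.P ⊞ r.Q ⟶ s'.P ⊞ s.Q) = a ≫ biprod.inr ∧ r.f ≫ a = p ≫ s.f := by
    have := s'.mono_f
    let φ₀ : r'.P ⊞ r.Q ⟶ s'.P ⊞ s.Q := φ.f 0
    let φ₁ : r'.Q ⊞ r.P ⟶ s'.Q ⊞ s.P := φ.f 1
    have h₁ : φ₁ ≫ sumDagD₁ s s' = sumDagD₁ r r' ≫ φ₀ :=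
      (congrArg (φ₁ ≫ ·) (sumDag_d₁ s s').symm).trans ((φ.comm 1 0).trans
        (congrArg (· ≫ φ₀) (sumDag_d₁ r r')))
    have h₀ : φ₀ ≫ sumDagD₀ s s' = sumDagD₀ r r' ≫ φ₁ :=
      (congrArg (φ₀ ≫ ·) (sumDag_d₀ s s').symm).trans ((φ.comm 0 1).trans
        (congrArg (· ≫ φ₁) (sumDag_d₀ r r')))
    have h₂ : (biprod.inr ≫ φ₀ ≫ biprod.fst) ≫ s'.f = 0 := by
      have := (biprod.inr ≫= h₀) =≫ biprod.fst
      simpa [sumDagD₀] using this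
    have h₃ := zero_of_comp_mono s'.f h₂
    have h₄ : biprod.inr ≫ φ₀ = (biprod.inr ≫ φ₀ ≫ biprod.snd) ≫ biprod.inr := by
      apply biprod.hom_ext <;> simp [h₃]
    refine ⟨biprod.inr ≫ φ₀ ≫ biprod.snd, biprod.inr ≫ φ₁ ≫ biprod.snd, h₄, ?_⟩
    have := (biprod.inr ≫= h₁) =≫ biprod.snd
    simpa [sumDagD₁] using this.symm
  obtain ⟨a, p, ha, hp⟩ := key r r' s s' φ.hom
  obtain ⟨b, q, hb, hq⟩ := key s s' r r' φ.inv
  have comp {P P' Q Q' : A} {x : P ⊞ Q ⟶ P' ⊞ Q'} {y : P' ⊞ Q' ⟶ P ⊞ Q} {a : Q ⟶ Q'} {b : Q' ⟶ Q}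
      (hx : biprod.inr ≫ x = a ≫ biprod.inr) (hy : biprod.inr ≫ y = b ≫ biprod.inr)
      (hxy : x ≫ y = 𝟙 _) : a ≫ b = 𝟙 _ := by
    have := biprod.inr ≫= hxy
    rw [← Category.assoc, hx, Category.assoc, hy, Category.comp_id] at this
    simpa using this =≫ biprod.snd
  have hab : a ≫ b = 𝟙 _ := comp ha hb (HomologicalComplex.congr_hom φ.hom_inv_id 0)
  have hba : b ≫ a = 𝟙 _ := comp hb ha (HomologicalComplex.congr_hom φ.inv_hom_id 0)
  have := r.epi_g
  have := s.epi_g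
  have w₁ : r.f ≫ a ≫ s.g = 0 := by rw [← Category.assoc, hp, Category.assoc, s.w, comp_zero]
  have w₂ : s.f ≫ b ≫ r.g = 0 := by rw [← Category.assoc, hq, Category.assoc, r.w, comp_zero]
  have e₁ : r.g ≫ r.shortExact.exact.desc (a ≫ s.g) w₁ = a ≫ s.g := r.shortExact.exact.g_desc _ _
  have e₂ : s.g ≫ s.shortExact.exact.desc (b ≫ r.g) w₂ = b ≫ r.g := s.shortExact.exact.g_desc _ _
  let i : X ≅ X₂ :=
    { hom := r.shortExact.exact.desc (a ≫ s.g) w₁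
      inv := s.shortExact.exact.desc (b ≫ r.g) w₂
      hom_inv_id := by
        rw [← cancel_epi r.g, ← Category.assoc, e₁, Category.assoc, e₂, ← Category.assoc, hab]
        simp
      inv_hom_id := by
        rw [← cancel_epi s.g, ← Category.assoc, e₂, Category.assoc, e₁, ← Category.assoc, hba]
        simp }
  refine ⟨⟨i⟩, ?_⟩
  have h₃ : cl r.Q = cl s.Q := cl_congr ⟨a, b, hab, hba⟩
  have h₄ := r.cl_eq
  rw [cl_congr i, s.cl_eq, h₃] at h₄
  exact (sub_right_injective h₄).symm

/-- Shifting exchanges the two parts of a decomposition. -/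
lemma dag_sumDag {X Y : A} (r : ProjRes X) (r' : ProjRes Y) :
    Nonempty (dag (r.sumDag r').obj ≅ (r'.sumDag r).obj) := by
  have : dagCocycle (0 : Cocycle r.cplx.obj r'.cplx.dag.obj) = 0 := by
    apply Subtype.ext; funext i j; exact neg_zero
  have i := dagTwist (0 : Cocycle r.cplx.obj r'.cplx.dag.obj)
  rw [this] at i
  exact ⟨i ≪≫ twistZeroSwap _ _ ≪≫ twistZeroCongr (dagDag r'.cplx.obj) (Iso.refl _)⟩

/-- The analogue of `sumDag_iso_left` for the shifted part. -/
lemma sumDag_iso_right {X Y X₂ Y₂ : A} {r : ProjRes X} {r' : ProjRes Y} {s : ProjRes X₂}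
    {s' : ProjRes Y₂} (φ : (r.sumDag r').obj ≅ (s.sumDag s').obj) :
    Nonempty (Y ≅ Y₂) ∧ cl r'.P = cl s'.P := by
  obtain ⟨i⟩ := dag_sumDag r r'
  obtain ⟨j⟩ := dag_sumDag s s'
  exact sumDag_iso_left (i.symm ≪≫ dagIso φ ≪≫ j)

lemma ProjRes.isDisk_cplx {X : A} (r : ProjRes X) (h : IsIso r.f) : IsDisk r.cplx.obj :=
  ⟨h, rfl⟩

/-- The resolution obtained by adding a contractible complex. -/
def ProjRes.addDisk {X P : A} (r : ProjRes X) (hP : Projective P) : ProjRes X :=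
  ((ProjRes.zero hP).extend r 0).ofIso
    (asIso (pushInl (ProjRes.zero hP) ((0 : P ⟶ r.Q) ≫ r.g))).symm

lemma ProjRes.addDisk_iso {X P : A} (r : ProjRes X) (hP : Projective P) :
    Nonempty (((ProjCplx.K hP).sum r.cplx).obj ≅ (r.addDisk hP).cplx.obj) :=
  twistExtend_zero (ProjRes.zero hP) r

lemma ProjRes.cl_addDisk {X P : A} (r : ProjRes X) (hP : Projective P) :
    cl (r.addDisk hP).P = cl r.P + cl P := cl_biprod r.P P

end Decomposition

/-! ### Spanning sets of the localized Hall algebra -/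

section Spanning

variable (k : Type w) [Field k] [Finite k] {A : Type u} [Category.{v} A] [Abelian A] [Linear k A]
  [EnoughProjectives A] [∀ X Y : A, Finite (X ⟶ Y)] [∀ X : A, HasProjectiveDimensionLE X 1]

lemma HTwC.disk_mul_dag_disk {K L : ProjCplx A} (hK : IsDisk K.obj) (hL : IsDisk L.obj) :
    HTwC.of k K * HTwC.of k L.dag = HTwC.of k (K.sum L.dag) := by
  rw [HTwC.disk_mul k hK, ProjCplx.hat_dag, ProjCplx.hat, hL.cl_eq, sub_self, neg_zero, map_zero,
    zpow_zero, one_smul]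

/-- A sum of two contractible parts is isomorphic to `K_P ⊕ K_Q†`, whose class is a product. -/
lemma HTwC.of_sumDag_of_isIso {X Y : A} (r : ProjRes X) (r' : ProjRes Y) (h : IsIso r.f)
    (h' : IsIso r'.f) : HTwC.of k (r.sumDag r') =
      HTwC.of k (ProjCplx.K r.projP) * HTwC.of k (ProjCplx.K r'.projP).dag := by
  obtain ⟨i⟩ := (r.isDisk_cplx h).nonempty_iso (ProjCplx.isDisk_K r.projP) (Iso.refl r.P)
  obtain ⟨i'⟩ := (r'.isDisk_cplx h').nonempty_iso (ProjCplx.isDisk_K r'.projP) (Iso.refl r'.P)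
  rw [← HTwC.of_congr k i,
    ← HTwC.of_congr k (M := r'.cplx.dag) (N := (ProjCplx.K r'.projP).dag) (dagIso i'),
    HTwC.disk_mul_dag_disk k (r.isDisk_cplx h) (r'.isDisk_cplx h')]
  rfl

lemma HTwC.of_acyclic (M : ProjCplx A) (hM : M.obj.Acyclic) :
    ∃ (P Q : A) (hP : Projective P) (hQ : Projective Q),
      HTwC.of k M = HTwC.of k (ProjCplx.K hP) * HTwC.of k (ProjCplx.K hQ).dag := by
  obtain ⟨X, Y, r, r', ⟨e⟩⟩ := M.exists_iso_sumDag
  obtain ⟨h, h'⟩ := isIso_of_acyclic_sumDag r r' fun i => (hM i).of_iso e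
  exact ⟨r.P, r'.P, r.projP, r'.projP,
    (HTwC.of_congr k e).trans (HTwC.of_sumDag_of_isIso k r r' h h')⟩

lemma DH.of_acyclic (M : ProjCplx A) (hM : M.obj.Acyclic) :
    ∃ α β : K₀ A, DH.of k M = DH.K k α * DH.KDag k β := by
  obtain ⟨P, Q, hP, hQ, h⟩ := HTwC.of_acyclic k M hM
  refine ⟨cl P, cl Q, ?_⟩
  have := congrArg (DH.fromH k) h
  rwa [map_mul, DH.fromH_of, DH.fromH_of, DH.fromH_of, ← DH.K_cl, ← DH.KDag_cl] at this

lemma DH.inv_acyclic (M : ProjCplx A) (hM : M.obj.Acyclic) :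
    ∃ α β : K₀ A, DH.inv k M hM = DH.K k α * DH.KDag k β := by
  obtain ⟨α, β, h⟩ := DH.of_acyclic k M hM
  refine ⟨-α, -β, left_inv_eq_right_inv (DH.inv_mul_of M hM) ?_⟩
  rw [h, mul_assoc, ← mul_assoc (DH.KDag k β), ← DH.K_comm_KDag, mul_assoc, DH.KDag_mul_neg,
    mul_one, DH.K_mul_neg]

/-- The products `[M] * K_α * K_β†` span the localized Hall algebra. -/
lemma DH.span_of_mul_eq_top : Submodule.span ℂ
    (Set.range fun p : ProjCplx A × K₀ A × K₀ A =>
      DH.of k p.1 * (DH.K k p.2.1 * DH.KDag k p.2.2)) = ⊤ := by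
  have hmem (x : HTwC k A) (α β : K₀ A) : DH.fromH k x * (DH.K k α * DH.KDag k β) ∈
      Submodule.span ℂ (Set.range fun p : ProjCplx A × K₀ A × K₀ A =>
        DH.of k p.1 * (DH.K k p.2.1 * DH.KDag k p.2.2)) := by
    refine HTwC.induction k (p := fun x => DH.fromH k x * (DH.K k α * DH.KDag k β) ∈
      Submodule.span ℂ (Set.range fun p : ProjCplx A × K₀ A × K₀ A =>
        DH.of k p.1 * (DH.K k p.2.1 * DH.KDag k p.2.2))) ?_ ?_ ?_ ?_ x
    · rw [map_zero, zero_mul]; exact Submodule.zero_mem _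
    · intro a b ha hb
      rw [map_add, add_mul]
      exact Submodule.add_mem _ ha hb
    · intro c a ha
      rw [map_smul, smul_mul_assoc]
      exact Submodule.smul_mem _ c ha
    · intro M
      exact Submodule.subset_span ⟨(M, α, β), rfl⟩
  refine DH.eq_top_of_mul_mem _ ?_ ?_ ?_
  · have := hmem 1 0 0
    rwa [map_one, DH.K_zero, DH.KDag_zero, one_mul, one_mul] at this
  · intro M x hx
    induction hx using Submodule.span_induction with
    | mem x hx =>
      obtain ⟨⟨N, α, β⟩, rfl⟩ := hx
      have := hmem (HTwC.of k M * HTwC.of k N) α β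
      rwa [map_mul, mul_assoc] at this
    | zero => rw [mul_zero]; exact Submodule.zero_mem _
    | add x y _ _ hx hy => rw [mul_add]; exact Submodule.add_mem _ hx hy
    | smul c x _ hx => rw [mul_smul_comm]; exact Submodule.smul_mem _ c hx
  · intro M hM x hx
    obtain ⟨γ, δ, h⟩ := DH.inv_acyclic k M hM
    rw [h]
    induction hx using Submodule.span_induction with
    | mem x hx =>
      obtain ⟨⟨N, α, β⟩, rfl⟩ := hx
      have h₁ : DH.K k γ * DH.KDag k δ * (DH.of k N * (DH.K k α * DH.KDag k β)) =
          (tPar k ^ symEuler k A γ N.hat * tPar k ^ (-symEuler k A δ N.hat)) •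
            (DH.of k N * (DH.K k (γ + α) * DH.KDag k (δ + β))) := by
        have h₂ : DH.K k γ * DH.KDag k δ * (DH.K k α * DH.KDag k β) =
            DH.K k γ * DH.K k α * (DH.KDag k δ * DH.KDag k β) := by
          rw [mul_assoc, ← mul_assoc (DH.KDag k δ), ← DH.K_comm_KDag]
          simp only [mul_assoc]
        rw [DH.K_add, DH.KDag_add, ← h₂, mul_assoc, ← mul_assoc (DH.KDag k δ), DH.KDag_comm_of,
          smul_mul_assoc, mul_smul_comm, mul_assoc (DH.of k N), ← mul_assoc (DH.K k γ),
          DH.K_comm_of, smul_mul_assoc, smul_smul, mul_comm (tPar k ^ _)]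
        simp only [mul_assoc]
      change DH.K k γ * DH.KDag k δ * (DH.of k N * (DH.K k α * DH.KDag k β)) ∈ _
      rw [h₁]
      exact Submodule.smul_mem _ _ (hmem (HTwC.of k N) _ _)
    | zero => rw [mul_zero]; exact Submodule.zero_mem _
    | add x y _ _ hx hy => rw [mul_add]; exact Submodule.add_mem _ hx hy
    | smul c x _ hx => rw [mul_smul_comm]; exact Submodule.smul_mem _ c hx

variable (A) in
/-- The elements `E_X * K_α * K_β† * F_Y` of the localized Hall algebra. -/
def DH.triangular (p : IsoCl A × K₀ A × K₀ A × IsoCl A) : DH k A :=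
  DH.E k p.1.out * (DH.K k p.2.1 * DH.KDag k p.2.2.1) * DH.F k p.2.2.2.out

lemma DH.F_congr {X Y : A} (e : X ≅ Y) : DH.F k X = DH.F k Y := by
  rw [DH.F, DH.F, DH.E_congr k e]

lemma DH.triangular_isoCl (X Y : A) (α β : K₀ A) :
    DH.triangular k A (isoCl X, α, β, isoCl Y) =
      DH.E k X * (DH.K k α * DH.KDag k β) * DH.F k Y := by
  rw [← DH.E_congr k (outIso X), ← DH.F_congr k (outIso Y)]
  rfl

lemma DH.F_comm_K (X : A) (α : K₀ A) :
    DH.F k X * DH.K k α = tPar k ^ symEuler k A α (cl X) • (DH.K k α * DH.F k X) := by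
  rw [DH.K_comm_F, smul_smul, ← tPar_zpow_add, add_neg_cancel, zpow_zero, one_smul]

lemma DH.F_comm_KDag (X : A) (α : K₀ A) :
    DH.F k X * DH.KDag k α = tPar k ^ (-symEuler k A α (cl X)) • (DH.KDag k α * DH.F k X) := by
  rw [DH.KDag_comm_F, smul_smul, ← tPar_zpow_add, neg_add_cancel, zpow_zero, one_smul]

/-- Up to a unit, the products of the classes of the two parts of a decomposition are the elements
of `DH.triangular`. -/
lemma DH.of_cplx_mul_of_cplx_dag {X Y : A} (r : ProjRes X) (r' : ProjRes Y) :
    ∃ c : ℂ, c ≠ 0 ∧ DH.of k r.cplx * DH.of k r'.cplx.dag =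
      c • DH.triangular k A (isoCl X, cl r.P, cl r'.P, isoCl Y) := by
  refine ⟨tPar k ^ (-eulerK k A (cl r.P) (cl X)) * tPar k ^ (-eulerK k A (cl r'.P) (cl Y)) *
    tPar k ^ symEuler k A (cl r.P) (cl X), mul_ne_zero (mul_ne_zero (tPar_zpow_ne_zero k _)
      (tPar_zpow_ne_zero k _)) (tPar_zpow_ne_zero k _), ?_⟩
  rw [r.of_cplx k, r'.of_cplx_dag k, DH.K_comm_E, DH.triangular_isoCl, smul_mul_smul_comm,
    smul_mul_assoc, smul_smul]
  simp only [mul_assoc]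

lemma ProjCplx.endCard_congr {M N : ProjCplx A} (e : M.obj ≅ N.obj) : M.endCard = N.endCard :=
  Nat.card_congr (e.homCongr e)

/-- The products `E_X * K_α * K_β† * F_Y` span the localized Hall algebra. -/
lemma DH.span_triangular_eq_top : Submodule.span ℂ (Set.range (DH.triangular k A)) = ⊤ := by
  -- The class of `C_r ⊕ C_r'†` is the leading term of `[C_r] * [C_r'†]`.
  have hof (n : ℕ) : ∀ M : ProjCplx A, M.endCard = n →
      DH.of k M ∈ Submodule.span ℂ (Set.range (DH.triangular k A)) := by
    induction n using Nat.strong_induction_on with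
    | _ n ih =>
    intro M hM
    obtain ⟨X, Y, r, r', ⟨e⟩⟩ := M.exists_iso_sumDag
    obtain ⟨c, hc, h⟩ := HTwC.of_mul_of_sub_mem k r.cplx r'.cplx.dag
    obtain ⟨c', -, h'⟩ := DH.of_cplx_mul_of_cplx_dag k r r'
    have h₁ : (Submodule.span ℂ (HTwC.of k '' {L | L.endCard < (r.sumDag r').endCard})) ≤
        (Submodule.span ℂ (Set.range (DH.triangular k A))).comap (DH.fromH k).toLinearMap := by
      rw [Submodule.span_le]
      rintro _ ⟨L, hL, rfl⟩
      refine ih L.endCard ?_ L rfl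
      rw [← hM, ProjCplx.endCard_congr e]
      exact hL
    have h₂ : DH.fromH k (HTwC.of k r.cplx * HTwC.of k r'.cplx.dag -
        c • HTwC.of k (r.cplx.sum r'.cplx.dag)) ∈
        Submodule.span ℂ (Set.range (DH.triangular k A)) := h₁ h
    rw [map_sub, map_mul, map_smul, DH.fromH_of, DH.fromH_of, DH.fromH_of, h'] at h₂
    have h₃ := Submodule.sub_mem _ (Submodule.smul_mem _ c'
      (Submodule.subset_span (Set.mem_range_self (f := DH.triangular k A)
        (isoCl X, cl r.P, cl r'.P, isoCl Y)))) h₂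
    rw [sub_sub_cancel] at h₃
    have h₄ := Submodule.smul_mem _ c⁻¹ h₃
    rw [smul_smul, inv_mul_cancel₀ hc, one_smul] at h₄
    rw [DH.of_congr k e]
    exact h₄
  rw [eq_top_iff, ← DH.span_of_mul_eq_top k, Submodule.span_le]
  rintro _ ⟨⟨M, γ, δ⟩, rfl⟩
  change DH.of k M * (DH.K k γ * DH.KDag k δ) ∈ Submodule.span ℂ (Set.range (DH.triangular k A))
  have hM := hof _ M rfl
  generalize DH.of k M = x at hM
  induction hM using Submodule.span_induction with
  | mem x hx =>
    obtain ⟨⟨X, α, β, Y⟩, rfl⟩ := hx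
    have h₁ : DH.triangular k A (X, α, β, Y) * (DH.K k γ * DH.KDag k δ) =
        (tPar k ^ symEuler k A γ (cl Y.out) * tPar k ^ (-symEuler k A δ (cl Y.out))) •
          DH.triangular k A (X, α + γ, β + δ, Y) := by
      change DH.E k X.out * (DH.K k α * DH.KDag k β) * DH.F k Y.out * (DH.K k γ * DH.KDag k δ) =
        _ • (DH.E k X.out * (DH.K k (α + γ) * DH.KDag k (β + δ)) * DH.F k Y.out)
      rw [mul_assoc _ (DH.F k Y.out), ← mul_assoc (DH.F k Y.out), DH.F_comm_K, smul_mul_assoc,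
        mul_assoc (DH.K k γ), DH.F_comm_KDag, mul_smul_comm, mul_smul_comm, mul_smul_comm,
        smul_smul, DH.K_add,
        DH.KDag_add]
      congr 1
      have h₂ : DH.K k α * DH.KDag k β * (DH.K k γ * DH.KDag k δ) =
          DH.K k α * DH.K k γ * (DH.KDag k β * DH.KDag k δ) := by
        rw [mul_assoc, ← mul_assoc (DH.KDag k β), ← DH.K_comm_KDag]
        simp only [mul_assoc]
      rw [← h₂]
      simp only [mul_assoc]
    rw [h₁]
    exact Submodule.smul_mem _ _ (Submodule.subset_span (Set.mem_range_self _))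
  | zero => rw [zero_mul]; exact Submodule.zero_mem _
  | add x y _ _ hx hy => rw [add_mul]; exact Submodule.add_mem _ hx hy
  | smul c x _ hx => rw [smul_mul_assoc]; exact Submodule.smul_mem _ c hx

end Spanning

/-! ### Localization at normal elements -/

section Normal

variable (R : Type*) [Ring R]

/-- The elements `s` of a ring with `s R ⊆ R s` such that `x s = 0` implies `s x = 0`. -/
def normalElements : Submonoid R where
  carrier := {s | (∀ x, ∃ y, s * x = y * s) ∧ ∀ x, x * s = 0 → s * x = 0}
  one_mem' := ⟨fun x => ⟨x, by rw [one_mul, mul_one]⟩, fun x h => by rwa [one_mul, ← mul_one x]⟩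
  mul_mem' := by
    rintro s t ⟨hs, hs'⟩ ⟨ht, ht'⟩
    refine ⟨fun x => ?_, fun x h => ?_⟩
    · obtain ⟨y, hy⟩ := ht x
      obtain ⟨z, hz⟩ := hs y
      exact ⟨z, by rw [mul_assoc, hy, ← mul_assoc, hz, mul_assoc]⟩
    · rw [← mul_assoc] at h
      rw [mul_assoc]
      exact hs' _ (by rw [mul_assoc]; exact ht' _ h)

variable {R}

/-- A submonoid of normal elements satisfies the Ore condition. -/
abbrev oreSetOfNormal {S : Submonoid R} (hS : S ≤ normalElements R) : OreLocalization.OreSet S where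
  ore_right_cancel r₁ r₂ s h := ⟨s, sub_eq_zero.1 (by
    rw [← mul_sub]
    exact (hS s.2).2 _ (by rw [sub_mul, h, sub_self]))⟩
  oreNum r s := ((hS s.2).1 r).choose
  oreDenom _ s := s
  ore_eq r s := ((hS s.2).1 r).choose_spec

end Normal

section LinearIndependence

variable (k : Type w) [Field k] {A : Type u} [Category.{v} A] [Abelian A] [Linear k A]

variable [Finite k] [EnoughProjectives A] [∀ X Y : A, Finite (X ⟶ Y)]
  [∀ X : A, HasProjectiveDimensionLE X 1]

/-- The coefficient of `[M]`. -/
def HTwC.coeff (M : ProjCplx A) : HTwC k A →ₗ[ℂ] ℂ := Finsupp.lapply (isoCl M)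

lemma HTwC.coeff_of_self (M : ProjCplx A) : HTwC.coeff k M (HTwC.of k M) = 1 :=
  Finsupp.single_eq_same

lemma HTwC.coeff_of_of_not_iso {M N : ProjCplx A} (h : ¬ Nonempty (N.obj ≅ M.obj)) :
    HTwC.coeff k M (HTwC.of k N) = 0 :=
  Finsupp.single_eq_of_ne fun h' => h (ProjCplx.isoCl_eq_iff.1 h'.symm)

/-- Elements with pairwise distinct leading terms, with respect to the order of the endomorphism
ring, are linearly independent. -/
lemma HTwC.eq_zero_of_sum_smul_eq_zero {ι : Type*} (s : Finset ι) (L : ι → ProjCplx A)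
    (hL : ∀ i ∈ s, ∀ j ∈ s, Nonempty ((L i).obj ≅ (L j).obj) → i = j) (x : ι → HTwC k A)
    (hx : ∀ i ∈ s, ∃ c : ℂ, c ≠ 0 ∧ x i - c • HTwC.of k (L i) ∈
      Submodule.span ℂ (HTwC.of k '' {N | N.endCard < (L i).endCard}))
    (a : ι → ℂ) (h : ∑ i ∈ s, a i • x i = 0) : ∀ i ∈ s, a i = 0 := by
  classical
  by_contra! hne
  obtain ⟨i₀, hi₀, hai₀⟩ := hne
  -- The leading term of largest order among those which occur cannot cancel.
  obtain ⟨i, hi, hmax⟩ := (s.filter (a · ≠ 0)).exists_max_image (fun i => (L i).endCard)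
    ⟨i₀, Finset.mem_filter.2 ⟨hi₀, hai₀⟩⟩
  obtain ⟨his, hai⟩ := Finset.mem_filter.1 hi
  have hlow (j : ι) (hj : j ∈ s) (haj : a j ≠ 0) (y : HTwC k A)
      (hy : y ∈ Submodule.span ℂ (HTwC.of k '' {N | N.endCard < (L j).endCard})) :
      HTwC.coeff k (L i) y = 0 := by
    refine (Submodule.span_le (p := LinearMap.ker (HTwC.coeff k (L i)))).2 ?_ hy
    rintro _ ⟨N, hN, rfl⟩
    refine HTwC.coeff_of_of_not_iso k fun ⟨e⟩ => ?_
    have h₁ : N.endCard < (L j).endCard := hN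
    have h₂ : (L j).endCard ≤ (L i).endCard := hmax j (Finset.mem_filter.2 ⟨hj, haj⟩)
    rw [ProjCplx.endCard_congr e] at h₁
    omega
  have h₁ := congrArg (HTwC.coeff k (L i)) h
  rw [map_sum, map_zero, Finset.sum_eq_single i] at h₁
  · obtain ⟨c, hc, hxi⟩ := hx i his
    have h₂ := hlow i his hai _ hxi
    rw [map_sub, map_smul, HTwC.coeff_of_self, sub_eq_zero] at h₂
    rw [map_smul, h₂, smul_eq_mul, smul_eq_mul, mul_one] at h₁
    exact (mul_ne_zero hai hc) h₁
  · intro j hj hji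
    by_cases haj : a j = 0
    · rw [haj, zero_smul, map_zero]
    obtain ⟨c, hc, hxj⟩ := hx j hj
    have h₂ := hlow j hj haj _ hxj
    rw [map_sub, map_smul, HTwC.coeff_of_of_not_iso k fun e => hji (hL j hj i his e), smul_zero,
      sub_zero] at h₂
    rw [map_smul, h₂, smul_zero]
  · exact fun h => absurd his h

/-- The endomorphism multiplying `[M]` by `t ^ n`, where `n` depends on the class
`[M₀] - [M₁]` only. -/
def HTwC.scale (n : K₀ A → ℤ) : HTwC k A →ₗ[ℂ] HTwC k A :=
  Finsupp.lsum ℂ fun m => LinearMap.toSpanSingleton ℂ _ (tPar k ^ n m.out.hat • HTwC.of k m.out)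

lemma HTwC.scale_of (n : K₀ A → ℤ) (M : ProjCplx A) :
    HTwC.scale k n (HTwC.of k M) = tPar k ^ n M.hat • HTwC.of k M := by
  obtain ⟨e⟩ := ProjCplx.isoCl_eq_iff.1 (isoCl_out (isoCl M))
  refine (Finsupp.lsum_single ..).trans ?_
  rw [LinearMap.toSpanSingleton_apply, one_smul, ProjCplx.hat_congr e, HTwC.of_congr k e]

/-- A criterion for normality in the twisted Hall algebra of complexes. -/
lemma HTwC.mem_normalElements (s : HTwC k A) (n : K₀ A → ℤ) (σ : ProjCplx A → ProjCplx A)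
    (hσ : ∀ M, (σ M).hat = M.hat)
    (h₁ : ∀ M, s * HTwC.of k M = tPar k ^ n M.hat • (HTwC.of k M * s))
    (h₂ : ∀ M, ∃ c : ℂ, s * HTwC.of k M = c • HTwC.of k (σ M)) :
    s ∈ normalElements (HTwC k A) := by
  have h₃ (M : ProjCplx A) : s * HTwC.of k M = HTwC.scale k n (HTwC.of k M * s) := by
    obtain ⟨c, hc⟩ := h₂ M
    have h := h₁ M
    rw [hc, ← inv_smul_eq_iff₀ (tPar_zpow_ne_zero k _)] at h
    rw [← h, map_smul, map_smul, HTwC.scale_of, hσ, hc, smul_comm c,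
      inv_smul_smul₀ (tPar_zpow_ne_zero k _)]
  have h₄ (x : HTwC k A) : s * x = HTwC.scale k n (x * s) := by
    refine HTwC.induction k (p := fun x => s * x = HTwC.scale k n (x * s)) ?_ ?_ ?_ h₃ x
    · rw [mul_zero, zero_mul, map_zero]
    · intro a b ha hb; rw [mul_add, add_mul, map_add, ha, hb]
    · intro c a ha; rw [mul_smul_comm, smul_mul_assoc, map_smul, ha]
  refine ⟨fun x => ?_, fun x hx => by rw [h₄, hx, map_zero]⟩
  refine HTwC.induction k (p := fun x => ∃ y, s * x = y * s) ?_ ?_ ?_ ?_ x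
  · exact ⟨0, by rw [mul_zero, zero_mul]⟩
  · rintro a b ⟨a', ha⟩ ⟨b', hb⟩
    exact ⟨a' + b', by rw [mul_add, add_mul, ha, hb]⟩
  · rintro c a ⟨a', ha⟩
    exact ⟨c • a', by rw [mul_smul_comm, smul_mul_assoc, ha]⟩
  · intro M
    exact ⟨tPar k ^ n M.hat • HTwC.of k M, by rw [h₁, smul_mul_assoc]⟩

variable (A) in
/-- The submonoid generated by the classes `[K_P]` and `[K_P†]`. -/
def HTwC.diskMonoid : Submonoid (HTwC k A) :=
  Submonoid.closure ({x | ∃ (P : A) (hP : Projective P), x = HTwC.of k (ProjCplx.K hP)} ∪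
    {x | ∃ (P : A) (hP : Projective P), x = HTwC.of k (ProjCplx.K hP).dag})

lemma HTwC.of_K_mem {P : A} (hP : Projective P) :
    HTwC.of k (ProjCplx.K hP) ∈ HTwC.diskMonoid k A :=
  Submonoid.subset_closure (Or.inl ⟨P, hP, rfl⟩)

lemma HTwC.of_K_dag_mem {P : A} (hP : Projective P) :
    HTwC.of k (ProjCplx.K hP).dag ∈ HTwC.diskMonoid k A :=
  Submonoid.subset_closure (Or.inr ⟨P, hP, rfl⟩)

lemma HTwC.diskMonoid_le : HTwC.diskMonoid k A ≤ normalElements (HTwC k A) := by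
  refine (Submonoid.closure_le).2 ?_
  rintro _ (⟨P, hP, rfl⟩ | ⟨P, hP, rfl⟩)
  · refine HTwC.mem_normalElements k _ (fun γ => symEuler k A (cl P) γ)
      (fun M => (ProjCplx.K hP).sum M) (fun M => ?_)
      (HTwC.disk_comm k (ProjCplx.isDisk_K hP))
      (fun M => ⟨_, HTwC.disk_mul k (ProjCplx.isDisk_K hP) M⟩)
    rw [ProjCplx.hat_sum, ProjCplx.hat_K, zero_add]
  · refine HTwC.mem_normalElements k _ (fun γ => -symEuler k A (cl P) γ)
      (fun M => (ProjCplx.K hP).dag.sum M) (fun M => ?_)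
      (HTwC.dag_disk_comm k (ProjCplx.isDisk_K hP))
      (fun M => ⟨_, HTwC.dag_disk_mul k (ProjCplx.isDisk_K hP) M⟩)
    rw [ProjCplx.hat_sum, ProjCplx.hat_dag, ProjCplx.hat_K, neg_zero, zero_add]

lemma HTwC.of_mem_diskMonoid {M : ProjCplx A} (hM : M.obj.Acyclic) :
    HTwC.of k M ∈ HTwC.diskMonoid k A := by
  obtain ⟨P, Q, hP, hQ, h⟩ := HTwC.of_acyclic k M hM
  rw [h]
  exact Submonoid.mul_mem _ (HTwC.of_K_mem k hP) (HTwC.of_K_dag_mem k hQ)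

/-- The kernel of the localization map. -/
lemma DH.exists_mul_eq_zero {x : HTwC k A} (hx : DH.fromH k x = 0) :
    ∃ s ∈ HTwC.diskMonoid k A, s * x = 0 := by
  let _ : OreLocalization.OreSet (HTwC.diskMonoid k A) := oreSetOfNormal (HTwC.diskMonoid_le k)
  let φ : HTwC k A →ₐ[ℂ] OreLocalization (HTwC.diskMonoid k A) (HTwC k A) :=
    { (OreLocalization.numeratorRingHom :
        HTwC k A →+* OreLocalization (HTwC.diskMonoid k A) (HTwC k A)) with
      commutes' := fun c => rfl }
  have hu (M : AcyclicCplx A) : IsUnit (φ (HTwC.of k M.1)) :=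
    OreLocalization.numerator_isUnit ⟨_, HTwC.of_mem_diskMonoid k M.2⟩
  have h := DH.lift_fromH φ (fun M => ((hu M).unit⁻¹ : Units _)) (fun M => (hu M).mul_val_inv)
    (fun M => (hu M).val_inv_mul) x
  rw [hx, map_zero] at h
  have h' : x /ₒ (1 : HTwC.diskMonoid k A) = 0 /ₒ 1 := h.symm.trans OreLocalization.zero_def
  obtain ⟨u, v, h₁, h₂⟩ := OreLocalization.oreDiv_eq_iff.1 h'
  refine ⟨u, u.2, ?_⟩
  have hv : (u : HTwC k A) = v := by simpa using h₂
  rw [hv]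
  simpa using h₁.symm

/-- Multiplication by an element generated by the `[K_P]` and `[K_P†]` enlarges the resolutions in
products `[C_r] * [C_r'†]`. -/
lemma HTwC.exists_enlarge {s : HTwC k A} (hs : s ∈ HTwC.diskMonoid k A) :
    ∃ (σ σ' : ∀ X : A, ProjRes X → ProjRes X) (γ γ' : K₀ A),
      (∀ X r, cl (σ X r).P = cl r.P + γ) ∧ (∀ X r, cl (σ' X r).P = cl r.P + γ') ∧
      ∀ (X Y : A) (r : ProjRes X) (r' : ProjRes Y), ∃ c : ℂ, c ≠ 0 ∧
        s * (HTwC.of k r.cplx * HTwC.of k r'.cplx.dag) =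
          c • (HTwC.of k (σ X r).cplx * HTwC.of k (σ' Y r').cplx.dag) := by
  have hK {P X : A} (hP : Projective P) (r : ProjRes X) : ∃ c : ℂ, c ≠ 0 ∧
      HTwC.of k (ProjCplx.K hP) * HTwC.of k r.cplx = c • HTwC.of k (r.addDisk hP).cplx := by
    obtain ⟨e⟩ := r.addDisk_iso hP
    exact ⟨_, tPar_zpow_ne_zero k _, by
      rw [HTwC.disk_mul k (ProjCplx.isDisk_K hP), HTwC.of_congr k e]⟩
  induction hs using Submonoid.closure_induction with
  | mem s hs =>
    rcases hs with ⟨P, hP, rfl⟩ | ⟨P, hP, rfl⟩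
    · refine ⟨fun X r => r.addDisk hP, fun X r => r, cl P, 0, fun X r => r.cl_addDisk hP,
        fun X r => (add_zero _).symm, fun X Y r r' => ?_⟩
      obtain ⟨c, hc, h⟩ := hK hP r
      exact ⟨c, hc, by rw [← mul_assoc, h, smul_mul_assoc]⟩
    · refine ⟨fun X r => r, fun X r => r.addDisk hP, 0, cl P, fun X r => (add_zero _).symm,
        fun X r => r.cl_addDisk hP, fun X Y r r' => ?_⟩
      obtain ⟨c, hc, h⟩ := hK hP r'
      have h' := congrArg (HTwC.dagHom k) h
      rw [map_mul, map_smul, HTwC.dagHom_of, HTwC.dagHom_of, HTwC.dagHom_of] at h'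
      refine ⟨tPar k ^ (-symEuler k A (cl P) r.cplx.hat) * c,
        mul_ne_zero (tPar_zpow_ne_zero k _) hc, ?_⟩
      have hcomm : HTwC.of k (ProjCplx.K hP).dag * HTwC.of k r.cplx =
          tPar k ^ (-symEuler k A (cl P) r.cplx.hat) •
            (HTwC.of k r.cplx * HTwC.of k (ProjCplx.K hP).dag) :=
        HTwC.dag_disk_comm k (ProjCplx.isDisk_K hP) r.cplx
      rw [← mul_assoc, hcomm, smul_mul_assoc, mul_assoc, h',
        mul_smul_comm, smul_smul]
  | one => exact ⟨fun X r => r, fun X r => r, 0, 0, fun X r => (add_zero _).symm,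
      fun X r => (add_zero _).symm, fun X Y r r' => ⟨1, one_ne_zero, by rw [one_mul, one_smul]⟩⟩
  | mul s t _ _ hs ht =>
    obtain ⟨σ, σ', γ, γ', h₁, h₂, h₃⟩ := hs
    obtain ⟨τ, τ', δ, δ', h₄, h₅, h₆⟩ := ht
    refine ⟨fun X r => σ X (τ X r), fun X r => σ' X (τ' X r), δ + γ, δ' + γ', fun X r => ?_,
      fun X r => ?_, fun X Y r r' => ?_⟩
    · rw [h₁, h₄, add_assoc]
    · rw [h₂, h₅, add_assoc]
    · obtain ⟨c, hc, h⟩ := h₆ X Y r r'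
      obtain ⟨d, hd, h'⟩ := h₃ X Y (τ X r) (τ' Y r')
      exact ⟨c * d, mul_ne_zero hc hd, by
        rw [mul_assoc, h, mul_smul_comm, h', smul_smul]⟩

/-- Finitely many classes become effective after adding the class of one projective object, and are
then realised by resolutions. -/
lemma ProjRes.exists_cl_eq {ι : Type*} (s : Finset ι) (X : ι → A) (α : ι → K₀ A) :
    ∃ (γ : K₀ A) (r : ∀ i, ProjRes (X i)), ∀ i ∈ s, cl (r i).P = γ + α i := by
  classical
  suffices h : ∃ (γ : K₀ A), ∀ i ∈ s, ∃ r : ProjRes (X i), cl r.P = γ + α i by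
    obtain ⟨γ, h⟩ := h
    refine ⟨γ, fun i => if hi : i ∈ s then (h i hi).choose else ProjRes.default (X i),
      fun i hi => ?_⟩
    have h' := (h i hi).choose_spec
    rwa [← dif_pos hi (t := fun hi => (h i hi).choose) (e := fun _ => ProjRes.default (X i))] at h'
  suffices h : ∃ (R : A), Projective R ∧ ∀ i ∈ s, ∃ r : ProjRes (X i), cl r.P = cl R + α i by
    obtain ⟨R, -, h⟩ := h
    exact ⟨cl R, h⟩
  induction s using Finset.induction_on with
  | empty => exact ⟨0, inferInstance, by simp⟩
  | insert a s _ ih =>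
    obtain ⟨R, hR, h⟩ := ih
    obtain ⟨U, V, hU, hV, hUV⟩ := K₀.induction_sub (α a - cl (ProjRes.default (X a)).P)
    refine ⟨R ⊞ V, projective_biprod hR hV, fun i hi => ?_⟩
    rw [cl_biprod]
    rcases Finset.mem_insert.1 hi with rfl | hi
    · refine ⟨((ProjRes.default (X i)).addDisk hU).addDisk hR, ?_⟩
      rw [ProjRes.cl_addDisk, ProjRes.cl_addDisk, sub_eq_iff_eq_add.1 hUV]
      abel
    · obtain ⟨r, hr⟩ := h i hi
      exact ⟨r.addDisk hV, by rw [ProjRes.cl_addDisk, hr]; abel⟩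

lemma DH.K_mul_KDag_mul_triangular (γ δ : K₀ A) (p : IsoCl A × K₀ A × K₀ A × IsoCl A) :
    ∃ c : ℂ, c ≠ 0 ∧ DH.K k γ * DH.KDag k δ * DH.triangular k A p =
      c • DH.triangular k A (p.1, γ + p.2.1, δ + p.2.2.1, p.2.2.2) := by
  obtain ⟨X, α, β, Y⟩ := p
  refine ⟨_ * _, mul_ne_zero (tPar_zpow_ne_zero k (-symEuler k A δ (cl X.out)))
    (tPar_zpow_ne_zero k (symEuler k A γ (cl X.out))), ?_⟩
  change DH.K k γ * DH.KDag k δ * (DH.E k X.out * (DH.K k α * DH.KDag k β) * DH.F k Y.out) =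
    _ • (DH.E k X.out * (DH.K k (γ + α) * DH.KDag k (δ + β)) * DH.F k Y.out)
  have h₂ : DH.K k (γ + α) * DH.KDag k (δ + β) =
      DH.K k γ * DH.KDag k δ * (DH.K k α * DH.KDag k β) := by
    rw [DH.K_add, DH.KDag_add, mul_assoc, mul_assoc, ← mul_assoc (DH.KDag k δ),
      ← DH.K_comm_KDag k α δ]
    simp only [mul_assoc]
  have h₁ : DH.K k γ * DH.KDag k δ * DH.E k X.out =
      (tPar k ^ (-symEuler k A δ (cl X.out)) * tPar k ^ (symEuler k A γ (cl X.out))) •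
        (DH.E k X.out * (DH.K k γ * DH.KDag k δ)) := by
    rw [mul_assoc, DH.KDag_comm_E, mul_smul_comm, ← mul_assoc, DH.K_comm_E, smul_mul_assoc,
      smul_smul, mul_assoc]
  rw [← mul_assoc, ← mul_assoc, h₁, h₂]
  simp only [smul_mul_assoc, mul_assoc]

/-- The products `E_X * K_α * K_β† * F_Y` are linearly independent. -/
theorem DH.linearIndependent_triangular : LinearIndependent ℂ (DH.triangular k A) := by
  rw [linearIndependent_iff']
  intro s a hsum
  obtain ⟨γ, r, hr⟩ := ProjRes.exists_cl_eq s (fun p : IsoCl A × K₀ A × K₀ A × IsoCl A => p.1.out)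
    (fun p => p.2.1)
  obtain ⟨δ, r', hr'⟩ := ProjRes.exists_cl_eq s
    (fun p : IsoCl A × K₀ A × K₀ A × IsoCl A => p.2.2.2.out) (fun p => p.2.2.1)
  -- Left multiplication by a suitable `K_γ * K_δ†` brings the relation into the Hall algebra.
  have h₁ (p : IsoCl A × K₀ A × K₀ A × IsoCl A) : ∃ c : ℂ, p ∈ s → c ≠ 0 ∧
      DH.K k γ * DH.KDag k δ * DH.triangular k A p =
        c • DH.fromH k (HTwC.of k (r p).cplx * HTwC.of k (r' p).cplx.dag) := by
    by_cases hp : p ∈ s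
    · obtain ⟨c, hc, h⟩ := DH.K_mul_KDag_mul_triangular k γ δ p
      obtain ⟨d, hd, h'⟩ := DH.of_cplx_mul_of_cplx_dag k (r p) (r' p)
      rw [isoCl_out, isoCl_out, hr p hp, hr' p hp] at h'
      refine ⟨c * d⁻¹, fun _ => ⟨mul_ne_zero hc (inv_ne_zero hd), ?_⟩⟩
      rw [map_mul, DH.fromH_of, DH.fromH_of, h', smul_smul, inv_mul_cancel_right₀ hd, h]
    · exact ⟨0, fun h => absurd h hp⟩
  choose c hc using h₁
  have h₂ : DH.fromH k (∑ p ∈ s, (a p * c p) •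
      (HTwC.of k (r p).cplx * HTwC.of k (r' p).cplx.dag)) = 0 := by
    have h := congrArg (DH.K k γ * DH.KDag k δ * ·) hsum
    simp only [Finset.mul_sum, mul_zero, mul_smul_comm] at h
    rw [map_sum, ← h]
    refine Finset.sum_congr rfl fun p hp => ?_
    rw [map_smul, (hc p hp).2, smul_smul]
  obtain ⟨t, ht, h₃⟩ := DH.exists_mul_eq_zero k h₂
  obtain ⟨σ, σ', ε, ε', hσ, hσ', hmul⟩ := HTwC.exists_enlarge k ht
  choose d hd hmul using fun p : IsoCl A × K₀ A × K₀ A × IsoCl A =>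
    hmul _ _ (r p) (r' p)
  rw [Finset.mul_sum] at h₃
  have h₄ := HTwC.eq_zero_of_sum_smul_eq_zero k s
    (fun p => (σ _ (r p)).sumDag (σ' _ (r' p))) (fun p hp q hq ⟨e⟩ => ?_)
    (fun p => HTwC.of k (σ _ (r p)).cplx * HTwC.of k (σ' _ (r' p)).cplx.dag)
    (fun p _ => HTwC.of_mul_of_sub_mem k _ _) (fun p => a p * c p * d p) ?_
  · intro p hp
    have := h₄ p hp
    rw [mul_eq_zero, mul_eq_zero] at this
    rcases this with (h | h) | h
    · exact h
    · exact absurd h (hc p hp).1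
    · exact absurd h (hd p)
  · obtain ⟨⟨e₁⟩, h₁⟩ := sumDag_iso_left e
    obtain ⟨⟨e₂⟩, h₂⟩ := sumDag_iso_right e
    rw [hσ, hσ, hr p hp, hr q hq, add_left_inj, add_right_inj] at h₁
    rw [hσ', hσ', hr' p hp, hr' q hq, add_left_inj, add_right_inj] at h₂
    have h₃ := isoCl_eq_iff.2 ⟨e₁⟩
    have h₄ := isoCl_eq_iff.2 ⟨e₂⟩
    rw [isoCl_out, isoCl_out] at h₃ h₄
    exact Prod.ext h₃ (Prod.ext h₁ (Prod.ext h₂ h₄))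
  · rw [← h₃]
    refine Finset.sum_congr rfl fun p hp => ?_
    rw [mul_smul_comm, hmul, smul_smul]

variable (A) in
/-- The basis of the localized Hall algebra by the products `E_X * K_α * K_β† * F_Y`. -/
def DH.basis : Module.Basis (IsoCl A × K₀ A × K₀ A × IsoCl A) ℂ (DH k A) :=
  Module.Basis.mk (DH.linearIndependent_triangular k) (DH.span_triangular_eq_top k).ge

lemma DH.basis_apply (p : IsoCl A × K₀ A × K₀ A × IsoCl A) :
    DH.basis k A p = DH.triangular k A p :=
  Module.Basis.mk_apply ..

end LinearIndependence

/-! ### The triangular decomposition of the localized Hall algebra -/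

section Decomposition

lemma bijective_of_span_eq_top {ι V W : Type*} [AddCommGroup V] [Module ℂ V] [AddCommGroup W]
    [Module ℂ W] (f : V →ₗ[ℂ] W) (v : ι → V) (hv : Submodule.span ℂ (Set.range v) = ⊤)
    (hf : LinearIndependent ℂ (f ∘ v)) (hf' : Submodule.span ℂ (Set.range (f ∘ v)) = ⊤) :
    Function.Bijective f := by
  constructor
  · refine (injective_iff_map_eq_zero f).2 fun x hx => ?_
    have hx' : x ∈ Submodule.span ℂ (Set.range v) := hv ▸ Submodule.mem_top
    obtain ⟨l, rfl⟩ := (Finsupp.mem_span_range_iff_exists_finsupp).1 hx'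
    rw [map_finsuppSum] at hx
    simp only [map_smul] at hx
    rw [linearIndependent_iff.1 hf l hx, Finsupp.sum_zero_index]
  · rw [← LinearMap.range_eq_top, ← top_le_iff, ← hf', Submodule.span_le]
    rintro _ ⟨i, rfl⟩
    exact ⟨v i, rfl⟩

lemma span_tmul_range_eq_top {ι κ V W : Type*} [AddCommGroup V] [Module ℂ V] [AddCommGroup W]
    [Module ℂ W] {v : ι → V} {w : κ → W} (hv : Submodule.span ℂ (Set.range v) = ⊤)
    (hw : Submodule.span ℂ (Set.range w) = ⊤) :
    Submodule.span ℂ (Set.range fun p : ι × κ => v p.1 ⊗ₜ[ℂ] w p.2) = ⊤ := by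
  rw [← TensorProduct.map₂_mk_top_top_eq_top, ← hv, ← hw, Submodule.map₂_span_span,
    Set.image2_range]
  rfl

variable (k : Type w) [Field k] [Finite k] {A : Type u} [Category.{v} A] [Abelian A] [Linear k A]
  [EnoughProjectives A] [∀ X Y : A, Finite (X ⟶ Y)] [∀ X : A, HasProjectiveDimensionLE X 1]

variable (A) in
/-- The linear map `a ⊗ b ↦ I₊(a) * I₋(b)`. -/
def DH.mulMap : HTwE k A ⊗[ℂ] HTwE k A →ₗ[ℂ] DH k A :=
  LinearMap.mul' ℂ (DH k A) ∘ₗ TensorProduct.map (iPlus k).toLinearMap (iMinus k).toLinearMap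

lemma DH.mulMap_tmul (a b : HTwE k A) : DH.mulMap k A (a ⊗ₜ[ℂ] b) = iPlus k a * iMinus k b := rfl

lemma DH.E_mul_K_mul_F_mul_KDag (X Y : IsoCl A) (α β : K₀ A) :
    DH.E k X.out * DH.K k α * (DH.F k Y.out * DH.KDag k β) =
      tPar k ^ (-symEuler k A β (cl Y.out)) • DH.triangular k A (X, α, β, Y) := by
  rw [DH.F_comm_KDag, mul_smul_comm]
  congr 1
  change _ = DH.E k X.out * (DH.K k α * DH.KDag k β) * DH.F k Y.out
  simp only [mul_assoc]

lemma DH.mulMap_bijective : Function.Bijective (DH.mulMap k A) := by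
  -- Up to units, the map carries a spanning set to the triangular basis.
  let e : (IsoCl A × K₀ A) × (IsoCl A × K₀ A) → IsoCl A × K₀ A × K₀ A × IsoCl A :=
    fun p => (p.1.1, p.1.2, p.2.2, p.2.1)
  let c : (IsoCl A × K₀ A) × (IsoCl A × K₀ A) → ℂˣ := fun p =>
    Units.mk0 (tPar k ^ (-symEuler k A p.2.2 (cl p.2.1.out))) (tPar_zpow_ne_zero k _)
  have he : Function.Bijective e :=
    ⟨fun p q h => by
      simp only [e, Prod.mk.injEq] at h
      exact Prod.ext (Prod.ext h.1 h.2.1) (Prod.ext h.2.2.2 h.2.2.1),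
      fun p => ⟨((p.1, p.2.1), (p.2.2.2, p.2.2.1)), rfl⟩⟩
  have h : DH.mulMap k A ∘ (fun p : (IsoCl A × K₀ A) × (IsoCl A × K₀ A) =>
      (HTwE.of k p.1.1.out * HTwE.K k p.1.2) ⊗ₜ[ℂ] (HTwE.of k p.2.1.out * HTwE.K k p.2.2)) =
      c • (DH.triangular k A ∘ e) := by
    funext p
    refine (DH.mulMap_tmul k _ _).trans ?_
    rw [map_mul, map_mul, iPlus_of, iPlus_K, iMinus_of, iMinus_K]
    exact DH.E_mul_K_mul_F_mul_KDag k p.1.1 p.2.1 p.1.2 p.2.2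
  refine bijective_of_span_eq_top _ _
    (span_tmul_range_eq_top (HTwE.span_eq_top k) (HTwE.span_eq_top k)) ?_ ?_
  · rw [h]
    exact ((DH.linearIndependent_triangular k).comp e he.1).units_smul c
  · rw [h, eq_top_iff, ← DH.span_triangular_eq_top k, Submodule.span_le]
    rintro _ ⟨p, rfl⟩
    obtain ⟨q, rfl⟩ := he.2 p
    have := Submodule.smul_mem (Submodule.span ℂ (Set.range (c • (DH.triangular k A ∘ e))))
      (↑(c q)⁻¹ : ℂ) (Submodule.subset_span ⟨q, rfl⟩)
    rwa [Pi.smul_apply', Units.smul_def, smul_smul, Units.inv_mul, one_smul] at this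

end Decomposition

/-! ### The reduced localized Hall algebra -/

section Reduced

variable {A : Type u} [Category.{v} A] [Abelian A]

lemma twist_acyclic {M N : Z2Cplx A} (hM : M.Acyclic) (hN : N.Acyclic) (s : Cocycle M N) :
    (twist s).Acyclic := fun i =>
  (HomologicalComplex.exactAt_iff_isZero_homology _ _).2
    (((twistExt s).shortExact.homology_exact₂ i).isZero_of_both_zeros
      (((HomologicalComplex.exactAt_iff_isZero_homology _ _).1 (hN i)).eq_zero_of_src _)
      (((HomologicalComplex.exactAt_iff_isZero_homology _ _).1 (hM i)).eq_zero_of_tgt _))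

end Reduced

section Reduced

variable (k : Type w) [Field k] [Finite k] {A : Type u} [Category.{v} A] [Abelian A] [Linear k A]
  [EnoughProjectives A] [∀ X Y : A, Finite (X ⟶ Y)] [∀ X : A, HasProjectiveDimensionLE X 1]

lemma DH.K_cl_mul_KDag_cl {P : A} (hP : Projective P) : DH.K k (cl P) * DH.KDag k (cl P) =
    DH.of k ((ProjCplx.K hP).sum (ProjCplx.K hP).dag) := by
  rw [DH.K_cl k hP, DH.KDag_cl k hP, ← DH.fromH_of, ← DH.fromH_of, ← map_mul,
    HTwC.disk_mul_dag_disk k (ProjCplx.isDisk_K hP) (ProjCplx.isDisk_K hP), DH.fromH_of]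

/-- The relation attached to `K_P ⊕ K_P†` identifies `K_α†` with the inverse of `K_α`. -/
lemma DHRed.mk_K_mul_KDag (α : K₀ A) : DHRed.mk k A (DH.K k α * DH.KDag k α) = 1 := by
  have h {P : A} (hP : Projective P) : DHRed.mk k A (DH.K k (cl P) * DH.KDag k (cl P)) = 1 := by
    obtain ⟨e⟩ := dag_sumDag (ProjRes.zero hP) (ProjRes.zero hP)
    rw [DH.K_cl_mul_KDag_cl k hP]
    exact (RingQuot.mkAlgHom_rel ℂ ⟨_, twist_acyclic (ProjCplx.acyclic_K hP)
      (ProjCplx.acyclic_K_dag hP) 0, ⟨ObjectProperty.isoMk _ e.symm⟩, rfl, rfl⟩).trans (map_one _)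
  obtain ⟨P, Q, hP, hQ, rfl⟩ := K₀.induction_sub α
  have h₁ : DH.K k (cl P) * DH.KDag k (cl P) = DH.K k (cl P - cl Q) * DH.KDag k (cl P - cl Q) *
      (DH.K k (cl Q) * DH.KDag k (cl Q)) := by
    rw [mul_assoc, ← mul_assoc (DH.KDag k (cl P - cl Q)), ← DH.K_comm_KDag, mul_assoc (DH.K k _),
      ← mul_assoc (DH.K k (cl P - cl Q)), ← DH.K_add, ← DH.KDag_add, sub_add_cancel]
  have h₂ := h hP
  rwa [h₁, map_mul, h hQ, mul_one] at h₂

/-- A self-dual acyclic complex has class `K_α * K_α†` for some `α`. -/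
lemma DH.exists_of_eq_K_mul_KDag (M : ProjCplx A) (hM : M.obj.Acyclic)
    (h : Nonempty (M ≅ M.dag)) : ∃ α : K₀ A, DH.of k M = DH.K k α * DH.KDag k α := by
  obtain ⟨X, Y, r, r', ⟨e⟩⟩ := M.exists_iso_sumDag
  obtain ⟨h₁, h₂⟩ := isIso_of_acyclic_sumDag r r' fun i => (hM i).of_iso e
  obtain ⟨φ⟩ := h
  obtain ⟨ψ⟩ := dag_sumDag r r'
  have hP : cl r.P = cl r'.P :=
    (sumDag_iso_left (e.symm ≪≫ (ObjectProperty.ι _).mapIso φ ≪≫ dagIso e ≪≫ ψ)).2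
  refine ⟨cl r.P, ?_⟩
  nth_rw 2 [hP]
  rw [DH.of_congr k e, DH.K_cl k r.projP, DH.KDag_cl k r'.projP, ← DH.fromH_of,
    HTwC.of_sumDag_of_isIso k r r' h₁ h₂, map_mul]
  rfl

/-- The elements `K_β * K_β†` are central. -/
lemma DH.K_mul_KDag_comm (β : K₀ A) (x : DH k A) :
    DH.K k β * DH.KDag k β * x = x * (DH.K k β * DH.KDag k β) := by
  have hof (M : ProjCplx A) : DH.K k β * DH.KDag k β * DH.of k M =
      DH.of k M * (DH.K k β * DH.KDag k β) := by
    rw [mul_assoc, DH.KDag_comm_of, mul_smul_comm, ← mul_assoc, DH.K_comm_of, smul_mul_assoc,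
      smul_smul, ← tPar_zpow_add, neg_add_cancel, zpow_zero, one_smul, mul_assoc]
  have h : LinearMap.eqLocus (LinearMap.mulLeft ℂ (DH.K k β * DH.KDag k β))
      (LinearMap.mulRight ℂ (DH.K k β * DH.KDag k β)) = ⊤ := by
    refine DH.eq_top_of_mul_mem _ ?_ ?_ ?_
    · change DH.K k β * DH.KDag k β * 1 = 1 * (DH.K k β * DH.KDag k β)
      rw [mul_one, one_mul]
    · intro M x hx
      change DH.K k β * DH.KDag k β * (_ * x) = _ * x * (DH.K k β * DH.KDag k β)
      change DH.K k β * DH.KDag k β * x = x * (DH.K k β * DH.KDag k β) at hx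
      rw [← mul_assoc, hof, mul_assoc, hx, mul_assoc]
    · intro M hM x hx
      change DH.K k β * DH.KDag k β * (_ * x) = _ * x * (DH.K k β * DH.KDag k β)
      change DH.K k β * DH.KDag k β * x = x * (DH.K k β * DH.KDag k β) at hx
      have hc : Commute (DH.K k β * DH.KDag k β) (DH.inv k M hM) := by
        let m : (DH k A)ˣ := ⟨_, _, DH.of_mul_inv M hM, DH.inv_mul_of M hM⟩
        have : Commute (DH.K k β * DH.KDag k β) (m : DH k A) := hof M
        exact this.units_inv_right
      rw [← mul_assoc, hc.eq, mul_assoc, hx, mul_assoc]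
  exact (h ▸ Submodule.mem_top : x ∈ LinearMap.eqLocus (LinearMap.mulLeft ℂ _)
    (LinearMap.mulRight ℂ _))

variable (A) in
/-- The left ideal generated by the central elements `K_β * K_β† - 1`. -/
def DH.redIdeal : Ideal (DH k A) :=
  Ideal.span (Set.range fun β : K₀ A => DH.K k β * DH.KDag k β - 1)

/-- The kernel of the quotient map to the reduced localized Hall algebra is generated by the
elements `K_β * K_β† - 1`. -/
lemma DHRed.mem_redIdeal_of_mk_eq_zero {x : DH k A} (hx : DHRed.mk k A x = 0) :
    x ∈ DH.redIdeal k A := by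
  let ρ : DHRed k A →ₐ[ℂ] Module.End ℂ (DH k A ⧸ DH.redIdeal k A) :=
    RingQuot.liftAlgHom ℂ ⟨Algebra.lsmul ℂ ℂ (DH k A ⧸ DH.redIdeal k A), by
      rintro _ _ ⟨M, hM, e, rfl, rfl⟩
      obtain ⟨α, h⟩ := DH.exists_of_eq_K_mul_KDag k M hM e
      refine LinearMap.ext fun y => ?_
      obtain ⟨y, rfl⟩ := Submodule.Quotient.mk_surjective _ y
      rw [h, map_one]
      refine (Submodule.Quotient.eq _).2 ?_
      change DH.K k α * DH.KDag k α * y - y ∈ _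
      rw [DH.K_mul_KDag_comm, ← mul_sub_one]
      exact Ideal.mul_mem_left _ _ (Ideal.subset_span ⟨α, rfl⟩)⟩
  have h : ρ (DHRed.mk k A x) = Algebra.lsmul ℂ ℂ (DH k A ⧸ DH.redIdeal k A) x :=
    RingQuot.liftAlgHom_mkAlgHom_apply ..
  rw [hx, map_zero] at h
  have h₁ := LinearMap.congr_fun h (Submodule.Quotient.mk 1)
  have h₂ : (Submodule.Quotient.mk (x • 1) : DH k A ⧸ DH.redIdeal k A) = 0 := h₁.symm
  rwa [smul_eq_mul, mul_one, Submodule.Quotient.mk_eq_zero] at h₂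

variable (A) in
/-- The linear map `E_X * K_α * K_β† * F_Y ↦ (X, α - β, Y)`. -/
def DH.collapse : DH k A →ₗ[ℂ] (IsoCl A × K₀ A × IsoCl A →₀ ℂ) :=
  (DH.basis k A).constr ℂ fun p => Finsupp.single (p.1, p.2.1 - p.2.2.1, p.2.2.2) 1

lemma DH.collapse_triangular (p : IsoCl A × K₀ A × K₀ A × IsoCl A) :
    DH.collapse k A (DH.triangular k A p) =
      Finsupp.single (p.1, p.2.1 - p.2.2.1, p.2.2.2) 1 := by
  rw [← DH.basis_apply]
  exact Module.Basis.constr_basis ..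

lemma DH.triangular_mul_K_mul_KDag (X Y : IsoCl A) (α β γ : K₀ A) :
    DH.triangular k A (X, α, γ, Y) * (DH.K k β * DH.KDag k β) =
      DH.triangular k A (X, α + β, γ + β, Y) := by
  change DH.E k X.out * (DH.K k α * DH.KDag k γ) * DH.F k Y.out * (DH.K k β * DH.KDag k β) =
    DH.E k X.out * (DH.K k (α + β) * DH.KDag k (γ + β)) * DH.F k Y.out
  have h : DH.K k (α + β) * DH.KDag k (γ + β) =
      DH.K k α * DH.KDag k γ * (DH.K k β * DH.KDag k β) := by
    rw [DH.K_add, DH.KDag_add, mul_assoc, mul_assoc, ← mul_assoc (DH.KDag k γ),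
      ← DH.K_comm_KDag k β γ]
    simp only [mul_assoc]
  rw [mul_assoc, ← DH.K_mul_KDag_comm, h]
  simp only [mul_assoc]

lemma DH.collapse_eq_zero {x : DH k A} (hx : x ∈ DH.redIdeal k A) : DH.collapse k A x = 0 := by
  have hz (β : K₀ A) (y : DH k A) :
      DH.collapse k A (y * (DH.K k β * DH.KDag k β)) = DH.collapse k A y := by
    suffices h : DH.collapse k A ∘ₗ LinearMap.mulRight ℂ (DH.K k β * DH.KDag k β) =
        DH.collapse k A from LinearMap.congr_fun h y
    refine (DH.basis k A).ext fun ⟨X, α, γ, Y⟩ => ?_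
    rw [DH.basis_apply, LinearMap.comp_apply, LinearMap.mulRight_apply,
      DH.triangular_mul_K_mul_KDag, DH.collapse_triangular, DH.collapse_triangular,
      add_sub_add_right_eq_sub]
  suffices h : ∀ y, DH.collapse k A (y * x) = 0 by
    rw [← one_mul x]
    exact h 1
  induction hx using Submodule.span_induction with
  | mem x hx =>
    obtain ⟨β, rfl⟩ := hx
    intro y
    change DH.collapse k A (y * (DH.K k β * DH.KDag k β - 1)) = 0
    rw [mul_sub, mul_one, map_sub, hz, sub_self]
  | zero => intro y; rw [mul_zero, map_zero]
  | add x x' _ _ hx hx' => intro y; rw [mul_add, map_add, hx, hx', add_zero]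
  | smul c x _ hx => intro y; rw [smul_eq_mul, ← mul_assoc, hx]

variable (A) in
/-- The elements `E_X * K_α * F_Y` of the reduced localized Hall algebra. -/
def DHRed.triangular (p : IsoCl A × K₀ A × IsoCl A) : DHRed k A :=
  DHRed.mk k A (DH.E k p.1.out * DH.K k p.2.1 * DH.F k p.2.2.out)

/-- A relation in the quotient is a relation modulo `DH.redIdeal`, and `DH.collapse` vanishes
there. -/
lemma DHRed.linearIndependent_triangular : LinearIndependent ℂ (DHRed.triangular k A) := by
  rw [linearIndependent_iff]
  intro l hl
  have h : Finsupp.linearCombination ℂ (DHRed.triangular k A) l = DHRed.mk k A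
      (Finsupp.linearCombination ℂ
        (fun p : IsoCl A × K₀ A × IsoCl A => DH.triangular k A (p.1, p.2.1, 0, p.2.2)) l) := by
    rw [Finsupp.linearCombination_apply, Finsupp.linearCombination_apply, map_finsuppSum]
    refine Finsupp.sum_congr fun p _ => ?_
    rw [map_smul]
    change _ = _ • DHRed.mk k A (DH.E k p.1.out * (DH.K k p.2.1 * DH.KDag k 0) * DH.F k p.2.2.out)
    rw [DH.KDag_zero, mul_one]
    rfl
  rw [h] at hl
  have h₁ := DH.collapse_eq_zero k (DHRed.mem_redIdeal_of_mk_eq_zero k hl)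
  rw [Finsupp.linearCombination_apply, map_finsuppSum] at h₁
  simp only [map_smul, DH.collapse_triangular, sub_zero, Finsupp.smul_single, smul_eq_mul,
    mul_one] at h₁
  exact (Finsupp.sum_single l).symm.trans h₁

lemma DHRed.span_triangular_eq_top :
    Submodule.span ℂ (Set.range (DHRed.triangular k A)) = ⊤ := by
  refine eq_top_iff.2 fun x _ => ?_
  obtain ⟨y, rfl⟩ := RingQuot.mkAlgHom_surjective ℂ _ x
  have hy : y ∈ Submodule.span ℂ (Set.range (DH.triangular k A)) :=
    (DH.span_triangular_eq_top (A := A) k).ge Submodule.mem_top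
  change y ∈ (Submodule.span ℂ (Set.range (DHRed.triangular k A))).comap
    (DHRed.mk k A).toLinearMap
  refine Submodule.span_le.2 ?_ hy
  rintro _ ⟨⟨X, α, β, Y⟩, rfl⟩
  refine Submodule.subset_span ⟨(X, α - β, Y), ?_⟩
  have h : DH.triangular k A (X, α, β, Y) =
      DH.K k β * DH.KDag k β * (DH.E k X.out * DH.K k (α - β) * DH.F k Y.out) := by
    rw [DH.K_mul_KDag_comm]
    have := DH.triangular_mul_K_mul_KDag k X Y (α - β) β 0
    rw [sub_add_cancel, zero_add] at this
    rw [← this]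
    change DH.E k X.out * (DH.K k (α - β) * DH.KDag k 0) * DH.F k Y.out * _ = _
    rw [DH.KDag_zero, mul_one]
  change _ = DHRed.mk k A (DH.triangular k A (X, α, β, Y))
  rw [h, map_mul, DHRed.mk_K_mul_KDag, one_mul]
  rfl

/-- The linear map `[X] ↦ F_X`. -/
def HTw.toDHDag : HTw k A →ₗ[ℂ] DH k A := (DH.dagHom k).toLinearMap ∘ₗ HTw.toDH k

lemma HTw.toDHDag_of (X : A) : HTw.toDHDag k (HTw.of k X) = DH.F k X :=
  congrArg (DH.dagHom k) (HTw.toDH_of k X)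

/-- The algebra homomorphism `α ↦ K_α`. -/
def DH.groupAlgebraHom : AddMonoidAlgebra ℂ (K₀ A) →ₐ[ℂ] DH k A :=
  AddMonoidAlgebra.lift ℂ (DH k A) (K₀ A)
    { toFun := fun α => DH.K k α.toAdd
      map_one' := DH.K_zero k
      map_mul' := fun α β => DH.K_add k α.toAdd β.toAdd }

lemma DH.groupAlgebraHom_single (α : K₀ A) :
    DH.groupAlgebraHom k (AddMonoidAlgebra.single α 1) = DH.K k α :=
  (AddMonoidAlgebra.lift_single _ _ _).trans (one_smul _ _)

variable (A) in
/-- The linear map `[X] ⊗ α ⊗ [Y] ↦ E_X * K_α * F_Y`. -/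
def DHRed.mulMap : HTw k A ⊗[ℂ] AddMonoidAlgebra ℂ (K₀ A) ⊗[ℂ] HTw k A →ₗ[ℂ] DHRed k A :=
  (DHRed.mk k A).toLinearMap ∘ₗ LinearMap.mul' ℂ (DH k A) ∘ₗ TensorProduct.map
    (LinearMap.mul' ℂ (DH k A) ∘ₗ
      TensorProduct.map (HTw.toDH k) (DH.groupAlgebraHom k).toLinearMap) (HTw.toDHDag k)

lemma DHRed.mulMap_tmul (X Y : A) (α : K₀ A) :
    DHRed.mulMap k A (HTw.of k X ⊗ₜ[ℂ] AddMonoidAlgebra.single α 1 ⊗ₜ[ℂ] HTw.of k Y) =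
      DHRed.mk k A (DH.E k X * DH.K k α * DH.F k Y) := by
  rw [← HTw.toDH_of, ← HTw.toDHDag_of, ← DH.groupAlgebraHom_single]
  rfl

lemma HTw.span_of_eq_top :
    Submodule.span ℂ (Set.range fun x : IsoCl A => HTw.of k x.out) = ⊤ := by
  refine eq_top_iff.2 fun x _ => ?_
  refine HTw.induction k
    (p := fun x => x ∈ Submodule.span ℂ (Set.range fun x : IsoCl A => HTw.of k x.out))
    (Submodule.zero_mem _) (fun _ _ => Submodule.add_mem _) (fun c _ => Submodule.smul_mem _ c)
    (fun X => Submodule.subset_span ⟨isoCl X, HTw.of_congr k (outIso X)⟩) x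

lemma span_single_eq_top {G : Type*} : Submodule.span ℂ
    (Set.range fun g : G => (AddMonoidAlgebra.single g 1 : AddMonoidAlgebra ℂ G)) = ⊤ := by
  refine eq_top_iff.2 fun x _ => ?_
  induction x using AddMonoidAlgebra.induction_linear with
  | zero => exact Submodule.zero_mem _
  | add x y hx hy => exact Submodule.add_mem _ (hx trivial) (hy trivial)
  | single g c =>
    have h := Submodule.smul_mem (Submodule.span ℂ
      (Set.range fun g : G => (AddMonoidAlgebra.single g 1 : AddMonoidAlgebra ℂ G))) c
      (Submodule.subset_span ⟨g, rfl⟩)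
    simpa using h

lemma DHRed.mulMap_bijective : Function.Bijective (DHRed.mulMap k A) := by
  let e : IsoCl A × K₀ A × IsoCl A ≃ (IsoCl A × K₀ A) × IsoCl A := (Equiv.prodAssoc _ _ _).symm
  have h : DHRed.mulMap k A ∘ (fun p : (IsoCl A × K₀ A) × IsoCl A =>
      HTw.of k p.1.1.out ⊗ₜ[ℂ] AddMonoidAlgebra.single p.1.2 1 ⊗ₜ[ℂ] HTw.of k p.2.out) =
      DHRed.triangular k A ∘ e.symm :=
    funext fun p => DHRed.mulMap_tmul k p.1.1.out p.2.out p.1.2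
  refine bijective_of_span_eq_top _ _ (span_tmul_range_eq_top
    (span_tmul_range_eq_top (HTw.span_of_eq_top k) span_single_eq_top) (HTw.span_of_eq_top k)) ?_ ?_
  · refine (congrArg (fun v => LinearIndependent ℂ v) h).mpr ?_
    exact (DHRed.linearIndependent_triangular k).comp _ e.symm.injective
  · refine (congrArg (fun v => Submodule.span ℂ (Set.range v)) h).trans ?_
    rw [e.symm.surjective.range_comp, DHRed.span_triangular_eq_top]

end Reduced

end HallComplexes

end

theorem mainTheorem3 {k : Type w} [Field k] [Finite k]
    {A : Type u} [Category.{v} A] [Abelian A] [Linear k A]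
    [∀ X Y : A, Finite (X ⟶ Y)] [EnoughProjectives A]
    [∀ X : A, HasProjectiveDimensionLE X 1]
    (hK : ∀ X : A, cl X = 0 → IsZero X) :
    (∃! I : HTwE k A →ₐ[ℂ] DH k A, IsIPlus k I) ∧
    (∃! I : HTwE k A →ₐ[ℂ] DH k A, IsIMinus k I) ∧
    ∀ Ip Im : HTwE k A →ₐ[ℂ] DH k A, IsIPlus k Ip → IsIMinus k Im →
      (∃ μ : (HTwE k A ⊗[ℂ] HTwE k A) ≃ₗ[ℂ] DH k A,
        ∀ a b : HTwE k A, μ (a ⊗ₜ[ℂ] b) = Ip a * Im b) ∧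
      (∃ τ : (HTw k A ⊗[ℂ] AddMonoidAlgebra ℂ (K₀ A) ⊗[ℂ] HTw k A) ≃ₗ[ℂ] DHRed k A,
        ∀ (X Y : A) (α : K₀ A),
          τ (HTw.of k X ⊗ₜ[ℂ] AddMonoidAlgebra.single α 1 ⊗ₜ[ℂ] HTw.of k Y) =
            DHRed.mk k A (Ip (HTwE.of k X) * Ip (HTwE.K k α) * Im (HTwE.of k Y))) := by
  refine ⟨⟨iPlus k, (isIPlus_iff k _).2 rfl, fun I => (isIPlus_iff k I).1⟩,
    ⟨iMinus k, (isIMinus_iff k _).2 rfl, fun I => (isIMinus_iff k I).1⟩, ?_⟩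
  intro Ip Im hIp hIm
  obtain rfl := (isIPlus_iff k Ip).1 hIp
  obtain rfl := (isIMinus_iff k Im).1 hIm
  refine ⟨⟨LinearEquiv.ofBijective _ (DH.mulMap_bijective k), DH.mulMap_tmul k⟩,
    ⟨LinearEquiv.ofBijective _ (DHRed.mulMap_bijective k), fun X Y α => ?_⟩⟩
  rw [iPlus_of, iPlus_K, iMinus_of]
  exact DHRed.mulMap_tmul k X Y α
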